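/- Let $I=(-1,1)$ and $\mu,\alpha,\beta,\gamma\in\mathbb C$. All singular integrals are Cauchy principal values (symmetric excision of the singularity). Let $L^2_d(I)$, resp. $L^2_m(I)$, be the space of measurable $f:I\to\mathbb C$ with $\int_{-1}^1|f(t)|^2(1-t^2)^{-1/2}dt<\infty$, resp. $\int_{-1}^1|f(t)|^2(1-t^2)^{1/2}dt<\infty$. Write $$F_\mu(s)=\frac1\pi\int_{-1}^1\frac{\cosh[\mu(s-t)]}{s-t}f(t)\,dt,\qquad q(s)=\alpha s^2+\beta s+\gamma .$$ (i) For all $t,u\in I$ the following principal value exists and $$\frac1\pi\int_{-1}^1\frac{\cosh[\mu(u-s)]}{t-s}\,\frac{q(s)}{\sqrt{1-s^2}}\cosh(i\mu\sqrt{1-s^2})\,ds = i\sinh[\mu(t-u)]\sinh(i\mu\sqrt{1-t^2})\frac{q(t)}{\sqrt{1-t^2}}-(\alpha t+\beta)\cosh(\mu u)+\frac{\alpha\mu}{2}\sinh(\mu u).$$ (ii) Suppose $q(t)\neq0$ for all $t\in I$, and let $f\in L^2_d(I)$; if moreover $q(-1)=q(1)=0$, it suffices that $f\in L^2_m(I)$.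 Then $F_\mu$ exists a.e. on $I$, $\int_{-1}^1\cosh(\mu t)f(t)\,dt$ converges absolutely, and for a.e. $t\in I$ the principal values below exist and $$\begin{aligned}f(t)={}&\frac{\sqrt{1-t^2}}{q(t)}\cosh(i\mu\sqrt{1-t^2})\Big[\frac1\pi\int_{-1}^1\frac{F_\mu(s)}{s-t}\cosh(i\mu\sqrt{1-s^2})\frac{q(s)}{\sqrt{1-s^2}}\,ds\Big]\\ &-\frac{\alpha\sqrt{1-t^2}}{q(t)}\cosh(i\mu\sqrt{1-t^2})\Big[\frac1\pi\int_{-1}^1\cosh(\mu \tau)f(\tau)\,d\tau\Big]\\ &-\sinh(i\mu\sqrt{1-t^2})\Big[\frac1\pi\int_{-1}^1\frac{F_\mu(s)}{s-t}\sinh(i\mu\sqrt{1-s^2})\,ds\Big].\end{aligned}$$ If $\alpha\ne0$, the moment is really needed: for such an $f$, the formula with the middle line omitted holds for a.e. $t$ if and only if $\int_{-1}^1\cosh(\mu \tau)f(\tau)\,d\tau=0$. (iii) The cases $\alpha=0$, $\beta=\pm1$, $\gamma=1$ give two moment-free formulas: for $f\in L^2_d(I)$ and either choice of sign, $F_\mu$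 exists a.e. on $I$, and for a.e. $t\in I$ the principal values below exist and $$f(t)=\frac{1\pm t}{\sqrt{1-t^2}}\cosh(i\mu\sqrt{1-t^2})\Big[\frac1\pi\int_{-1}^1\frac{F_\mu(s)}{s-t}\cosh(i\mu\sqrt{1-s^2})\frac{\sqrt{1-s^2}}{1\pm s}\,ds\Big]-\sinh(i\mu\sqrt{1-t^2})\Big[\frac1\pi\int_{-1}^1\frac{F_\mu(s)}{s-t}\sinh(i\mu\sqrt{1-s^2})\,ds\Big].$$ -/

import Mathlib

open MeasureTheory Filter Topology Set

noncomputable section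

namespace CoshFHT

/-- The interval `(-1,1)` with the part within distance `ε` of `x` removed. -/
def cutInterval (x ε : ℝ) : Set ℝ := {s | s ∈ Ioo (-1 : ℝ) 1 ∧ ε < |s - x|}

/-- The integral of `g` over `(-1,1)` exists as a Cauchy principal value at `x`: all truncated
integrals converge absolutely and they have a limit as the symmetric cut shrinks to `x`. -/
def PVExists (g : ℝ → ℂ) (x : ℝ) : Prop :=
  (∀ ε > 0, IntegrableOn g (cutInterval x ε)) ∧
    ∃ L : ℂ, Tendsto (fun ε : ℝ => ∫ s in cutInterval x ε, g s) (𝓝[>] 0) (𝓝 L)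

/-- The Cauchy principal value at `x` of the integral of `g` over `(-1,1)`
(meaningful when `PVExists g x`). -/
def pv (g : ℝ → ℂ) (x : ℝ) : ℂ :=
  limUnder (𝓝[>] (0 : ℝ)) (fun ε : ℝ => ∫ s in cutInterval x ε, g s)

/-- The function `√(1 - s²)`. -/
def rt (s : ℝ) : ℝ := Real.sqrt (1 - s ^ 2)

/-- `f ∈ L²_d(I)`: measurable with `∫ |f|² / √(1 - t²) < ∞`. -/
def MemLd (f : ℝ → ℂ) : Prop :=
  AEStronglyMeasurable f (volume.restrict (Ioo (-1 : ℝ) 1)) ∧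
    IntegrableOn (fun t => ‖f t‖ ^ 2 / rt t) (Ioo (-1 : ℝ) 1)

/-- `f ∈ L²_m(I)`: measurable with `∫ |f|² √(1 - t²) < ∞`. -/
def MemLm (f : ℝ → ℂ) : Prop :=
  AEStronglyMeasurable f (volume.restrict (Ioo (-1 : ℝ) 1)) ∧
    IntegrableOn (fun t => ‖f t‖ ^ 2 * rt t) (Ioo (-1 : ℝ) 1)

/-- The integrand `cosh[μ(s-t)] f(t) / (s-t)`, as a function of `t`, of the cosh-weighted finite
Hilbert transform of `f` at `s`. -/
def coshIntegrand (μ : ℂ) (f : ℝ → ℂ) (s t : ℝ) : ℂ :=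
  Complex.cosh (μ * (s - t)) / (s - t) * f t

/-- The cosh-weighted finite Hilbert transform `F_μ = H_μ f`. -/
def coshFHT (μ : ℂ) (f : ℝ → ℂ) (s : ℝ) : ℂ :=
  1 / (Real.pi : ℂ) * pv (coshIntegrand μ f s) s

/-- The function `cosh(iμ√(1 - s²))`. -/
def coshR (μ : ℂ) (s : ℝ) : ℂ := Complex.cosh (Complex.I * μ * rt s)

/-- The function `sinh(iμ√(1 - s²))`. -/
def sinhR (μ : ℂ) (s : ℝ) : ℂ := Complex.sinh (Complex.I * μ * rt s)

/-- The quadratic `αs² + βs + γ`. -/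
def quad (α β γ : ℂ) (s : ℝ) : ℂ := α * s ^ 2 + β * s + γ

/-- The integrand `F_μ(s) w(s) / (s-t)`, as a function of `s`, with `F_μ = H_μ f`. -/
def invIntegrand (μ : ℂ) (f w : ℝ → ℂ) (t s : ℝ) : ℂ :=
  coshFHT μ f s / (s - t) * w s

/-- The weighted inner transform `(1/π) p.v.∫ F_μ(s) w(s) / (s-t) ds` with `F_μ = H_μ f`. -/
def invTerm (μ : ℂ) (f w : ℝ → ℂ) (t : ℝ) : ℂ :=
  1 / (Real.pi : ℂ) * pv (invIntegrand μ f w t) t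

/-- The moment `∫ cosh(μt) f(t) dt` over `(-1,1)`. -/
def moment (μ : ℂ) (f : ℝ → ℂ) : ℂ :=
  ∫ t in Ioo (-1 : ℝ) 1, Complex.cosh (μ * t) * f t

end CoshFHT

end

noncomputable section

namespace CoshFHT

open Polynomial.Chebyshev (measureT T U)

/-! ### Poisson type kernels at Lebesgue points -/

/-! Everything takes place in `LpT`, the space `L²` of the measure `dx / √(1 - x²)`. It is
`L²_d(I)`, and `f ∈ L²_m(I)` is encoded by the class `h = √(1 - t²) f` in it. Write `r = √(1 - x²)`,
let `H` have kernel `1 / (π(t - s))`, and let `S` be the bounded operator `h ↦ (1 - t²) H(h / r)`.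

The algebraic core is Tricomi's product identity `S v S = -r² v + X S - S X`, where `v` and `X` act
by multiplication and `X = H(r v)`. For `v = U_m`, `X = T_{m+1}` it can be checked on each `T_n` by
angle addition (`tricomi_uC`). It is linear and norm continuous in the pair `(v, X)`, so it passes
to uniformly convergent series. Since `x ± i r = e^{± iθ}`, the exponential series give `∑ νᵏ T_k /
k! = e^{νx} cosh(iνr)` and `∑ νᵏ r U_{k-1} / k! = -i e^{νx} sinh(iνr)`. Taking `ν = ±μ`, conjugating
by exponentials and averaging turns `S` into the cosh-weighted transform. Two identities result
(`hilbS_mul_coshC_mul_coshS` and `hilbS_mul_sincC_mul_coshS`). Both contain the transform with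
kernel `sinh[μ(s - t)] / (s - t)`; it is eliminated with `cosh² - sinh² = 1`. This gives inversion
with weight `√(1 - s²)` and a moment term coming from the commutator of `x` with `S`
(`ae_inversion_rt`).

To reach the weight `q(s) / √(1 - s²)`, divide the density by `1 - s²` and multiply it by `q`. Both
operations change the principal value only through the integrals of `g` and `s g`, where `g = F_μ
cosh(iμr) / r`. For `f ∈ L²_d(I)` these are `0` and the moment (`intT_coshC_coshT`,
`intT_xC_coshC_coshT`). If `q(±1) = 0`, then `q = -α(1 - s²)` and the new weight is a constant
multiple of the old one.

Principal values enter through the isometry `hilbT`, which sends `r U_n` to `T_{n+1}`. At a Lebesgue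
point of `f` the truncated integrals have the same limit as the conjugate Abel–Poisson means of `f`.
These are the Abel–Poisson means of `hilbT f`, which converge at the Lebesgue points of `hilbT f`
(`hasPV_of_isLebesguePt`). For continuous data this covers every point, as the identity (i)
requires. -/

theorem poisson_le_sum_indicator {ε u : ℝ} (hε : 0 < ε) {N : ℕ} (hu : |u| ≤ 2 ^ N * ε) :
    ε / (u ^ 2 + ε ^ 2) ≤ ∑ k ∈ Finset.range (N + 1),
      4 * (1 / 4) ^ k / ε * (if |u| ≤ 2 ^ k * ε then 1 else 0) := by
  classical
  have hex : ∃ k, |u| ≤ 2 ^ k * ε := ⟨N, hu⟩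
  -- Only the least dyadic scale containing `u` is needed. There `|u|` exceeds half the scale,
  -- unless `k = 0`, so the kernel is at most `4 · 4⁻ᵏ / ε`.
  set k := Nat.find hex with hk
  have hk1 : |u| ≤ 2 ^ k * ε := Nat.find_spec hex
  have hkN : k ≤ N := Nat.find_min' hex hu
  have key : ε / (u ^ 2 + ε ^ 2) ≤ 4 * (1 / 4) ^ k / ε := by
    rw [div_le_div_iff₀ (by positivity) hε]
    rcases Nat.eq_zero_or_pos k with h0 | hpos
    · rw [h0]; nlinarith [sq_nonneg u, sq_nonneg ε]
    · obtain ⟨j, hj⟩ : ∃ j, k = j + 1 := ⟨k - 1, by omega⟩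
      have hj2 : 2 ^ j * ε < |u| := by
        have := Nat.find_min hex (m := j) (by omega)
        exact not_le.mp this
      have h2 : (2 ^ j * ε) ^ 2 ≤ u ^ 2 := by
        rw [← sq_abs u]; gcongr
      have h4 : ((1 : ℝ) / 4) ^ j * (2 ^ j) ^ 2 = 1 := by
        rw [← pow_mul, mul_comm j 2, pow_mul, ← mul_pow]; norm_num
      rw [hj, pow_succ]
      have h5 : ((1 : ℝ) / 4) ^ j * (2 ^ j * ε) ^ 2 ≤ (1 / 4) ^ j * u ^ 2 := by gcongr
      have h6 : 0 ≤ ((1 : ℝ) / 4) ^ j * ε ^ 2 := by positivity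
      have h7 : ((1 : ℝ) / 4) ^ j * (2 ^ j * ε) ^ 2 = ε ^ 2 := by
        rw [mul_pow, ← mul_assoc, h4, one_mul]
      nlinarith
  refine key.trans ?_
  have := Finset.single_le_sum
    (f := fun k => 4 * (1 / 4 : ℝ) ^ k / ε * (if |u| ≤ 2 ^ k * ε then 1 else 0))
    (fun i _ => by positivity) (Finset.mem_range.mpr (Nat.lt_succ_of_le hkN))
  simpa [hk1] using this

/-- The dyadic majorant has height `4 · 4⁻ᵏ / ε` on the ball of radius `2ᵏ ε`, whose mass is at most
`η 2ᵏ ε`. The contributions `4 η 2⁻ᵏ` form a geometric series. -/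
theorem integral_ball_mul_poisson_le {ν : Measure ℝ} {φ : ℝ → ℝ} (hφ : Integrable φ ν)
    (h0 : ∀ x, 0 ≤ φ x) {y η δ₀ ε : ℝ} (hδ₀ : 0 < δ₀) (hε : 0 < ε)
    (hL : ∀ δ ∈ Ioc 0 δ₀, ∫ x in Metric.closedBall y δ, φ x ∂ν ≤ η * δ) :
    ∫ x in Metric.closedBall y δ₀, φ x * (ε / ((x - y) ^ 2 + ε ^ 2)) ∂ν ≤ 8 * η := by
  obtain ⟨N, hN⟩ := pow_unbounded_of_one_lt (δ₀ / ε) (one_lt_two (α := ℝ))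
  have hN' : δ₀ ≤ 2 ^ N * ε := by
    rw [div_lt_iff₀ hε] at hN; exact hN.le
  have hη : 0 ≤ η := by
    have h1 := hL δ₀ ⟨hδ₀, le_rfl⟩
    have h2 : 0 ≤ ∫ x in Metric.closedBall y δ₀, φ x ∂ν := integral_nonneg h0
    by_contra hneg
    nlinarith
  have hint : ∀ k : ℕ, Integrable (fun x => 4 * (1 / 4 : ℝ) ^ k / ε *
      (Metric.closedBall y (2 ^ k * ε)).indicator φ x)
      (ν.restrict (Metric.closedBall y δ₀)) := fun k =>
    ((hφ.restrict).indicator Metric.isClosed_closedBall.measurableSet).const_mul _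
  calc ∫ x in Metric.closedBall y δ₀, φ x * (ε / ((x - y) ^ 2 + ε ^ 2)) ∂ν
      ≤ ∫ x in Metric.closedBall y δ₀, ∑ k ∈ Finset.range (N + 1),
          4 * (1 / 4 : ℝ) ^ k / ε * (Metric.closedBall y (2 ^ k * ε)).indicator φ x ∂ν := by
        refine integral_mono_of_nonneg (ae_of_all _ fun x => ?_)
          (integrable_finsetSum _ fun k _ => hint k) ?_
        · exact mul_nonneg (h0 x) (by positivity)
        · filter_upwards [ae_restrict_mem Metric.isClosed_closedBall.measurableSet] with x hx
          have hx' : |x - y| ≤ 2 ^ N * ε := by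
            rw [Metric.mem_closedBall, Real.dist_eq] at hx; exact hx.trans hN'
          have := mul_le_mul_of_nonneg_left (poisson_le_sum_indicator hε hx') (h0 x)
          refine this.trans (le_of_eq ?_)
          rw [Finset.mul_sum]
          refine Finset.sum_congr rfl fun k _ => ?_
          simp only [indicator, Metric.mem_closedBall, Real.dist_eq]
          split_ifs <;> ring
    _ = ∑ k ∈ Finset.range (N + 1), 4 * (1 / 4 : ℝ) ^ k / ε *
          ∫ x in Metric.closedBall y δ₀ ∩ Metric.closedBall y (2 ^ k * ε), φ x ∂ν := by
        rw [integral_finsetSum _ fun k _ => hint k]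
        refine Finset.sum_congr rfl fun k _ => ?_
        rw [integral_const_mul, setIntegral_indicator Metric.isClosed_closedBall.measurableSet]
    _ ≤ ∑ k ∈ Finset.range (N + 1), 4 * η * (1 / 2 : ℝ) ^ k := by
        refine Finset.sum_le_sum fun k _ => ?_
        have h1 : Metric.closedBall y δ₀ ∩ Metric.closedBall y (2 ^ k * ε)
            = Metric.closedBall y (min δ₀ (2 ^ k * ε)) := by
          ext x; simp [Metric.mem_closedBall]
        have h2 : ∫ x in Metric.closedBall y (min δ₀ (2 ^ k * ε)), φ x ∂ν
            ≤ η * (2 ^ k * ε) :=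
          (hL _ ⟨lt_min hδ₀ (by positivity), min_le_left _ _⟩).trans
            (mul_le_mul_of_nonneg_left (min_le_right _ _) hη)
        rw [h1]
        calc 4 * (1 / 4 : ℝ) ^ k / ε * _ ≤ 4 * (1 / 4 : ℝ) ^ k / ε * (η * (2 ^ k * ε)) := by
              gcongr
          _ = 4 * η * ((1 / 4 : ℝ) ^ k * 2 ^ k) := by field_simp
          _ = 4 * η * (1 / 2 : ℝ) ^ k := by rw [← mul_pow]; norm_num
    _ ≤ 8 * η := by
        rw [← Finset.mul_sum]
        have := sum_geometric_two_le (N + 1)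
        nlinarith

/-- The Poisson type means of a function vanish in the limit at a point where its averages do. -/
theorem tendsto_integral_mul_poisson {ν : Measure ℝ} {φ : ℝ → ℝ} (hφ : Integrable φ ν)
    (h0 : ∀ x, 0 ≤ φ x) {y : ℝ}
    (hL : Tendsto (fun δ => δ⁻¹ * ∫ x in Metric.closedBall y δ, φ x ∂ν) (𝓝[>] 0) (𝓝 0)) :
    Tendsto (fun ε => ∫ x, φ x * (ε / ((x - y) ^ 2 + ε ^ 2)) ∂ν) (𝓝[>] 0) (𝓝 0) := by
  rw [Metric.tendsto_nhds]
  intro η hη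
  -- The near part costs `8 · η / 16 = η / 2`. The far part, where the kernel is at most `ε / δ₀²`,
  -- is left `η / 4`.
  have h1 := (Metric.tendsto_nhds.mp hL) (η / 16) (by positivity)
  rw [eventually_nhdsWithin_iff, Metric.eventually_nhds_iff] at h1
  obtain ⟨δ₁, hδ₁, h1⟩ := h1
  set δ₀ := δ₁ / 2 with hδ₀
  have hδ₀' : 0 < δ₀ := by positivity
  have hL' : ∀ δ ∈ Ioc 0 δ₀, ∫ x in Metric.closedBall y δ, φ x ∂ν ≤ η / 16 * δ := by
    intro δ hδ
    have h2 := h1 (y := δ) (by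
      rw [Real.dist_eq, sub_zero, abs_of_pos hδ.1]; linarith [hδ.2]) hδ.1
    rw [Real.dist_eq, sub_zero] at h2
    have h3 := (le_abs_self _).trans h2.le
    rwa [inv_mul_le_iff₀ hδ.1, mul_comm] at h3
  have hlim : Tendsto (fun ε : ℝ => ε / δ₀ ^ 2 * ∫ x, φ x ∂ν) (𝓝[>] 0) (𝓝 0) := by
    have : Tendsto (fun ε : ℝ => ε / δ₀ ^ 2 * ∫ x, φ x ∂ν) (𝓝 0)
        (𝓝 (0 / δ₀ ^ 2 * ∫ x, φ x ∂ν)) := by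
      apply Continuous.tendsto; fun_prop
    simpa using this.mono_left nhdsWithin_le_nhds
  have h4 := (Metric.tendsto_nhds.mp hlim) (η / 4) (by positivity)
  filter_upwards [h4, self_mem_nhdsWithin] with ε hε hε0
  have hε0' : 0 < ε := hε0
  rw [Real.dist_eq, sub_zero] at hε ⊢
  have hmeas : Measurable fun x : ℝ => ε / ((x - y) ^ 2 + ε ^ 2) := by fun_prop
  have hint : Integrable (fun x => φ x * (ε / ((x - y) ^ 2 + ε ^ 2))) ν := by
    refine hφ.mul_bdd (c := 1 / ε) hmeas.aestronglyMeasurable (ae_of_all _ fun x => ?_)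
    rw [Real.norm_of_nonneg (by positivity), div_le_div_iff₀ (by positivity) hε0']
    nlinarith [sq_nonneg (x - y)]
  rw [abs_of_nonneg (integral_nonneg fun x => mul_nonneg (h0 x) (by positivity)),
    ← integral_add_compl Metric.isClosed_closedBall.measurableSet
      (s := Metric.closedBall y δ₀) hint]
  have hnear := integral_ball_mul_poisson_le hφ h0 hδ₀' hε0' hL'
  have hfar : ∫ x in (Metric.closedBall y δ₀)ᶜ, φ x * (ε / ((x - y) ^ 2 + ε ^ 2)) ∂ν
      ≤ ε / δ₀ ^ 2 * ∫ x, φ x ∂ν := by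
    calc _ ≤ ∫ x in (Metric.closedBall y δ₀)ᶜ, ε / δ₀ ^ 2 * φ x ∂ν := by
          refine setIntegral_mono_on hint.integrableOn (hφ.const_mul _).integrableOn
            Metric.isClosed_closedBall.measurableSet.compl fun x hx => ?_
          rw [mul_comm (ε / δ₀ ^ 2)]
          refine mul_le_mul_of_nonneg_left ?_ (h0 x)
          have hx' : δ₀ < |x - y| := by
            simpa [Metric.mem_closedBall, Real.dist_eq] using hx
          have : δ₀ ^ 2 ≤ (x - y) ^ 2 := by rw [← sq_abs (x - y)]; gcongr
          gcongr
          nlinarith [sq_nonneg ε]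
      _ ≤ ∫ x, ε / δ₀ ^ 2 * φ x ∂ν :=
          setIntegral_le_integral (hφ.const_mul _)
            (ae_of_all _ fun x => mul_nonneg (by positivity) (h0 x))
      _ = _ := integral_const_mul _ _
  have := (le_abs_self _).trans hε.le
  linarith

/-- `y` is a Lebesgue point of `f`, relative to the interval `(-1, 1)`. -/
def IsLebesguePt (f : ℝ → ℂ) (y : ℝ) : Prop :=
  Tendsto (fun δ => δ⁻¹ * ∫ x in Metric.closedBall y δ, ‖f x - f y‖
    ∂(volume.restrict (Ioo (-1 : ℝ) 1))) (𝓝[>] 0) (𝓝 0)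

theorem ae_isLebesguePt {f : ℝ → ℂ} (hf : IntegrableOn f (Ioo (-1 : ℝ) 1)) :
    ∀ᵐ y ∂(volume.restrict (Ioo (-1 : ℝ) 1)), IsLebesguePt f y := by
  have hg : Integrable ((Ioo (-1 : ℝ) 1).indicator f) := hf.integrable_indicator measurableSet_Ioo
  rw [ae_restrict_iff' measurableSet_Ioo]
  filter_upwards [IsUnifLocDoublingMeasure.ae_tendsto_average_norm_sub volume
    hg.locallyIntegrable 1] with y hy hyI
  have h1 := hy (l := 𝓝[>] (0 : ℝ)) (fun _ => y) (fun δ => δ) tendsto_id (by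
    filter_upwards [self_mem_nhdsWithin] with δ hδ
    simpa using (le_of_lt hδ : (0 : ℝ) ≤ δ))
  -- The average divides by the length `2δ` of the ball, the definition of a Lebesgue point here
  -- only by `δ`.
  have h2 := h1.const_mul 2
  rw [mul_zero] at h2
  refine squeeze_zero' ?_ ?_ h2
  · filter_upwards [self_mem_nhdsWithin] with δ hδ
    exact mul_nonneg (inv_nonneg.mpr (le_of_lt hδ)) (integral_nonneg fun _ => norm_nonneg _)
  · filter_upwards [self_mem_nhdsWithin] with δ hδ
    have hδ' : 0 < δ := hδ
    rw [setAverage_eq]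
    have hv : (volume : Measure ℝ).real (Metric.closedBall y δ) = 2 * δ := by
      rw [Measure.real, Real.volume_closedBall, ENNReal.toReal_ofReal (by positivity)]
    rw [hv, smul_eq_mul, mul_inv]
    have : ∫ x in Metric.closedBall y δ, ‖f x - f y‖ ∂(volume.restrict (Ioo (-1 : ℝ) 1))
        ≤ ∫ x in Metric.closedBall y δ,
          ‖(Ioo (-1 : ℝ) 1).indicator f x - (Ioo (-1 : ℝ) 1).indicator f y‖ := by
      rw [Measure.restrict_restrict Metric.isClosed_closedBall.measurableSet]
      have hc : IntegrableOn (fun x => ‖(Ioo (-1 : ℝ) 1).indicator f x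
          - (Ioo (-1 : ℝ) 1).indicator f y‖) (Metric.closedBall y δ) :=
        (hg.integrableOn.sub (integrableOn_const
          (by simp [Real.volume_closedBall, ENNReal.mul_eq_top]))).norm
      calc _ = ∫ x in Metric.closedBall y δ ∩ Ioo (-1) 1, ‖(Ioo (-1 : ℝ) 1).indicator f x
          - (Ioo (-1 : ℝ) 1).indicator f y‖ := by
            refine setIntegral_congr_fun
              (Metric.isClosed_closedBall.measurableSet.inter measurableSet_Ioo) fun x hx => ?_
            simp only [indicator_of_mem hx.2, indicator_of_mem hyI]
        _ ≤ _ := setIntegral_mono_set hc (ae_of_all _ fun _ => norm_nonneg _)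
            (inter_subset_left.eventuallyLE)
    calc δ⁻¹ * _ ≤ δ⁻¹ * _ := mul_le_mul_of_nonneg_left this (by positivity)
      _ = _ := by ring

/-- For continuous densities this upgrades almost-everywhere principal values to every point, as
needed in part (i). -/
theorem isLebesguePt_of_continuousAt {f : ℝ → ℂ} {y : ℝ} (hc : ContinuousAt f y) :
    IsLebesguePt f y := by
  rw [IsLebesguePt, Metric.tendsto_nhds]
  intro η hη
  obtain ⟨δ₀, hδ₀, h⟩ := Metric.continuousAt_iff.mp hc (η / 4) (by positivity)
  rw [eventually_nhdsWithin_iff, Metric.eventually_nhds_iff]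
  refine ⟨δ₀, hδ₀, fun δ hδ hpos => ?_⟩
  have hpos' : 0 < δ := hpos
  rw [Real.dist_eq, sub_zero, abs_of_pos hpos'] at hδ
  rw [Real.dist_eq, sub_zero, abs_of_nonneg (mul_nonneg (inv_nonneg.mpr hpos'.le)
    (integral_nonneg fun _ => norm_nonneg _)), inv_mul_lt_iff₀ hpos']
  have hle : volume (Metric.closedBall y δ ∩ Ioo (-1 : ℝ) 1) < ⊤ :=
    (measure_mono inter_subset_right).trans_lt (by simp)
  rw [Measure.restrict_restrict Metric.isClosed_closedBall.measurableSet]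
  have h1 := norm_setIntegral_le_of_norm_le_const (f := fun x => ‖f x - f y‖) (C := η / 4) hle
    (fun x hx => by
      rw [norm_norm, ← dist_eq_norm]
      refine (h ?_).le
      exact (Metric.mem_closedBall.mp hx.1).trans_lt hδ)
  have h2 : (volume : Measure ℝ).real (Metric.closedBall y δ ∩ Ioo (-1 : ℝ) 1) ≤ 2 * δ := by
    calc _ ≤ (volume : Measure ℝ).real (Metric.closedBall y δ) :=
          measureReal_mono inter_subset_left (by simp [Real.volume_closedBall, ENNReal.mul_eq_top])
      _ = 2 * δ := by
          rw [Measure.real, Real.volume_closedBall, ENNReal.toReal_ofReal (by positivity)]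
  have h3 := (le_abs_self _).trans h1
  nlinarith

/-! ### The Abel–Poisson kernels of Chebyshev expansions -/

/-- The common denominator of the Abel–Poisson kernels of Chebyshev expansions. -/
def den (r x y : ℝ) : ℝ := 4 * r ^ 2 * (x - y) ^ 2 + (1 - r) ^ 2 * ((1 + r) ^ 2 - 4 * r * x * y)

/-- The conjugate Abel–Poisson kernel, which tends to `1 / (y - x)` as `r → 1`. -/
def conjKer (r x y : ℝ) : ℝ := 2 * r * ((1 + r ^ 2) * y - 2 * r * x) / den r x y

/-- The Abel–Poisson kernel of Chebyshev expansions. -/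
def poisKer (r x y : ℝ) : ℝ := (1 - r ^ 2) * (1 + r ^ 2 - 2 * r * x * y) / den r x y

/-- For fixed interior `y` the denominator dominates `(x - y)² + (1 - r)²` uniformly in `x`, so a
numerator of size `O(1 - r)` yields a Poisson type kernel. The condition `r ≥ 1/2` keeps `4r²` above
`1`. -/
theorem den_ge {r x y : ℝ} (hr : 1 / 2 ≤ r) (hx : |x| ≤ 1) (hy : |y| < 1) :
    (1 - |y|) * ((x - y) ^ 2 + (1 - r) ^ 2) ≤ den r x y := by
  have h1 : x * y ≤ |y| := by
    calc x * y ≤ |x * y| := le_abs_self _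
      _ = |x| * |y| := abs_mul _ _
      _ ≤ 1 * |y| := by gcongr
      _ = |y| := one_mul _
  have h0 := abs_nonneg y
  have h2 : (1 - |y|) ≤ (1 + r) ^ 2 - 4 * r * x * y := by
    nlinarith [sq_nonneg (1 - r), mul_le_mul_of_nonneg_left h1 (by linarith : 0 ≤ 4 * r)]
  have h3 : (1 - |y|) ≤ 4 * r ^ 2 := by nlinarith
  unfold den
  nlinarith [mul_le_mul_of_nonneg_right h2 (sq_nonneg (1 - r)),
    mul_le_mul_of_nonneg_right h3 (sq_nonneg (x - y))]

theorem den_pos_of_lt_one {r x y : ℝ} (hr0 : 0 ≤ r) (hr : r < 1) (hx : |x| ≤ 1) (hy : |y| ≤ 1) :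
    0 < den r x y := by
  have h1 : x * y ≤ 1 := by
    calc x * y ≤ |x * y| := le_abs_self _
      _ = |x| * |y| := abs_mul _ _
      _ ≤ 1 * 1 := by gcongr
      _ = 1 := one_mul _
  -- Writing `(1 + r)² - 4rxy` as `(1 - r)² + 4r(1 - xy)` shows positivity on the closed square.
  have e : den r x y =
      4 * r ^ 2 * (x - y) ^ 2 + (1 - r) ^ 2 * ((1 - r) ^ 2 + 4 * r * (1 - x * y)) := by
    unfold den; ring
  have h2 : 0 < (1 - r) ^ 2 := by have : 0 < 1 - r := by linarith
                                  positivity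
  have h3 : 0 ≤ 4 * r * (1 - x * y) := mul_nonneg (by linarith) (by linarith)
  rw [e]
  have h4 := sq_nonneg (x - y)
  have : 0 < (1 - r) ^ 2 * ((1 - r) ^ 2 + 4 * r * (1 - x * y)) := by positivity
  positivity

theorem div_den_le {r x y C N : ℝ} (hr : 1 / 2 ≤ r) (hr1 : r < 1) (hx : |x| ≤ 1) (hy : |y| < 1)
    (hC : 0 ≤ C) (hN : |N| ≤ C * (1 - r)) :
    |N / den r x y| ≤ C / (1 - |y|) * ((1 - r) / ((x - y) ^ 2 + (1 - r) ^ 2)) := by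
  have hd := den_pos_of_lt_one (by linarith) hr1 hx hy.le
  have hy' : 0 < 1 - |y| := by linarith
  have hr' : 0 < 1 - r := by linarith
  rw [abs_div, abs_of_pos hd, ← mul_div_mul_comm]
  refine div_le_div₀ (by positivity) hN (by positivity) (den_ge hr hx hy)

theorem abs_poisKer_le {r x y : ℝ} (hr : 1 / 2 ≤ r) (hr1 : r < 1) (hx : |x| ≤ 1) (hy : |y| < 1) :
    |poisKer r x y| ≤ 8 / (1 - |y|) * ((1 - r) / ((x - y) ^ 2 + (1 - r) ^ 2)) := by
  refine div_den_le hr hr1 hx hy (by norm_num) ?_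
  have h1 : |x * y| ≤ 1 := by
    rw [abs_mul]; exact mul_le_one₀ hx (abs_nonneg _) hy.le
  have h2 := abs_le.mp h1
  have h3 : |1 + r ^ 2 - 2 * r * x * y| ≤ 4 := by
    rw [abs_le]; constructor <;> nlinarith
  rw [abs_mul, abs_of_nonneg (by nlinarith : 0 ≤ 1 - r ^ 2)]
  calc (1 - r ^ 2) * |1 + r ^ 2 - 2 * r * x * y| ≤ (2 * (1 - r)) * 4 := by
        gcongr
        nlinarith
    _ = 8 * (1 - r) := by ring

/-- With the cut at `ε = 1 - r`, the singularity cancels outside it: the difference over `den` has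
numerator `O((1 - r)² / |x - y|) + O((1 - r)²)`, which is `O(1 - r)`. Inside the cut the conjugate
kernel itself has numerator `O(1 - r)`, because `(1 + r²)y - 2rx = (1 - r)² y - 2r(x - y)`. -/
theorem cut_kernel_sub_conjKer {r x y : ℝ} (hr : 1 / 2 ≤ r) (hr1 : r < 1)
    (hx : x ∈ Ioo (-1 : ℝ) 1) (hy : |y| < 1) :
    |(cutInterval y (1 - r)).indicator (fun x => (y - x)⁻¹) x - conjKer r x y|
      ≤ 16 / (1 - |y|) * ((1 - r) / ((x - y) ^ 2 + (1 - r) ^ 2)) := by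
  have hx' : |x| ≤ 1 := (abs_lt.mpr hx).le
  have hd := den_pos_of_lt_one (by linarith) hr1 hx' hy.le
  have hr' : 0 < 1 - r := by linarith
  have hy2 := abs_lt.mp hy
  by_cases hc : 1 - r < |x - y|
  · have hmem : x ∈ cutInterval y (1 - r) := ⟨hx, hc⟩
    have hxy : y - x ≠ 0 := by
      intro h0
      rw [abs_sub_comm, h0, abs_zero] at hc
      linarith
    rw [indicator_of_mem hmem]
    have e : (y - x)⁻¹ - conjKer r x y =
        ((1 - r) ^ 2 * ((1 + r) ^ 2 - 4 * r * x * y) / (y - x) - 2 * r * (1 - r) ^ 2 * y)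
          / den r x y := by
      rw [conjKer, eq_div_iff hd.ne', sub_mul, div_mul_cancel₀ _ hd.ne']
      field_simp
      unfold den
      ring
    rw [e]
    refine div_den_le hr hr1 hx' hy (by norm_num) ?_
    have h1 : |x * y| ≤ 1 := by
      rw [abs_mul]; exact mul_le_one₀ hx' (abs_nonneg _) hy.le
    have h2 := abs_le.mp h1
    have h3 : |(1 - r) ^ 2 * ((1 + r) ^ 2 - 4 * r * x * y) / (y - x)| ≤ 8 * (1 - r) := by
      rw [abs_div, abs_mul, abs_of_nonneg (sq_nonneg (1 - r)), abs_sub_comm y x,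
        div_le_iff₀ (by linarith)]
      have h4 : |(1 + r) ^ 2 - 4 * r * x * y| ≤ 8 := by
        rw [abs_le]; constructor <;> nlinarith
      calc (1 - r) ^ 2 * |(1 + r) ^ 2 - 4 * r * x * y| ≤ (1 - r) ^ 2 * 8 := by gcongr
        _ = 8 * (1 - r) * (1 - r) := by ring
        _ ≤ 8 * (1 - r) * |x - y| := by gcongr
    have h5 : |2 * r * (1 - r) ^ 2 * y| ≤ 8 * (1 - r) := by
      rw [abs_mul, abs_of_nonneg (by positivity : 0 ≤ 2 * r * (1 - r) ^ 2)]
      calc 2 * r * (1 - r) ^ 2 * |y| ≤ 2 * 1 * (1 - r) ^ 2 * 1 := by gcongr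
        _ ≤ 8 * (1 - r) := by nlinarith
    calc _ ≤ _ := abs_sub _ _
      _ ≤ 8 * (1 - r) + 8 * (1 - r) := add_le_add h3 h5
      _ = _ := by ring
  · have hmem : x ∉ cutInterval y (1 - r) := fun h => hc h.2
    rw [indicator_of_notMem hmem, zero_sub, abs_neg, conjKer]
    refine div_den_le hr hr1 hx' hy (by norm_num) ?_
    have e : 2 * r * ((1 + r ^ 2) * y - 2 * r * x)
        = 2 * r * ((1 - r) ^ 2 * y - 2 * r * (x - y)) := by ring
    have h1 : |(1 - r) ^ 2 * y - 2 * r * (x - y)| ≤ 4 * (1 - r) := by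
      calc _ ≤ |(1 - r) ^ 2 * y| + |2 * r * (x - y)| := abs_sub _ _
        _ = (1 - r) ^ 2 * |y| + 2 * r * |x - y| := by
            rw [abs_mul, abs_mul, abs_of_nonneg (sq_nonneg (1 - r)),
              abs_of_nonneg (by linarith : 0 ≤ 2 * r)]
        _ ≤ (1 - r) ^ 2 * 1 + 2 * 1 * (1 - r) := by
            gcongr
            exact not_lt.mp hc
        _ ≤ _ := by nlinarith
    rw [e, abs_mul, abs_of_nonneg (by linarith : 0 ≤ 2 * r)]
    calc 2 * r * _ ≤ 2 * 1 * (4 * (1 - r)) := by gcongr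
      _ ≤ _ := by nlinarith

theorem continuousOn_conjKer {r y : ℝ} (hr0 : 0 ≤ r) (hr : r < 1) (hy : |y| ≤ 1) :
    ContinuousOn (fun x => conjKer r x y) (Icc (-1) 1) := by
  unfold conjKer
  refine ContinuousOn.div (by fun_prop) (by unfold den; fun_prop) fun x hx => ?_
  exact (den_pos_of_lt_one hr0 hr (abs_le.mpr hx) hy).ne'

theorem continuousOn_poisKer {r y : ℝ} (hr0 : 0 ≤ r) (hr : r < 1) (hy : |y| ≤ 1) :
    ContinuousOn (fun x => poisKer r x y) (Icc (-1) 1) := by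
  unfold poisKer
  refine ContinuousOn.div (by fun_prop) (by unfold den; fun_prop) fun x hx => ?_
  exact (den_pos_of_lt_one hr0 hr (abs_le.mpr hx) hy).ne'

/-- The conjugate kernel is `-1/2` times the `x`-derivative of `log den`. -/
theorem integral_conjKer {r y : ℝ} (hr0 : 0 ≤ r) (hr : r < 1) (hy : |y| ≤ 1) :
    ∫ x in Ioo (-1 : ℝ) 1, conjKer r x y
      = -(1 / 2) * (Real.log (den r 1 y) - Real.log (den r (-1) y)) := by
  rw [← integral_Ioc_eq_integral_Ioo, ← intervalIntegral.integral_of_le (by norm_num)]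
  have hd : ∀ x ∈ uIcc (-1 : ℝ) 1, HasDerivAt (fun x => -(1 / 2) * Real.log (den r x y))
      (conjKer r x y) x := by
    intro x hx
    rw [uIcc_of_le (by norm_num)] at hx
    have hp := den_pos_of_lt_one hr0 hr (abs_le.mpr hx) hy
    have h1 : HasDerivAt (fun x => den r x y)
        (4 * r ^ 2 * (2 * (x - y)) + (1 - r) ^ 2 * (-(4 * r * y))) x := by
      unfold den
      have a : HasDerivAt (fun x : ℝ => (x - y) ^ 2) (2 * (x - y)) x := by
        simpa using ((hasDerivAt_id x).sub_const y).fun_pow 2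
      have b : HasDerivAt (fun x : ℝ => (1 + r) ^ 2 - 4 * r * x * y) (-(4 * r * y)) x := by
        have := (((hasDerivAt_id x).const_mul (4 * r)).mul_const y).const_sub ((1 + r) ^ 2)
        simpa using this
      exact (a.const_mul _).add (b.const_mul _)
    have h2 := (h1.log hp.ne').const_mul (-(1 / 2) : ℝ)
    convert! h2 using 1
    rw [conjKer, ← mul_div_assoc]
    congr 1
    ring
  rw [intervalIntegral.integral_eq_sub_of_hasDerivAt hd]
  · ring
  · refine ContinuousOn.intervalIntegrable ?_
    rw [uIcc_of_le (by norm_num)]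
    exact continuousOn_conjKer hr0 hr hy

/-! ### Truncated Hilbert kernels against conjugate means -/

theorem measurableSet_cutInterval (y ε : ℝ) : MeasurableSet (cutInterval y ε) :=
  measurableSet_Ioo.inter (measurableSet_lt measurable_const
    ((continuous_id.sub continuous_const).abs).measurable)

theorem cutInterval_subset (y ε : ℝ) : cutInterval y ε ⊆ Ioo (-1) 1 := fun _ h => h.1

/-- The contributions `log ε` of the two sides cancel by symmetry of the cut. -/
theorem integral_cut_inv {y ε : ℝ} (hε : 0 < ε) (h1 : ε < 1 - y) (h2 : ε < 1 + y) :
    ∫ x in cutInterval y ε, (y - x)⁻¹ = Real.log (1 + y) - Real.log (1 - y) := by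
  have e : cutInterval y ε = Ioo (-1) (y - ε) ∪ Ioo (y + ε) 1 := by
    ext x
    simp only [cutInterval, mem_ofPred_eq, mem_Ioo, mem_union, lt_abs]
    constructor
    · rintro ⟨⟨a, b⟩, c | c⟩
      · right; constructor <;> linarith
      · left; constructor <;> linarith
    · rintro (⟨a, b⟩ | ⟨a, b⟩)
      · exact ⟨⟨a, by linarith⟩, Or.inr (by linarith)⟩
      · exact ⟨⟨by linarith, b⟩, Or.inl (by linarith)⟩
  have i1 : IntervalIntegrable (fun x => (y - x)⁻¹) volume (-1) (y - ε) := by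
    refine ContinuousOn.intervalIntegrable (ContinuousOn.inv₀ (by fun_prop) fun x hx => ?_)
    rw [uIcc_of_le (by linarith)] at hx
    have := hx.2
    intro h; linarith
  have i2 : IntervalIntegrable (fun x => (y - x)⁻¹) volume (y + ε) 1 := by
    refine ContinuousOn.intervalIntegrable (ContinuousOn.inv₀ (by fun_prop) fun x hx => ?_)
    rw [uIcc_of_le (by linarith)] at hx
    have := hx.1
    intro h; linarith
  rw [e, setIntegral_union]
  · rw [← integral_Ioc_eq_integral_Ioo, ← integral_Ioc_eq_integral_Ioo,
      ← intervalIntegral.integral_of_le (by linarith),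
      ← intervalIntegral.integral_of_le (by linarith),
      intervalIntegral.integral_comp_sub_left (fun x => x⁻¹),
      intervalIntegral.integral_comp_sub_left (fun x => x⁻¹),
      integral_inv_of_pos (by linarith) (by linarith),
      integral_inv_of_neg (by linarith) (by linarith)]
    rw [show (y - (-1)) / (y - (y - ε)) = (1 + y) / ε by congr 1 <;> ring,
      show (y - (y + ε)) / (y - 1) = ε / (1 - y) by
        rw [← neg_div_neg_eq]; congr 1 <;> ring,
      Real.log_div (by linarith) hε.ne', Real.log_div hε.ne' (by linarith)]
    ring
  · rw [Set.disjoint_left]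
    rintro x ⟨_, b⟩ ⟨a, _⟩
    linarith
  · exact measurableSet_Ioo
  · exact (intervalIntegrable_iff_integrableOn_Ioo_of_le (by linarith)).mp i1
  · exact (intervalIntegrable_iff_integrableOn_Ioo_of_le (by linarith)).mp i2

/-- Truncations of the Hilbert kernel agree with the conjugate Abel–Poisson means in the limit at
each Lebesgue point. -/
theorem tendsto_cut_sub_conjKer {f : ℝ → ℂ} (hf : IntegrableOn f (Ioo (-1 : ℝ) 1)) {y : ℝ}
    (hy : y ∈ Ioo (-1 : ℝ) 1) (hL : IsLebesguePt f y) :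
    Tendsto (fun ε => (∫ x in cutInterval y ε, f x / ((y : ℂ) - x))
      - ∫ x in Ioo (-1 : ℝ) 1, f x * (conjKer (1 - ε) x y : ℝ)) (𝓝[>] 0) (𝓝 0) := by
  have hy' : |y| < 1 := abs_lt.mpr hy
  set k : ℝ → ℝ → ℝ := fun ε x =>
    (cutInterval y ε).indicator (fun x => (y - x)⁻¹) x - conjKer (1 - ε) x y with hk
  set I : Set ℝ := Ioo (-1 : ℝ) 1 with hI
  have hsmall : ∀ᶠ ε : ℝ in 𝓝[>] 0, 0 < ε ∧ ε < 1 / 2 ∧ ε < 1 - y ∧ ε < 1 + y := by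
    have h := hy.1
    have h' := hy.2
    filter_upwards [self_mem_nhdsWithin,
      nhdsWithin_le_nhds (Iio_mem_nhds (by norm_num : (0:ℝ) < 1 / 2)),
      nhdsWithin_le_nhds (Iio_mem_nhds (by linarith : (0:ℝ) < 1 - y)),
      nhdsWithin_le_nhds (Iio_mem_nhds (by linarith : (0:ℝ) < 1 + y))] with ε a b c d
    exact ⟨a, b, c, d⟩
  have hkb : ∀ ε, 0 < ε → ε < 1 / 2 → ∀ x ∈ I, |k ε x| ≤
      16 / (1 - |y|) * (ε / ((x - y) ^ 2 + ε ^ 2)) := by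
    intro ε h0 h1 x hx
    have := cut_kernel_sub_conjKer (r := 1 - ε) (by linarith) (by linarith) hx hy'
    simpa only [sub_sub_cancel] using this
  have hmk1 : ∀ ε, Measurable ((cutInterval y ε).indicator (fun x => (y - x)⁻¹)) := fun ε =>
    Measurable.indicator (by fun_prop) (measurableSet_cutInterval y ε)
  have hmk2 : ∀ ε, Measurable fun x => conjKer (1 - ε) x y := by
    intro ε; unfold conjKer den; fun_prop
  have hmk : ∀ ε, Measurable (k ε) := fun ε => (hmk1 ε).sub (hmk2 ε)
  have hcutb : ∀ ε, 0 < ε → ∀ x, ‖(cutInterval y ε).indicator (fun x => (y - x)⁻¹) x‖ ≤ ε⁻¹ := by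
    intro ε h0 x
    by_cases hx : x ∈ cutInterval y ε
    · rw [indicator_of_mem hx, norm_inv, Real.norm_eq_abs, abs_sub_comm]
      exact inv_anti₀ h0 hx.2.le
    · rw [indicator_of_notMem hx, norm_zero]; positivity
  have hkerb : ∀ ε, 0 < ε → ε < 1 / 2 → ∃ C, ∀ x ∈ I, ‖conjKer (1 - ε) x y‖ ≤ C := by
    intro ε h0 h1
    obtain ⟨C, hC⟩ := isCompact_Icc.exists_bound_of_continuousOn
      (continuousOn_conjKer (r := 1 - ε) (y := y) (by linarith) (by linarith) hy'.le)
    exact ⟨C, fun x hx => hC x (Ioo_subset_Icc_self hx)⟩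
  have hIfin : IsFiniteMeasure (volume.restrict I) := ⟨by simp [hI]⟩
  -- rewrite as an integral against `k`
  have hint1 : ∀ ε, 0 < ε → ∀ g : ℝ → ℂ, IntegrableOn g I → IntegrableOn (fun x => g x *
      (((cutInterval y ε).indicator (fun x => (y - x)⁻¹) x : ℝ) : ℂ)) I := by
    intro ε h0 g hg
    refine Integrable.mul_bdd (c := ε⁻¹) hg
      (Complex.measurable_ofReal.comp (hmk1 ε)).aestronglyMeasurable (ae_of_all _ fun x => ?_)
    rw [Complex.norm_real]; exact hcutb ε h0 x
  have hint2 : ∀ ε, 0 < ε → ε < 1 / 2 → ∀ g : ℝ → ℂ, IntegrableOn g I → IntegrableOn (fun x => g x *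
      ((conjKer (1 - ε) x y : ℝ) : ℂ)) I := by
    intro ε h0 h1 g hg
    obtain ⟨C, hC⟩ := hkerb ε h0 h1
    refine Integrable.mul_bdd (c := C) hg
      (Complex.measurable_ofReal.comp (hmk2 ε)).aestronglyMeasurable ?_
    filter_upwards [ae_restrict_mem measurableSet_Ioo] with x hx
    rw [Complex.norm_real]; exact hC x hx
  have hcut : ∀ ε (g : ℝ → ℂ), (∫ x in cutInterval y ε, g x / ((y : ℂ) - x)) =
      ∫ x in I, g x * (((cutInterval y ε).indicator (fun x => (y - x)⁻¹) x : ℝ) : ℂ) := by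
    intro ε g
    rw [← integral_indicator (measurableSet_cutInterval y ε), ← integral_indicator measurableSet_Ioo]
    congr 1
    ext x
    by_cases hx : x ∈ cutInterval y ε
    · rw [indicator_of_mem hx, indicator_of_mem (cutInterval_subset _ _ hx), indicator_of_mem hx]
      push_cast
      rw [div_eq_mul_inv]
    · rw [indicator_of_notMem hx]
      by_cases hxI : x ∈ I
      · rw [indicator_of_mem hxI, indicator_of_notMem hx]; simp
      · rw [indicator_of_notMem hxI]
  -- Subtracting the constant `f y` leaves an oscillation, controlled by the Lebesgue point
  -- condition, and `f y` times the total mass of `k`, which must be shown to vanish in the limit.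
  have hrepr : ∀ ε, 0 < ε → ε < 1 / 2 → (∫ x in cutInterval y ε, f x / ((y : ℂ) - x))
      - ∫ x in I, f x * (conjKer (1 - ε) x y : ℝ)
      = (∫ x in I, (f x - f y) * (k ε x : ℝ)) + f y * ((∫ x in I, k ε x : ℝ) : ℂ) := by
    intro ε h0 h1
    have hone : IntegrableOn (fun _ : ℝ => (1 : ℂ)) I := integrable_const _
    have hkI : IntegrableOn (fun x => ((k ε x : ℝ) : ℂ)) I := by
      have := (hint1 ε h0 _ hone).sub (hint2 ε h0 h1 _ hone)
      refine this.congr (ae_of_all _ fun x => ?_)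
      simp [hk]
    have hfk : IntegrableOn (fun x => f x * ((k ε x : ℝ) : ℂ)) I := by
      have := (hint1 ε h0 _ hf).sub (hint2 ε h0 h1 _ hf)
      refine this.congr (ae_of_all _ fun x => ?_)
      simp [hk, mul_sub]
    rw [hcut, ← integral_sub (hint1 ε h0 _ hf) (hint2 ε h0 h1 _ hf), ← integral_complex_ofReal,
      ← integral_const_mul]
    simp only [sub_mul]
    rw [integral_sub hfk (hkI.const_mul _), sub_add_cancel]
    refine integral_congr_ae (ae_of_all _ fun x => ?_)
    simp [hk, mul_sub]
  -- the mean zero part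
  have hmass : Tendsto (fun ε => ∫ x in I, k ε x) (𝓝[>] 0) (𝓝 0) := by
    have h1 : Tendsto (fun ε : ℝ => Real.log (1 + y) - Real.log (1 - y)
        - (-(1 / 2) * (Real.log (den (1 - ε) 1 y) - Real.log (den (1 - ε) (-1) y))))
        (𝓝[>] 0) (𝓝 (Real.log (1 + y) - Real.log (1 - y)
        - (-(1 / 2) * (Real.log (den (1 - 0) 1 y) - Real.log (den (1 - 0) (-1) y))))) := by
      refine Tendsto.mono_left ?_ nhdsWithin_le_nhds
      refine ContinuousAt.tendsto (f := fun ε : ℝ => Real.log (1 + y) - Real.log (1 - y)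
        - (-(1 / 2) * (Real.log (den (1 - ε) 1 y) - Real.log (den (1 - ε) (-1) y)))) ?_
      have ha : den (1 - 0) 1 y ≠ 0 := by
        have : den (1 - 0) 1 y = 4 * (1 - y) ^ 2 := by unfold den; ring
        rw [this]; have := hy.2; have : 0 < 1 - y := by linarith
        positivity
      have hb : den (1 - 0) (-1) y ≠ 0 := by
        have : den (1 - 0) (-1) y = 4 * (1 + y) ^ 2 := by unfold den; ring
        rw [this]; have := hy.1; have : 0 < 1 + y := by linarith
        positivity
      have ca : ContinuousAt (fun ε : ℝ => den (1 - ε) 1 y) 0 := by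
        unfold den; fun_prop
      have cb : ContinuousAt (fun ε : ℝ => den (1 - ε) (-1) y) 0 := by
        unfold den; fun_prop
      exact continuousAt_const.sub (((ca.log ha).sub (cb.log hb)).const_mul _)
    -- At `r = 1` the denominator at the endpoints `±1` is the square `(2(1 ∓ y))²`, so the two
    -- logarithmic masses agree in the limit.
    have h0 : Real.log (1 + y) - Real.log (1 - y)
        - (-(1 / 2) * (Real.log (den (1 - 0) 1 y) - Real.log (den (1 - 0) (-1) y))) = 0 := by
      have e1 : den (1 - 0) 1 y = (2 * (1 - y)) ^ 2 := by unfold den; ring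
      have e2 : den (1 - 0) (-1) y = (2 * (1 + y)) ^ 2 := by unfold den; ring
      have := hy.1
      have := hy.2
      rw [e1, e2, Real.log_pow, Real.log_pow, Real.log_mul two_ne_zero (by linarith),
        Real.log_mul two_ne_zero (by linarith)]
      push_cast
      ring
    rw [h0] at h1
    refine h1.congr' ?_
    filter_upwards [hsmall] with ε ⟨h0, h1, h2, h3⟩
    have hone : IntegrableOn (fun _ : ℝ => (1 : ℂ)) I := integrable_const _
    rw [← integral_cut_inv h0 h2 h3, ← integral_conjKer (by linarith) (by linarith) hy'.le, hk]
    rw [integral_sub]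
    · congr 1
      rw [setIntegral_indicator (measurableSet_cutInterval y ε),
        inter_eq_self_of_subset_right (cutInterval_subset y ε)]
    · have := (hint1 ε h0 _ hone).re
      simpa [IntegrableOn] using this
    · have := (hint2 ε h0 h1 _ hone).re
      simpa [IntegrableOn] using this
  have hosc : Tendsto (fun ε => ∫ x in I, (f x - f y) * ((k ε x : ℝ) : ℂ)) (𝓝[>] 0) (𝓝 0) := by
    have hφ : Integrable (fun x => ‖f x - f y‖) (volume.restrict I) :=
      (Integrable.sub hf (integrable_const _)).norm
    have h1 := (tendsto_integral_mul_poisson hφ (fun _ => norm_nonneg _) hL).const_mul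
      (16 / (1 - |y|))
    rw [mul_zero] at h1
    refine squeeze_zero_norm' ?_ h1
    filter_upwards [hsmall] with ε ⟨h0, h1, _, _⟩
    rw [← integral_const_mul]
    refine norm_integral_le_of_norm_le ?_ ?_
    · refine Integrable.const_mul (hφ.mul_bdd (c := 1 / ε)
        (by fun_prop : Measurable fun x : ℝ => ε / ((x - y) ^ 2 + ε ^ 2)).aestronglyMeasurable
        (ae_of_all _ fun x => ?_)) _
      rw [Real.norm_of_nonneg (by positivity), div_le_div_iff₀ (by positivity) h0]
      nlinarith [sq_nonneg (x - y)]
    · filter_upwards [ae_restrict_mem measurableSet_Ioo] with x hx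
      rw [norm_mul, Complex.norm_real, Real.norm_eq_abs, mul_left_comm]
      exact mul_le_mul_of_nonneg_left (hkb ε h0 h1 x hx) (norm_nonneg _)
  have hfin := hosc.add ((Complex.continuous_ofReal.tendsto 0).comp hmass |>.const_mul (f y))
  simp only [Complex.ofReal_zero, mul_zero, add_zero] at hfin
  refine hfin.congr' ?_
  filter_upwards [hsmall] with ε ⟨h0, h1, _, _⟩
  rw [hrepr ε h0 h1]
  rfl

/-! ### The Chebyshev measure -/

theorem measurable_rt : Measurable rt := by unfold rt; fun_prop

theorem continuous_rt : Continuous rt := by unfold rt; fun_prop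

theorem rt_nonneg (x : ℝ) : 0 ≤ rt x := Real.sqrt_nonneg _

theorem rt_pos {x : ℝ} (hx : x ∈ Ioo (-1 : ℝ) 1) : 0 < rt x :=
  Real.sqrt_pos.mpr (by nlinarith [hx.1, hx.2])

theorem rt_sq {x : ℝ} (hx : x ∈ Icc (-1 : ℝ) 1) : rt x ^ 2 = 1 - x ^ 2 :=
  Real.sq_sqrt (by nlinarith [hx.1, hx.2])

theorem rt_le_one (x : ℝ) : rt x ≤ 1 := by
  rw [rt, Real.sqrt_le_one]
  nlinarith [sq_nonneg x]

theorem measurable_ofReal_inv_rt : Measurable fun x => ENNReal.ofReal (rt x)⁻¹ :=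
  measurable_rt.inv.ennreal_ofReal

theorem measureT_eq : measureT = (volume.restrict (Ioo (-1 : ℝ) 1)).withDensity
    fun x => ENNReal.ofReal (rt x)⁻¹ := by
  have : (fun x : ℝ => ENNReal.ofNNReal (.mk (√(1 - x ^ 2)⁻¹) (by positivity)))
      = fun x => ENNReal.ofReal (rt x)⁻¹ := by
    ext x
    rw [ENNReal.ofReal, ENNReal.coe_inj]
    apply NNReal.eq
    rw [Real.coe_toNNReal _ (inv_nonneg.mpr (rt_nonneg x)), rt, ← Real.sqrt_inv]
    rfl
  rw [measureT, this, restrict_withDensity measurableSet_Ioc,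
    Measure.restrict_congr_set Ioo_ae_eq_Ioc]

instance : IsFiniteMeasure measureT := by
  have h := Polynomial.Chebyshev.integrable_measureT (f := fun _ => (1 : ℝ)) continuousOn_const
  rw [integrable_const_iff_isFiniteMeasure one_ne_zero] at h
  exact h

/-- The density is finite and positive on the open interval, so statements almost everywhere can be
moved freely between the two measures. -/
theorem ae_measureT : ae measureT = ae (volume.restrict (Ioo (-1 : ℝ) 1)) := by
  rw [measureT_eq]
  refine le_antisymm (withDensity_absolutelyContinuous _ _).ae_le
    (withDensity_absolutelyContinuous' ?_ ?_).ae_le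
  · exact measurable_ofReal_inv_rt.aemeasurable
  · filter_upwards [ae_restrict_mem measurableSet_Ioo] with x hx
    simpa using rt_pos hx

theorem ae_measureT_mem : ∀ᵐ x ∂measureT, x ∈ Ioo (-1 : ℝ) 1 := by
  rw [ae_measureT]; exact ae_restrict_mem measurableSet_Ioo

theorem aestronglyMeasurable_measureT_iff {f : ℝ → ℂ} : AEStronglyMeasurable f measureT ↔
    AEStronglyMeasurable f (volume.restrict (Ioo (-1 : ℝ) 1)) :=
  ⟨fun h => h.mono_ac (Measure.ae_le_iff_absolutelyContinuous.mp ae_measureT.ge),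
    fun h => h.mono_ac (Measure.ae_le_iff_absolutelyContinuous.mp ae_measureT.le)⟩

theorem integrable_measureT_iff {E : Type*} [NormedAddCommGroup E] [NormedSpace ℝ E] {f : ℝ → E} :
    Integrable f measureT ↔ IntegrableOn (fun x => (rt x)⁻¹ • f x) (Ioo (-1 : ℝ) 1) := by
  rw [measureT_eq, integrable_withDensity_iff_integrable_smul₀'
    measurable_ofReal_inv_rt.aemeasurable (ae_of_all _ fun _ => ENNReal.ofReal_lt_top)]
  unfold IntegrableOn
  refine integrable_congr (ae_of_all _ fun x => ?_)
  simp only [ENNReal.toReal_ofReal (inv_nonneg.mpr (rt_nonneg x))]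

theorem integral_measureT_smul {E : Type*} [NormedAddCommGroup E] [NormedSpace ℝ E] (f : ℝ → E) :
    ∫ x, f x ∂measureT = ∫ x in Ioo (-1 : ℝ) 1, (rt x)⁻¹ • f x := by
  rw [measureT_eq, integral_withDensity_eq_integral_toReal_smul₀
    measurable_ofReal_inv_rt.aemeasurable (ae_of_all _ fun _ => ENNReal.ofReal_lt_top)]
  refine integral_congr_ae (ae_of_all _ fun x => ?_)
  simp only [ENNReal.toReal_ofReal (inv_nonneg.mpr (rt_nonneg x))]

/-- The factor `√(1 - x²)` cancels the density. This is why functions in `L²_m(I)` are represented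
by the class of `rt · f`. -/
theorem integrable_rt_mul_iff {f : ℝ → ℂ} :
    Integrable (fun x => (rt x : ℂ) * f x) measureT ↔ IntegrableOn f (Ioo (-1 : ℝ) 1) := by
  rw [integrable_measureT_iff]
  refine integrable_congr ?_
  filter_upwards [ae_restrict_mem measurableSet_Ioo] with x hx
  rw [Complex.real_smul, ← mul_assoc, ← Complex.ofReal_mul, inv_mul_cancel₀ (rt_pos hx).ne',
    Complex.ofReal_one, one_mul]

theorem integral_rt_mul (f : ℝ → ℂ) :
    ∫ x, (rt x : ℂ) * f x ∂measureT = ∫ x in Ioo (-1 : ℝ) 1, f x := by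
  rw [integral_measureT_smul]
  refine integral_congr_ae ?_
  filter_upwards [ae_restrict_mem measurableSet_Ioo] with x hx
  rw [Complex.real_smul, ← mul_assoc, ← Complex.ofReal_mul, inv_mul_cancel₀ (rt_pos hx).ne',
    Complex.ofReal_one, one_mul]

theorem _root_.MeasureTheory.Integrable.integrableOn_of_measureT {f : ℝ → ℂ}
    (hf : Integrable f measureT) : IntegrableOn f (Ioo (-1 : ℝ) 1) := by
  rw [← integrable_rt_mul_iff]
  refine hf.bdd_mul (c := 1) (by
    exact (Complex.measurable_ofReal.comp measurable_rt).aestronglyMeasurable)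
    (ae_of_all _ fun x => ?_)
  rw [Complex.norm_real, Real.norm_of_nonneg (rt_nonneg x)]
  exact rt_le_one x

theorem memLd_iff {f : ℝ → ℂ} : MemLd f ↔ MemLp f 2 measureT := by
  rw [MemLd, ← aestronglyMeasurable_measureT_iff]
  have key : Integrable (fun x => ‖f x‖ ^ 2) measureT ↔
      IntegrableOn (fun t => ‖f t‖ ^ 2 / rt t) (Ioo (-1 : ℝ) 1) := by
    rw [integrable_measureT_iff]
    refine integrable_congr (ae_of_all _ fun x => ?_)
    simp only [smul_eq_mul]
    ring
  constructor
  · rintro ⟨h1, h2⟩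
    exact (memLp_two_iff_integrable_sq_norm h1).mpr (key.mpr h2)
  · exact fun h => ⟨h.1, key.mp ((memLp_two_iff_integrable_sq_norm h.1).mp h)⟩

/-- Pointwise, `(rt |f|)² / rt = rt |f|²`. -/
theorem memLm_iff {f : ℝ → ℂ} : MemLm f ↔ MemLp (fun x => (rt x : ℂ) * f x) 2 measureT := by
  rw [← memLd_iff, MemLm, MemLd]
  have hm : AEStronglyMeasurable (fun x => (rt x : ℂ)) (volume.restrict (Ioo (-1 : ℝ) 1)) :=
    (Complex.measurable_ofReal.comp measurable_rt).aestronglyMeasurable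
  have hmi : AEStronglyMeasurable (fun x => (rt x : ℂ)⁻¹) (volume.restrict (Ioo (-1 : ℝ) 1)) :=
    (Complex.measurable_ofReal.comp measurable_rt).inv.aestronglyMeasurable
  refine and_congr ⟨fun h => hm.mul h, fun h => (hmi.mul h).congr ?_⟩ (integrable_congr ?_)
  · filter_upwards [ae_restrict_mem measurableSet_Ioo] with x hx
    have : (rt x : ℂ) ≠ 0 := Complex.ofReal_ne_zero.mpr (rt_pos hx).ne'
    simp only [Pi.mul_apply]
    field_simp
  · filter_upwards [ae_restrict_mem measurableSet_Ioo] with x hx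
    have := (rt_pos hx).ne'
    rw [norm_mul, Complex.norm_real, Real.norm_of_nonneg (rt_nonneg x)]
    field_simp

theorem MemLd.memLm {f : ℝ → ℂ} (hf : MemLd f) : MemLm f := by
  rw [memLm_iff]
  refine (memLd_iff.mp hf).of_le ?_ (ae_of_all _ fun x => ?_)
  · exact (Complex.measurable_ofReal.comp measurable_rt).aestronglyMeasurable.mul
      (memLd_iff.mp hf).1
  · rw [norm_mul, Complex.norm_real, Real.norm_of_nonneg (rt_nonneg x)]
    exact mul_le_of_le_one_left (norm_nonneg _) (rt_le_one x)

/-! ### Abel–Poisson means at Lebesgue points -/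

theorem integrable_mul_of_continuousOn {g : ℝ → ℂ} (hg : Integrable g measureT) {c : ℝ → ℂ}
    (hc : ContinuousOn c (Icc (-1) 1)) : Integrable (fun x => g x * c x) measureT := by
  obtain ⟨C, hC⟩ := isCompact_Icc.exists_bound_of_continuousOn hc
  refine hg.mul_bdd (c := C) ?_ ?_
  · rw [aestronglyMeasurable_measureT_iff]
    exact (hc.mono Ioo_subset_Icc_self).aestronglyMeasurable measurableSet_Ioo
  · filter_upwards [ae_measureT_mem] with x hx using hC x (Ioo_subset_Icc_self hx)

/-- The Chebyshev density is bounded near an interior point: small balls around `y` stay in `|x| ≤ 1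
- d`, where `1 / rt ≤ 1 / c`. -/
theorem IsLebesguePt.tendsto_measureT {g : ℝ → ℂ} (hg : Integrable g measureT) {y : ℝ}
    (hy : y ∈ Ioo (-1 : ℝ) 1) (hL : IsLebesguePt g y) :
    Tendsto (fun δ => δ⁻¹ * ∫ x in Metric.closedBall y δ, ‖g x - g y‖ ∂measureT)
      (𝓝[>] 0) (𝓝 0) := by
  set d : ℝ := (1 - |y|) / 2 with hd
  have hy' : |y| < 1 := abs_lt.mpr hy
  have hd0 : 0 < d := by rw [hd]; linarith
  set c : ℝ := Real.sqrt (1 - (1 - d) ^ 2) with hc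
  have hd1 : d ≤ 1 / 2 := by rw [hd]; linarith [abs_nonneg y]
  have hc0 : 0 < c := Real.sqrt_pos.mpr (by nlinarith)
  have h1 := hL.const_mul c⁻¹
  rw [mul_zero] at h1
  refine squeeze_zero' ?_ ?_ h1
  · filter_upwards [self_mem_nhdsWithin] with δ hδ
    exact mul_nonneg (inv_nonneg.mpr (le_of_lt hδ)) (integral_nonneg fun _ => norm_nonneg _)
  · filter_upwards [self_mem_nhdsWithin, nhdsWithin_le_nhds (Iio_mem_nhds hd0)] with δ hδ hδd
    have hδ0 : 0 < δ := hδ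
    rw [mul_left_comm]
    refine mul_le_mul_of_nonneg_left ?_ (inv_nonneg.mpr hδ0.le)
    have hmb : MeasurableSet (Metric.closedBall y δ) := Metric.isClosed_closedBall.measurableSet
    have hi : Integrable (fun x => ‖g x - g y‖) measureT :=
      (hg.sub (integrable_const _)).norm
    have hiI : IntegrableOn (fun x => ‖g x - g y‖) (Ioo (-1 : ℝ) 1) :=
      (hg.sub (integrable_const _)).integrableOn_of_measureT.norm
    rw [← integral_indicator hmb, integral_measureT_smul, ← integral_indicator hmb,
      ← integral_const_mul]
    refine integral_mono_ae ?_ ((hiI.indicator hmb).const_mul _) ?_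
    · exact integrable_measureT_iff.mp (hi.indicator hmb)
    · filter_upwards [ae_restrict_mem measurableSet_Ioo] with x hx
      simp only [smul_eq_mul]
      by_cases hxb : x ∈ Metric.closedBall y δ
      · rw [indicator_of_mem hxb]
        refine mul_le_mul_of_nonneg_right (inv_anti₀ hc0 ?_) (norm_nonneg _)
        refine Real.sqrt_le_sqrt ?_
        have hxy : |x - y| ≤ δ := by
          simpa [Metric.mem_closedBall, Real.dist_eq] using hxb
        have h2 : |x| ≤ 1 - d := by
          have : |x| ≤ |x - y| + |y| := by
            calc |x| = |(x - y) + y| := by ring_nf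
              _ ≤ _ := abs_add_le _ _
          have hδd' : δ < d := hδd
          have : |y| = 1 - 2 * d := by rw [hd]; ring
          linarith
        have h3 : x ^ 2 ≤ (1 - d) ^ 2 := by
          rw [← sq_abs x]; gcongr
        linarith
      · rw [indicator_of_notMem hxb]; simp

/-- Abel–Poisson means converge at Lebesgue points. -/
theorem tendsto_integral_mul_poisKer {g : ℝ → ℂ} (hg : Integrable g measureT) {y : ℝ}
    (hy : y ∈ Ioo (-1 : ℝ) 1) (hL : IsLebesguePt g y)
    (hmass : ∀ r : ℝ, 0 ≤ r → r < 1 → ∫ x, poisKer r x y ∂measureT = Real.pi) :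
    Tendsto (fun ε => ∫ x, g x * (poisKer (1 - ε) x y : ℝ) ∂measureT) (𝓝[>] 0)
      (𝓝 (Real.pi * g y)) := by
  have hy' : |y| < 1 := abs_lt.mpr hy
  have hφ : Integrable (fun x => ‖g x - g y‖) measureT := (hg.sub (integrable_const _)).norm
  have h1 := (tendsto_integral_mul_poisson hφ (fun _ => norm_nonneg _)
    (hL.tendsto_measureT hg hy)).const_mul (8 / (1 - |y|))
  rw [mul_zero] at h1
  have hsmall : ∀ᶠ ε : ℝ in 𝓝[>] 0, 0 < ε ∧ ε < 1 / 2 := by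
    filter_upwards [self_mem_nhdsWithin,
      nhdsWithin_le_nhds (Iio_mem_nhds (by norm_num : (0:ℝ) < 1 / 2))] with ε a b
    exact ⟨a, b⟩
  have hcont : ∀ ε : ℝ, 0 < ε → ε < 1 / 2 →
      ContinuousOn (fun x => ((poisKer (1 - ε) x y : ℝ) : ℂ)) (Icc (-1) 1) := fun ε h0 h1 =>
    Complex.continuous_ofReal.comp_continuousOn
      (continuousOn_poisKer (by linarith) (by linarith) hy'.le)
  have hosc : Tendsto (fun ε => ∫ x, (g x - g y) * ((poisKer (1 - ε) x y : ℝ) : ℂ) ∂measureT)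
      (𝓝[>] 0) (𝓝 0) := by
    refine squeeze_zero_norm' ?_ h1
    filter_upwards [hsmall] with ε ⟨h0, h2⟩
    rw [← integral_const_mul]
    refine norm_integral_le_of_norm_le ?_ ?_
    · refine Integrable.const_mul (hφ.mul_bdd (c := 1 / ε)
        (by fun_prop : Measurable fun x : ℝ => ε / ((x - y) ^ 2 + ε ^ 2)).aestronglyMeasurable
        (ae_of_all _ fun x => ?_)) _
      rw [Real.norm_of_nonneg (by positivity), div_le_div_iff₀ (by positivity) h0]
      nlinarith [sq_nonneg (x - y)]
    · filter_upwards [ae_measureT_mem] with x hx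
      rw [norm_mul, Complex.norm_real, Real.norm_eq_abs, mul_left_comm]
      refine mul_le_mul_of_nonneg_left ?_ (norm_nonneg _)
      have := abs_poisKer_le (r := 1 - ε) (by linarith) (by linarith) (abs_lt.mpr hx).le hy'
      simpa only [sub_sub_cancel] using this
  -- The oscillation tends to zero, and the constant part is exactly `π g(y)` for every `r`, because
  -- the kernel has mass `π`.
  have h2 := hosc.add_const (Real.pi * g y)
  rw [zero_add] at h2
  refine h2.congr' ?_
  filter_upwards [hsmall] with ε ⟨h0, h3⟩
  simp only [sub_mul]
  have hi2 := integrable_mul_of_continuousOn (integrable_const (g y)) (hcont ε h0 h3)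
  rw [integral_sub (integrable_mul_of_continuousOn hg (hcont ε h0 h3)) hi2, integral_const_mul,
    integral_complex_ofReal, hmass (1 - ε) (by linarith) (by linarith)]
  ring

/-! ### Chebyshev expansions of the kernels -/

/-- Real and imaginary parts of the geometric series in `r e^{ia}`. -/
theorem hasSum_pow_mul_cos {r : ℝ} (hr0 : 0 ≤ r) (hr : r < 1) (a : ℝ) :
    HasSum (fun k : ℕ => r ^ k * Real.cos (k * a))
      ((1 - r * Real.cos a) / (1 - 2 * r * Real.cos a + r ^ 2)) ∧
    HasSum (fun k : ℕ => r ^ k * Real.sin (k * a))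
      (r * Real.sin a / (1 - 2 * r * Real.cos a + r ^ 2)) := by
  set z : ℂ := r * Complex.exp (a * Complex.I) with hz
  have hn : ‖z‖ < 1 := by
    rw [hz, norm_mul, Complex.norm_exp_ofReal_mul_I, mul_one, Complex.norm_real,
      Real.norm_of_nonneg hr0]
    exact hr
  have h := hasSum_geometric_of_norm_lt_one hn
  have hzre : z.re = r * Real.cos a := by
    rw [hz, Complex.re_ofReal_mul, Complex.exp_ofReal_mul_I_re]
  have hzim : z.im = r * Real.sin a := by
    rw [hz, Complex.im_ofReal_mul, Complex.exp_ofReal_mul_I_im]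
  have hpow : ∀ k : ℕ, z ^ k = ((r ^ k : ℝ) : ℂ) * Complex.exp (((k * a : ℝ) : ℂ) * Complex.I) := by
    intro k
    rw [hz, mul_pow, ← Complex.exp_nat_mul]
    push_cast
    ring_nf
  have hns : Complex.normSq (1 - z) = 1 - 2 * r * Real.cos a + r ^ 2 := by
    rw [Complex.normSq_apply]
    simp only [Complex.sub_re, Complex.one_re, Complex.sub_im, Complex.one_im, hzre, hzim]
    linear_combination r ^ 2 * Real.sin_sq_add_cos_sq a
  constructor
  · have h1 := Complex.hasSum_re h
    rw [Complex.inv_re, hns] at h1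
    convert! h1 using 1
    · ext k
      rw [hpow, Complex.re_ofReal_mul, Complex.exp_ofReal_mul_I_re]
    · simp [hzre]
  · have h1 := Complex.hasSum_im h
    rw [Complex.inv_im, hns] at h1
    convert! h1 using 1
    · ext k
      rw [hpow, Complex.im_ofReal_mul, Complex.exp_ofReal_mul_I_im]
    · simp [hzim]

theorem eval_T_eq_cos (n : ℤ) {x : ℝ} (hx : x ∈ Icc (-1 : ℝ) 1) :
    (T ℝ n).eval x = Real.cos (n * Real.arccos x) := by
  conv_lhs => rw [← Real.cos_arccos hx.1 hx.2]
  exact Polynomial.Chebyshev.T_real_cos _ _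

theorem rt_mul_eval_U (n : ℤ) {x : ℝ} (hx : x ∈ Icc (-1 : ℝ) 1) :
    rt x * (U ℝ n).eval x = Real.sin ((n + 1) * Real.arccos x) := by
  rw [← Polynomial.Chebyshev.U_real_cos, Real.cos_arccos hx.1 hx.2, Real.sin_arccos, mul_comm]
  rfl

/-- In angular variables `den` is the product of the two Poisson denominators of the circle at `a +
b` and `a - b`, which arise from the product-to-sum formulas. -/
theorem den_eq_mul (r a b : ℝ) : den r (Real.cos a) (Real.cos b) =
    (1 - 2 * r * Real.cos (a + b) + r ^ 2) * (1 - 2 * r * Real.cos (a - b) + r ^ 2) := by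
  rw [Real.cos_add, Real.cos_sub, den]
  have ha := Real.sin_sq a
  have hb := Real.sin_sq b
  linear_combination (4 * r ^ 2 * Real.sin b ^ 2) * ha + (4 * r ^ 2 * (1 - Real.cos a ^ 2)) * hb

theorem one_sub_two_mul_cos_pos {r : ℝ} (hr0 : 0 ≤ r) (hr : r < 1) (a : ℝ) :
    0 < 1 - 2 * r * Real.cos a + r ^ 2 := by
  nlinarith [Real.cos_le_one a, mul_le_mul_of_nonneg_left (Real.cos_le_one a) hr0,
    sq_pos_of_pos (sub_pos.mpr hr)]

/-- Product-to-sum reduces the series to two geometric ones. The term `k = 0` enters with full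
weight, hence the `1 +` in the value. -/
theorem hasSum_poisKer {r : ℝ} (hr0 : 0 ≤ r) (hr : r < 1) {x y : ℝ} (hx : x ∈ Icc (-1 : ℝ) 1)
    (hy : y ∈ Icc (-1 : ℝ) 1) :
    HasSum (fun k : ℕ => r ^ k * ((T ℝ k).eval x * (T ℝ k).eval y)) ((1 + poisKer r x y) / 2) := by
  set a := Real.arccos x with ha
  set b := Real.arccos y with hb
  have h := ((hasSum_pow_mul_cos hr0 hr (a + b)).1.add
    (hasSum_pow_mul_cos hr0 hr (a - b)).1).div_const 2
  have hA := one_sub_two_mul_cos_pos hr0 hr (a + b)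
  have hB := one_sub_two_mul_cos_pos hr0 hr (a - b)
  convert! h using 1
  · ext k
    rw [eval_T_eq_cos _ hx, eval_T_eq_cos _ hy, ← ha, ← hb, mul_add, mul_sub, Real.cos_add,
      Real.cos_sub]
    push_cast
    ring
  · have hxa : x = Real.cos a := (Real.cos_arccos hx.1 hx.2).symm
    have hyb : y = Real.cos b := (Real.cos_arccos hy.1 hy.2).symm
    rw [poisKer, hxa, hyb, den_eq_mul]
    congr 1
    rw [div_add_div _ _ hA.ne' hB.ne', eq_div_iff (mul_pos hA hB).ne', add_mul,
      div_mul_cancel₀ _ (mul_pos hA hB).ne', Real.cos_add, Real.cos_sub]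
    ring

/-- Here `√(1 - x²) U_{k-1}(x) T_k(y) = sin(ka) cos(kb)` is a half sum of sines at `a ± b`. Dividing
by `√(1 - x²)` requires `x` in the open interval; the term `k = 0` vanishes since `U_{-1} = 0`. -/
theorem hasSum_conjKer {r : ℝ} (hr0 : 0 ≤ r) (hr : r < 1) {x y : ℝ} (hx : x ∈ Ioo (-1 : ℝ) 1)
    (hy : y ∈ Icc (-1 : ℝ) 1) :
    HasSum (fun k : ℕ => r ^ k * ((U ℝ ((k : ℤ) - 1)).eval x * (T ℝ k).eval y))
      (conjKer r x y / 2) := by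
  have hx' := Ioo_subset_Icc_self hx
  set a := Real.arccos x with ha
  set b := Real.arccos y with hb
  have h := ((hasSum_pow_mul_cos hr0 hr (a + b)).2.add
    (hasSum_pow_mul_cos hr0 hr (a - b)).2).div_const (2 * rt x)
  have hA := one_sub_two_mul_cos_pos hr0 hr (a + b)
  have hB := one_sub_two_mul_cos_pos hr0 hr (a - b)
  have hrt := rt_pos hx
  convert! h using 1
  · ext k
    have := rt_mul_eval_U ((k : ℤ) - 1) hx'
    rw [eq_div_iff (by positivity), eval_T_eq_cos _ hy, ← hb, mul_add, mul_sub, Real.sin_add,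
      Real.sin_sub]
    push_cast at this ⊢
    rw [sub_add_cancel, ← ha] at this
    linear_combination (2 * r ^ k * Real.cos (k * b)) * this
  · have hxa : x = Real.cos a := (Real.cos_arccos hx'.1 hx'.2).symm
    have hyb : y = Real.cos b := (Real.cos_arccos hy.1 hy.2).symm
    have hra : rt x = Real.sin a := by rw [ha, Real.sin_arccos]; rfl
    rw [← div_div, div_right_comm _ 2, conjKer]
    congr 1
    rw [eq_div_iff hrt.ne', hra, div_add_div _ _ hA.ne' hB.ne', hxa, hyb, den_eq_mul,
      div_mul_eq_mul_div]
    congr 1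
    rw [Real.cos_add, Real.cos_sub, Real.sin_add, Real.sin_sub]
    linear_combination (4 * r ^ 2 * Real.sin a * Real.cos a) * Real.sin_sq_add_cos_sq b

/-! ### Chebyshev orthogonality and termwise integration of Abel series -/

theorem abs_eval_T_le_one (n : ℤ) {x : ℝ} (hx : x ∈ Icc (-1 : ℝ) 1) : |(T ℝ n).eval x| ≤ 1 := by
  rw [eval_T_eq_cos n hx]; exact Real.abs_cos_le_one _

theorem abs_rt_mul_eval_U_le_one (n : ℤ) {x : ℝ} (hx : x ∈ Icc (-1 : ℝ) 1) :
    |rt x * (U ℝ n).eval x| ≤ 1 := by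
  rw [rt_mul_eval_U n hx]; exact Real.abs_sin_le_one _

theorem integral_eval_T (n : ℤ) :
    ∫ x, (T ℝ n).eval x ∂measureT = if n = 0 then Real.pi else 0 := by
  split_ifs with h
  · rw [h]; exact Polynomial.Chebyshev.integral_eval_T_real_measureT_zero
  · exact Polynomial.Chebyshev.integral_eval_T_real_measureT_of_ne_zero h

theorem integral_eval_T_mul_eval_T (n m : ℕ) :
    ∫ x, (T ℝ n).eval x * (T ℝ m).eval x ∂measureT =
      if m = n then (if n = 0 then Real.pi else Real.pi / 2) else 0 := by
  rw [Polynomial.Chebyshev.integral_eval_T_real_mul_eval_T_real_measureT, integral_eval_T,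
    integral_eval_T]
  split_ifs <;> first | omega | ring

theorem integral_rt_mul_eval_U_mul (n m : ℕ) :
    ∫ x, (rt x * (U ℝ n).eval x) * (rt x * (U ℝ m).eval x) ∂measureT =
      if m = n then Real.pi / 2 else 0 := by
  have h : ∀ᵐ x ∂measureT, (rt x * (U ℝ n).eval x) * (rt x * (U ℝ m).eval x)
      = ((T ℝ ((n : ℤ) - m)).eval x - (T ℝ ((n : ℤ) + m + 2)).eval x) / 2 := by
    filter_upwards [ae_measureT_mem] with x hx
    have hx' := Ioo_subset_Icc_self hx
    rw [rt_mul_eval_U _ hx', rt_mul_eval_U _ hx', eval_T_eq_cos _ hx', eval_T_eq_cos _ hx']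
    set a := Real.arccos x
    have h1 := Real.cos_sub (((n : ℤ) + 1) * a) (((m : ℤ) + 1) * a)
    have h2 := Real.cos_add (((n : ℤ) + 1) * a) (((m : ℤ) + 1) * a)
    have e1 : (((n : ℤ) - m : ℤ) : ℝ) * a = ((n : ℤ) + 1) * a - ((m : ℤ) + 1) * a := by
      push_cast; ring
    have e2 : (((n : ℤ) + m + 2 : ℤ) : ℝ) * a = ((n : ℤ) + 1) * a + ((m : ℤ) + 1) * a := by
      push_cast; ring
    rw [e1, e2, h1, h2]
    ring
  rw [integral_congr_ae h, integral_div, integral_sub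
    (Polynomial.Chebyshev.integrable_measureT (by fun_prop))
    (Polynomial.Chebyshev.integrable_measureT (by fun_prop)), integral_eval_T, integral_eval_T]
  split_ifs <;> first | omega | ring

theorem integrable_measureT_of_bound {f : ℝ → ℝ} {C : ℝ} (hf : Measurable f)
    (hC : ∀ x ∈ Icc (-1 : ℝ) 1, |f x| ≤ C) : Integrable f measureT :=
  (integrable_const C).mono' hf.aestronglyMeasurable (by
    filter_upwards [ae_measureT_mem] with x hx
    exact hC x (Ioo_subset_Icc_self hx))

/-- Termwise integration of an Abel series with bounded terms in which a single term survives. -/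
theorem integral_abel_series {r : ℝ} (hr0 : 0 ≤ r) (hr : r < 1) {F : ℕ → ℝ → ℝ} {G : ℝ → ℝ}
    {n : ℕ} {c : ℝ} (hm : ∀ k, Measurable (F k))
    (hF : ∀ k, ∀ x ∈ Icc (-1 : ℝ) 1, |F k x| ≤ 1)
    (hG : ∀ x ∈ Ioo (-1 : ℝ) 1, HasSum (fun k => r ^ k * F k x) (G x))
    (hint : ∀ k, ∫ x, F k x ∂measureT = if k = n then c else 0) :
    ∫ x, G x ∂measureT = r ^ n * c := by
  have hi : ∀ k, Integrable (fun x => r ^ k * F k x) measureT := fun k =>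
    (integrable_measureT_of_bound (hm k) (hF k)).const_mul _
  have hs : Summable fun k => ∫ x, ‖r ^ k * F k x‖ ∂measureT := by
    refine Summable.of_nonneg_of_le (fun k => integral_nonneg fun _ => norm_nonneg _) (fun k => ?_)
      ((summable_geometric_of_lt_one hr0 hr).mul_right (measureT.real univ))
    calc _ ≤ ∫ x, r ^ k ∂measureT := by
          refine integral_mono_ae (hi k).norm (integrable_const _) ?_
          filter_upwards [ae_measureT_mem] with x hx
          rw [norm_mul, Real.norm_of_nonneg (pow_nonneg hr0 k)]
          exact mul_le_of_le_one_right (pow_nonneg hr0 k) (hF k x (Ioo_subset_Icc_self hx))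
      _ = _ := by rw [integral_const, smul_eq_mul, mul_comm]
  have h1 := hasSum_integral_of_summable_integral_norm hi hs
  have h2 : ∫ x, ∑' k, r ^ k * F k x ∂measureT = ∫ x, G x ∂measureT := by
    refine integral_congr_ae ?_
    filter_upwards [ae_measureT_mem] with x hx using (hG x hx).tsum_eq
  rw [h2] at h1
  refine h1.unique ?_
  have h3 := hasSum_ite_eq n (r ^ n * c)
  convert! h3 using 1
  ext k
  rw [integral_const_mul, hint]
  split_ifs with h
  · rw [h]
  · rw [mul_zero]

theorem integral_eval_T_mul_poisKer (n : ℕ) {r : ℝ} (hr0 : 0 ≤ r) (hr : r < 1) {y : ℝ}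
    (hy : y ∈ Icc (-1 : ℝ) 1) :
    ∫ x, (T ℝ n).eval x * poisKer r x y ∂measureT = Real.pi * (r ^ n * (T ℝ n).eval y) := by
  have h1 : ∫ x, (T ℝ n).eval x * ((1 + poisKer r x y) / 2) ∂measureT
      = r ^ n * ((T ℝ n).eval y * if n = 0 then Real.pi else Real.pi / 2) := by
    refine integral_abel_series hr0 hr
      (F := fun k x => (T ℝ n).eval x * ((T ℝ k).eval x * (T ℝ k).eval y))
      (fun k => by fun_prop) (fun k x hx => ?_) (fun x hx => ?_) fun k => ?_
    · rw [abs_mul, abs_mul]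
      exact mul_le_one₀ (abs_eval_T_le_one _ hx) (by positivity)
        (mul_le_one₀ (abs_eval_T_le_one _ hx) (abs_nonneg _) (abs_eval_T_le_one _ hy))
    · have := (hasSum_poisKer hr0 hr (Ioo_subset_Icc_self hx) hy).mul_left ((T ℝ n).eval x)
      convert! this using 1
      ext k; ring
    · simp only [← mul_assoc]
      rw [integral_mul_const, integral_eval_T_mul_eval_T]
      split_ifs with h <;> simp [h, mul_comm]
  have hy' : |y| ≤ 1 := abs_le.mpr hy
  have hi : Integrable (fun x => (T ℝ n).eval x * poisKer r x y) measureT :=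
    Polynomial.Chebyshev.integrable_measureT
      (ContinuousOn.mul (by fun_prop) (continuousOn_poisKer hr0 hr hy'))
  have hT : Integrable (fun x => (T ℝ n).eval x) measureT :=
    Polynomial.Chebyshev.integrable_measureT (by fun_prop)
  have h2 : ∫ x, (T ℝ n).eval x * ((1 + poisKer r x y) / 2) ∂measureT =
      ((∫ x, (T ℝ n).eval x ∂measureT) + ∫ x, (T ℝ n).eval x * poisKer r x y ∂measureT) / 2 := by
    rw [← integral_add hT hi, ← integral_div]
    congr 1; ext x; ring
  rw [h2, integral_eval_T] at h1
  -- Undoing `(1 + poisKer) / 2`: the constant pairs with `T_n` only for `n = 0`, and its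
  -- contribution offsets the larger norm of `T_0`, so both cases give the same formula.
  have h3 : ∫ x, (T ℝ n).eval x * poisKer r x y ∂measureT =
      2 * (r ^ n * ((T ℝ n).eval y * if n = 0 then Real.pi else Real.pi / 2))
        - if (n : ℤ) = 0 then Real.pi else 0 := by rw [← h1]; ring
  rw [h3]
  rcases Nat.eq_zero_or_pos n with h | h
  · subst h; simp; ring
  · have h' : n ≠ 0 := h.ne'
    simp [h']; ring

theorem integral_poisKer {r : ℝ} (hr0 : 0 ≤ r) (hr : r < 1) {y : ℝ} (hy : y ∈ Icc (-1 : ℝ) 1) :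
    ∫ x, poisKer r x y ∂measureT = Real.pi := by
  simpa using integral_eval_T_mul_poisKer 0 hr0 hr hy

/-- Only `k = n + 1` survives. One factor `rt` makes a sine of `U_{k-1}`, the other belongs to the
density. Compared with `integral_eval_T_mul_poisKer`, this says that the conjugate means of `√(1 -
x²) U_n` are the Abel–Poisson means of `T_{n+1}`. -/
theorem integral_eval_U_mul_conjKer (n : ℕ) {r : ℝ} (hr0 : 0 ≤ r) (hr : r < 1) {y : ℝ}
    (hy : y ∈ Icc (-1 : ℝ) 1) :
    ∫ x, (rt x * (U ℝ n).eval x) * (rt x * conjKer r x y) ∂measureT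
      = Real.pi * (r ^ (n + 1) * (T ℝ (n + 1)).eval y) := by
  have h1 : ∫ x, (rt x * (U ℝ n).eval x) * (rt x * (conjKer r x y / 2)) ∂measureT
      = r ^ (n + 1) * ((T ℝ (n + 1)).eval y * (Real.pi / 2)) := by
    refine integral_abel_series hr0 hr
      (F := fun k x => (rt x * (U ℝ n).eval x) *
        ((rt x * (U ℝ ((k : ℤ) - 1)).eval x) * (T ℝ k).eval y))
      (fun k => ?_) (fun k x hx => ?_) (fun x hx => ?_) fun k => ?_
    · have := measurable_rt
      fun_prop
    · rw [abs_mul (rt x * (U ℝ n).eval x), abs_mul (rt x * (U ℝ ((k : ℤ) - 1)).eval x)]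
      exact mul_le_one₀ (abs_rt_mul_eval_U_le_one _ hx) (by positivity)
        (mul_le_one₀ (abs_rt_mul_eval_U_le_one _ hx) (abs_nonneg _) (abs_eval_T_le_one _ hy))
    · have := (hasSum_conjKer hr0 hr hx hy).mul_left (rt x * (U ℝ n).eval x * rt x)
      convert! this using 1
      · ext k; ring
      · ring
    · simp only [← mul_assoc]
      rw [integral_mul_const]
      rcases k with _ | k
      · simp
      · have e : (((k + 1 : ℕ) : ℤ) - 1) = (k : ℤ) := by push_cast; ring
        have := integral_rt_mul_eval_U_mul n k
        simp only [← mul_assoc] at this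
        rw [e, this]
        by_cases h : k = n
        · simp [h, mul_comm]
        · simp [h]
  have h2 : ∫ x, (rt x * (U ℝ n).eval x) * (rt x * (conjKer r x y / 2)) ∂measureT =
      (∫ x, (rt x * (U ℝ n).eval x) * (rt x * conjKer r x y) ∂measureT) / 2 := by
    rw [← integral_div]
    congr 1; ext x; ring
  rw [h2] at h1
  linarith

/-! ### Multiplication operators on `L²` of the Chebyshev measure -/

/-- The space `L²` of the Chebyshev measure, a copy of `L²_d(I)`. -/
abbrev LpT := Lp ℂ 2 measureT

/-- The extension of a function on `[-1, 1]` to the line, constant on both sides. -/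
def extC (c : C(Icc (-1 : ℝ) 1, ℂ)) : ℝ → ℂ := IccExtend (by norm_num) c

theorem extC_of_mem (c : C(Icc (-1 : ℝ) 1, ℂ)) {x : ℝ} (hx : x ∈ Icc (-1 : ℝ) 1) :
    extC c x = c ⟨x, hx⟩ := IccExtend_of_mem _ _ hx

theorem continuous_extC (c : C(Icc (-1 : ℝ) 1, ℂ)) : Continuous (extC c) :=
  c.continuous.Icc_extend'

theorem norm_extC_le (c : C(Icc (-1 : ℝ) 1, ℂ)) (x : ℝ) : ‖extC c x‖ ≤ ‖c‖ :=
  c.norm_coe_le_norm _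

theorem memLp_extC_mul (c : C(Icc (-1 : ℝ) 1, ℂ)) {f : ℝ → ℂ} (hf : MemLp f 2 measureT) :
    MemLp (fun x => extC c x * f x) 2 measureT :=
  MemLp.of_le_mul (c := ‖c‖) hf ((continuous_extC c).aestronglyMeasurable.mul hf.1)
    (ae_of_all _ fun x => by
      rw [norm_mul]; exact mul_le_mul_of_nonneg_right (norm_extC_le c x) (norm_nonneg _))

/-- Multiplication by a continuous function on `[-1, 1]`, as a linear map. -/
def mulLin (c : C(Icc (-1 : ℝ) 1, ℂ)) : LpT →ₗ[ℂ] LpT where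
  toFun h := (memLp_extC_mul c (Lp.memLp h)).toLp _
  map_add' f g := by
    rw [← MemLp.toLp_add]
    refine MemLp.toLp_congr _ _ ?_
    filter_upwards [Lp.coeFn_add f g] with x hx
    change extC c x * (f + g : LpT) x = _
    rw [hx, Pi.add_apply, mul_add]
    rfl
  map_smul' a f := by
    rw [RingHom.id_apply, ← MemLp.toLp_const_smul]
    refine MemLp.toLp_congr _ _ ?_
    filter_upwards [Lp.coeFn_smul a f] with x hx
    simp [hx, mul_left_comm]

theorem coeFn_mulLin (c : C(Icc (-1 : ℝ) 1, ℂ)) (h : LpT) :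
    mulLin c h =ᵐ[measureT] fun x => extC c x * h x :=
  (memLp_extC_mul c (Lp.memLp h)).coeFn_toLp

theorem norm_mulLin_le (c : C(Icc (-1 : ℝ) 1, ℂ)) (h : LpT) : ‖mulLin c h‖ ≤ ‖c‖ * ‖h‖ := by
  refine Lp.norm_le_mul_norm_of_ae_le_mul ?_
  filter_upwards [coeFn_mulLin c h] with x hx
  rw [hx, norm_mul]
  exact mul_le_mul_of_nonneg_right (norm_extC_le c x) (norm_nonneg _)

/-- Multiplication by a continuous function on `[-1, 1]`, as a bounded operator. -/
def mulOp : C(Icc (-1 : ℝ) 1, ℂ) →ₐ[ℂ] (LpT →L[ℂ] LpT) :=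
  AlgHom.ofLinearMap
    { toFun := fun c => (mulLin c).mkContinuous ‖c‖ (norm_mulLin_le c)
      map_add' := fun c d => by
        ext1 h
        apply Lp.ext
        rw [add_apply]
        filter_upwards [coeFn_mulLin (c + d) h, coeFn_mulLin c h, coeFn_mulLin d h,
          Lp.coeFn_add (mulLin c h) (mulLin d h)] with x h1 h2 h3 h4
        simp only [LinearMap.mkContinuous_apply]
        rw [h1, h4, Pi.add_apply, h2, h3, ← add_mul]
        rfl
      map_smul' := fun a c => by
        ext1 h
        apply Lp.ext
        simp only [RingHom.id_apply]
        rw [smul_apply]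
        filter_upwards [coeFn_mulLin (a • c) h, coeFn_mulLin c h,
          Lp.coeFn_smul a (mulLin c h)] with x h1 h2 h4
        simp only [LinearMap.mkContinuous_apply]
        rw [h1, h4, Pi.smul_apply, h2, smul_eq_mul, ← mul_assoc]
        rfl }
    (by
      ext1 h
      apply Lp.ext
      filter_upwards [coeFn_mulLin 1 h] with x h1
      change mulLin 1 h x = h x
      rw [h1]
      change 1 * _ = _
      rw [one_mul])
    (fun c d => by
      ext1 h
      apply Lp.ext
      filter_upwards [coeFn_mulLin (c * d) h, coeFn_mulLin c (mulLin d h),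
        coeFn_mulLin d h] with x h1 h2 h3
      change mulLin (c * d) h x = mulLin c (mulLin d h) x
      rw [h1, h2, h3, ← mul_assoc]
      rfl)

theorem coeFn_mulOp (c : C(Icc (-1 : ℝ) 1, ℂ)) (h : LpT) :
    mulOp c h =ᵐ[measureT] fun x => extC c x * h x := coeFn_mulLin c h

theorem norm_mulOp_le (c : C(Icc (-1 : ℝ) 1, ℂ)) : ‖mulOp c‖ ≤ ‖c‖ :=
  LinearMap.mkContinuous_norm_le _ (norm_nonneg _) (norm_mulLin_le c)

/-- Multiplication operators depend continuously on the multiplier. -/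
def mulOpL : C(Icc (-1 : ℝ) 1, ℂ) →L[ℂ] (LpT →L[ℂ] LpT) :=
  mulOp.toLinearMap.mkContinuous 1 fun c => by rw [one_mul]; exact norm_mulOp_le c

/-- The constant function `1` as an element of `L²`. -/
def oneT : LpT := (memLp_const (1 : ℂ)).toLp (fun _ => 1)

/-- The class in `L²` of a continuous function on `[-1, 1]`. -/
def emb (c : C(Icc (-1 : ℝ) 1, ℂ)) : LpT := mulOp c oneT

theorem coeFn_emb (c : C(Icc (-1 : ℝ) 1, ℂ)) : emb c =ᵐ[measureT] extC c := by
  filter_upwards [coeFn_mulOp c oneT, (memLp_const (μ := measureT) (p := 2) (1 : ℂ)).coeFn_toLp]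
    with x h1 h2
  change mulOp c oneT x = _
  rw [h1]
  unfold oneT
  rw [h2, mul_one]

theorem mulOp_emb (c d : C(Icc (-1 : ℝ) 1, ℂ)) : mulOp c (emb d) = emb (c * d) := by
  rw [emb, emb, map_mul]; rfl

theorem emb_add (c d : C(Icc (-1 : ℝ) 1, ℂ)) : emb (c + d) = emb c + emb d := by
  rw [emb, map_add]; rfl

theorem emb_sub (c d : C(Icc (-1 : ℝ) 1, ℂ)) : emb (c - d) = emb c - emb d := by
  rw [emb, map_sub]; rfl

theorem emb_neg (c : C(Icc (-1 : ℝ) 1, ℂ)) : emb (-c) = -emb c := by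
  rw [emb, map_neg]; rfl

theorem emb_smul (a : ℂ) (c : C(Icc (-1 : ℝ) 1, ℂ)) : emb (a • c) = a • emb c := by
  rw [emb, map_smul]; rfl

theorem integrable_coe (h : LpT) : Integrable h measureT :=
  (Lp.memLp h).integrable one_le_two

/-- Pairing with a continuous function on `[-1, 1]`. -/
theorem inner_emb (c : C(Icc (-1 : ℝ) 1, ℂ)) (h : LpT) :
    inner ℂ (emb c) h = ∫ x, h x * (starRingEnd ℂ) (extC c x) ∂measureT := by
  rw [L2.inner_def]
  refine integral_congr_ae ?_
  filter_upwards [coeFn_emb c] with x hx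
  rw [hx]
  rfl

/-- Integration against the Chebyshev measure, as a bounded functional. -/
def intT : LpT →L[ℂ] ℂ := innerSL ℂ (emb 1)

theorem intT_apply (h : LpT) : intT h = ∫ x, h x ∂measureT := by
  rw [intT, innerSL_apply_apply, inner_emb]
  refine integral_congr_ae (ae_of_all _ fun x => ?_)
  have : extC 1 x = 1 := rfl
  simp [this]

theorem intT_emb (c : C(Icc (-1 : ℝ) 1, ℂ)) : intT (emb c) = ∫ x, extC c x ∂measureT := by
  rw [intT_apply]; exact integral_congr_ae (coeFn_emb c)

/-- The Chebyshev polynomial `T_n` on `[-1, 1]`. -/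
def tC (n : ℤ) : C(Icc (-1 : ℝ) 1, ℂ) :=
  ⟨fun x => (((T ℝ n).eval (x : ℝ) : ℝ) : ℂ), by fun_prop⟩

/-- The Chebyshev polynomial `U_n` on `[-1, 1]`. -/
def uC (n : ℤ) : C(Icc (-1 : ℝ) 1, ℂ) :=
  ⟨fun x => (((U ℝ n).eval (x : ℝ) : ℝ) : ℂ), by fun_prop⟩

/-- The function `√(1 - x²)` on `[-1, 1]`. -/
def rtC : C(Icc (-1 : ℝ) 1, ℂ) :=
  ⟨fun x => (rt x : ℂ), Complex.continuous_ofReal.comp (continuous_rt.comp continuous_subtype_val)⟩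

/-- The function `x` on `[-1, 1]`. -/
def xC : C(Icc (-1 : ℝ) 1, ℂ) := ⟨fun x => ((x : ℝ) : ℂ), by fun_prop⟩

theorem extC_tC (n : ℤ) {x : ℝ} (hx : x ∈ Icc (-1 : ℝ) 1) :
    extC (tC n) x = ((T ℝ n).eval x : ℝ) := extC_of_mem _ hx

theorem extC_rtC_mul_uC (n : ℤ) {x : ℝ} (hx : x ∈ Icc (-1 : ℝ) 1) :
    extC (rtC * uC n) x = ((rt x * (U ℝ n).eval x : ℝ) : ℂ) := by
  rw [extC_of_mem _ hx]
  simp [rtC, uC]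

theorem intT_emb_tC (n : ℤ) : intT (emb (tC n)) = if n = 0 then (Real.pi : ℂ) else 0 := by
  have h : ∫ x, extC (tC n) x ∂measureT = ∫ x, (((T ℝ n).eval x : ℝ) : ℂ) ∂measureT := by
    refine integral_congr_ae ?_
    filter_upwards [ae_measureT_mem] with x hx using extC_tC n (Ioo_subset_Icc_self hx)
  rw [intT_emb, h, integral_complex_ofReal, integral_eval_T]
  split_ifs <;> simp

/-! ### Completeness of the Chebyshev systems -/

/-- By Weierstrass approximation vanishing moments annihilate all continuous functions, in
particular the smooth test functions with compact support in the open interval. -/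
theorem ae_eq_zero_of_forall_integral_pow_mul {G : ℝ → ℂ} (hG : IntegrableOn G (Ioo (-1 : ℝ) 1))
    (h : ∀ k : ℕ, ∫ x in Ioo (-1 : ℝ) 1, ((x ^ k : ℝ) : ℂ) * G x = 0) :
    G =ᵐ[volume.restrict (Ioo (-1 : ℝ) 1)] 0 := by
  have hbdd : ∀ g : ℝ → ℝ, Continuous g →
      IntegrableOn (fun x => ((g x : ℝ) : ℂ) * G x) (Ioo (-1 : ℝ) 1) := by
    intro g hg
    obtain ⟨C, hC⟩ := isCompact_Icc.exists_bound_of_continuousOn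
      (hg.continuousOn (s := Icc (-1 : ℝ) 1))
    refine Integrable.bdd_mul (c := C) hG (by fun_prop) ?_
    filter_upwards [ae_restrict_mem measurableSet_Ioo] with x hx
    rw [Complex.norm_real]
    exact hC x (Ioo_subset_Icc_self hx)
  have hpoly : ∀ p : Polynomial ℝ, ∫ x in Ioo (-1 : ℝ) 1, ((p.eval x : ℝ) : ℂ) * G x = 0 := by
    intro p
    induction p using Polynomial.induction_on' with
    | add p q hp hq =>
      simp only [Polynomial.eval_add, Complex.ofReal_add, add_mul]
      rw [integral_add (hbdd _ (by fun_prop)) (hbdd _ (by fun_prop)), hp, hq, add_zero]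
    | monomial n a =>
      simp only [Polynomial.eval_monomial, Complex.ofReal_mul a, mul_assoc]
      rw [integral_const_mul, h, mul_zero]
  have hcont : ∀ g : ℝ → ℝ, Continuous g → ∫ x in Ioo (-1 : ℝ) 1, ((g x : ℝ) : ℂ) * G x = 0 := by
    intro g hg
    by_contra hne
    set A := ∫ x in Ioo (-1 : ℝ) 1, ‖G x‖ with hA
    have hA0 : 0 ≤ A := integral_nonneg fun _ => norm_nonneg _
    set d := ‖∫ x in Ioo (-1 : ℝ) 1, ((g x : ℝ) : ℂ) * G x‖ with hd
    have hd0 : 0 < d := norm_pos_iff.mpr hne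
    -- The tolerance `d / (A + 1)` makes the error strictly less than `d`, even when `A = 0`.
    obtain ⟨p, hp⟩ := exists_polynomial_near_of_continuousOn (-1) 1 g hg.continuousOn
      (d / (A + 1)) (by positivity)
    have h1 : d ≤ d / (A + 1) * A := by
      have e : ∫ x in Ioo (-1 : ℝ) 1, ((g x : ℝ) : ℂ) * G x
          = ∫ x in Ioo (-1 : ℝ) 1, ((g x - p.eval x : ℝ) : ℂ) * G x := by
        simp only [Complex.ofReal_sub, sub_mul]
        rw [integral_sub (hbdd g hg) (hbdd _ (by fun_prop)), hpoly, sub_zero]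
      calc d = ‖∫ x in Ioo (-1 : ℝ) 1, ((g x - p.eval x : ℝ) : ℂ) * G x‖ := by rw [hd, e]
        _ ≤ ∫ x in Ioo (-1 : ℝ) 1, d / (A + 1) * ‖G x‖ := by
          refine norm_integral_le_of_norm_le (Integrable.const_mul hG.norm _) ?_
          filter_upwards [ae_restrict_mem measurableSet_Ioo] with x hx
          rw [norm_mul, Complex.norm_real]
          refine mul_le_mul_of_nonneg_right ?_ (norm_nonneg _)
          rw [Real.norm_eq_abs, abs_sub_comm]
          exact (hp x (Ioo_subset_Icc_self hx)).le
        _ = d / (A + 1) * A := integral_const_mul _ _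
    have h2 : d / (A + 1) * A < d := by
      rw [div_mul_eq_mul_div, div_lt_iff₀ (by positivity)]
      nlinarith
    linarith
  have h3 := isOpen_Ioo.ae_eq_zero_of_integral_contDiff_smul_eq_zero (μ := volume)
    (U := Ioo (-1 : ℝ) 1) (f := G) hG.locallyIntegrableOn (fun g hg _ hs => ?_)
  · exact (ae_restrict_iff' measurableSet_Ioo).mpr h3
  · rw [← hcont g hg.continuous, ← setIntegral_eq_integral_of_forall_compl_eq_zero
      (s := Ioo (-1 : ℝ) 1)]
    · refine integral_congr_ae (ae_of_all _ fun x => ?_)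
      simp only [Complex.real_smul]
    · intro x hx
      have : g x = 0 := by
        by_contra hne
        exact hx (hs (subset_tsupport g hne))
      rw [this, zero_smul]

/-- The three-term recurrence converts multiplication by `X` into combinations of neighbours, so all
`Xᵏ Q_n` are annihilated; `n = 0` gives the monomials. Both kinds of Chebyshev polynomials fit, with
`a = 1` for `T` and `a = 1/2` for `U`. -/
theorem ae_eq_zero_of_forall_integral_chebyshev {G : ℝ → ℂ}
    (hG : IntegrableOn G (Ioo (-1 : ℝ) 1)) {Q : ℕ → Polynomial ℝ} (h0 : Q 0 = 1) {a : ℝ}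
    (h1 : Polynomial.X = Polynomial.C a * Q 1)
    (hrec : ∀ n, 2 * Polynomial.X * Q (n + 1) = Q (n + 2) + Q n)
    (h : ∀ n, ∫ x in Ioo (-1 : ℝ) 1, (((Q n).eval x : ℝ) : ℂ) * G x = 0) :
    G =ᵐ[volume.restrict (Ioo (-1 : ℝ) 1)] 0 := by
  have hbdd : ∀ p : Polynomial ℝ,
      IntegrableOn (fun x => ((p.eval x : ℝ) : ℂ) * G x) (Ioo (-1 : ℝ) 1) := by
    intro p
    obtain ⟨C, hC⟩ := isCompact_Icc.exists_bound_of_continuousOn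
      (p.continuous.continuousOn (s := Icc (-1 : ℝ) 1))
    refine Integrable.bdd_mul (c := C) hG (by fun_prop) ?_
    filter_upwards [ae_restrict_mem measurableSet_Ioo] with x hx
    rw [Complex.norm_real]
    exact hC x (Ioo_subset_Icc_self hx)
  have key : ∀ k n : ℕ, ∫ x in Ioo (-1 : ℝ) 1,
      (((Polynomial.X ^ k * Q n).eval x : ℝ) : ℂ) * G x = 0 := by
    intro k
    induction k with
    | zero => intro n; simpa using h n
    | succ k ih =>
      intro n
      rcases n with _ | n
      · have e : Polynomial.X ^ (k + 1) * Q 0 = Polynomial.C a * (Polynomial.X ^ k * Q 1) := by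
          rw [h0, pow_succ, mul_one, mul_left_comm, ← h1]
        rw [e]
        simp only [Polynomial.eval_mul (p := Polynomial.C a), Polynomial.eval_C,
          Complex.ofReal_mul a, mul_assoc]
        rw [integral_const_mul, ih, mul_zero]
      · have e : Polynomial.X ^ (k + 1) * Q (n + 1) = Polynomial.C (1 / 2 : ℝ) *
            (Polynomial.X ^ k * Q (n + 2) + Polynomial.X ^ k * Q n) := by
          rw [← mul_add, ← hrec]
          have : Polynomial.C (1 / 2 : ℝ) * 2 = 1 := by
            rw [← Polynomial.C_ofNat, ← Polynomial.C_mul]; norm_num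
          linear_combination (-(Polynomial.X ^ (k + 1) * Q (n + 1))) * this
        rw [e]
        simp only [Polynomial.eval_mul (p := Polynomial.C (1 / 2 : ℝ)), Polynomial.eval_C,
          Complex.ofReal_mul (1 / 2 : ℝ), mul_assoc]
        simp only [Polynomial.eval_add, Complex.ofReal_add, add_mul]
        rw [integral_const_mul, integral_add (hbdd _) (hbdd _), ih, ih, add_zero, mul_zero]
  refine ae_eq_zero_of_forall_integral_pow_mul hG fun k => ?_
  simpa [h0] using key k 0

theorem eq_zero_of_ae {g : LpT} (h : g =ᵐ[volume.restrict (Ioo (-1 : ℝ) 1)] 0) : g = 0 := by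
  rw [← ae_measureT] at h
  apply Lp.ext
  filter_upwards [h, Lp.coeFn_zero ℂ 2 measureT] with x h1 h2
  rw [h1, h2]

/-- The factor `√(1 - x²)` cancels the density, so orthogonality of `g` reads `∫ U_n g dx = 0`. -/
theorem span_sin_orthogonal :
    (Submodule.span ℂ (Set.range fun n : ℕ => emb (rtC * uC n)))ᗮ = ⊥ := by
  rw [Submodule.eq_bot_iff]
  intro g hg
  apply eq_zero_of_ae
  refine ae_eq_zero_of_forall_integral_chebyshev (integrable_coe g).integrableOn_of_measureT
    (Q := fun n => U ℝ n) (a := 1 / 2) (by simp) ?_ (fun n => ?_) fun n => ?_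
  · simp only [Nat.cast_one, Polynomial.Chebyshev.U_one]
    rw [← mul_assoc, ← Polynomial.C_ofNat, ← Polynomial.C_mul]; norm_num
  · have := Polynomial.Chebyshev.U_add_two ℝ n
    push_cast
    rw [this]; ring
  · have h1 := (Submodule.mem_orthogonal _ g).mp hg _ (Submodule.subset_span ⟨n, rfl⟩)
    rw [inner_emb] at h1
    rw [← h1, ← integral_rt_mul]
    refine integral_congr_ae ?_
    filter_upwards [ae_measureT_mem] with x hx
    rw [extC_rtC_mul_uC _ (Ioo_subset_Icc_self hx), Complex.conj_ofReal]
    push_cast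
    ring

/-- No factor cancels the density this time, so completeness is applied to `g / √(1 - x²)`. -/
theorem span_cos_orthogonal :
    (Submodule.span ℂ (Set.range fun n : ℕ => emb (tC n)))ᗮ = ⊥ := by
  rw [Submodule.eq_bot_iff]
  intro g hg
  have hG : IntegrableOn (fun x => (rt x : ℂ)⁻¹ * g x) (Ioo (-1 : ℝ) 1) := by
    have := integrable_measureT_iff.mp (integrable_coe g)
    refine this.congr (ae_of_all _ fun x => ?_)
    simp
  have h0 : (fun x => (rt x : ℂ)⁻¹ * g x) =ᵐ[volume.restrict (Ioo (-1 : ℝ) 1)] 0 := by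
    refine ae_eq_zero_of_forall_integral_chebyshev hG
      (Q := fun n => T ℝ n) (a := 1) (by simp) (by simp) (fun n => ?_) fun n => ?_
    · have := Polynomial.Chebyshev.T_add_two ℝ n
      push_cast
      rw [this]; ring
    · have h1 := (Submodule.mem_orthogonal _ g).mp hg _ (Submodule.subset_span ⟨n, rfl⟩)
      rw [inner_emb] at h1
      rw [← h1, integral_measureT_smul]
      refine integral_congr_ae ?_
      filter_upwards [ae_restrict_mem measurableSet_Ioo] with x hx
      rw [extC_tC _ (Ioo_subset_Icc_self hx), Complex.conj_ofReal, Complex.real_smul]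
      push_cast
      ring
  apply eq_zero_of_ae
  filter_upwards [h0, ae_restrict_mem measurableSet_Ioo] with x h1 hx
  have : (rt x : ℂ)⁻¹ ≠ 0 := inv_ne_zero (Complex.ofReal_ne_zero.mpr (rt_pos hx).ne')
  exact (mul_eq_zero.mp h1).resolve_left this

/-- By density, operator identities reduce to trigonometric identities on `√(1 - x²) U_n`;
`ext_of_cos` does the same with `T_n`. -/
theorem ext_of_sin {F : Type*} [NormedAddCommGroup F] [NormedSpace ℂ F] {A B : LpT →L[ℂ] F}
    (h : ∀ n : ℕ, A (emb (rtC * uC n)) = B (emb (rtC * uC n))) : A = B := by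
  refine ContinuousLinearMap.ext_on (s := Set.range fun n : ℕ => emb (rtC * uC n)) ?_ ?_
  · rw [Submodule.dense_iff_topologicalClosure_eq_top, Submodule.topologicalClosure_eq_top_iff]
    exact span_sin_orthogonal
  · rintro _ ⟨n, rfl⟩; exact h n

theorem ext_of_cos {F : Type*} [NormedAddCommGroup F] [NormedSpace ℂ F] {A B : LpT →L[ℂ] F}
    (h : ∀ n : ℕ, A (emb (tC n)) = B (emb (tC n))) : A = B := by
  refine ContinuousLinearMap.ext_on (s := Set.range fun n : ℕ => emb (tC n)) ?_ ?_
  · rw [Submodule.dense_iff_topologicalClosure_eq_top, Submodule.topologicalClosure_eq_top_iff]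
    exact span_cos_orthogonal
  · rintro _ ⟨n, rfl⟩; exact h n

/-! ### The finite Hilbert transform on `L²_d` -/

/-- The factor that normalizes the Chebyshev systems. -/
def nrm : ℂ := (Real.sqrt (2 / Real.pi) : ℝ)

theorem nrm_ne_zero : nrm ≠ 0 :=
  Complex.ofReal_ne_zero.mpr (Real.sqrt_pos.mpr (by positivity)).ne'

theorem inner_nrm_smul {c d : C(Icc (-1 : ℝ) 1, ℂ)} {p q : ℝ → ℝ}
    (hc : ∀ x ∈ Icc (-1 : ℝ) 1, extC c x = p x) (hd : ∀ x ∈ Icc (-1 : ℝ) 1, extC d x = q x) :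
    inner ℂ (nrm • emb c) (nrm • emb d) = (((2 / Real.pi) * ∫ x, p x * q x ∂measureT : ℝ) : ℂ) := by
  rw [inner_smul_left, inner_smul_right, inner_emb, ← mul_assoc, nrm, Complex.conj_ofReal,
    ← Complex.ofReal_mul, Real.mul_self_sqrt (by positivity), Complex.ofReal_mul,
    ← integral_complex_ofReal]
  congr 1
  refine integral_congr_ae ?_
  filter_upwards [coeFn_emb d, ae_measureT_mem] with x h1 hx
  rw [h1, hd x (Ioo_subset_Icc_self hx), hc x (Ioo_subset_Icc_self hx), Complex.conj_ofReal,
    Complex.ofReal_mul, mul_comm]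

theorem orthonormal_sin : Orthonormal ℂ fun n : ℕ => nrm • emb (rtC * uC n) := by
  rw [orthonormal_iff_ite]
  intro i j
  rw [inner_nrm_smul (fun x hx => extC_rtC_mul_uC i hx) (fun x hx => extC_rtC_mul_uC j hx),
    integral_rt_mul_eval_U_mul]
  by_cases h : i = j
  · rw [if_pos h, if_pos h.symm, div_mul_div_cancel₀ (by positivity)]; norm_num
  · rw [if_neg h, if_neg (Ne.symm h)]; simp

/-- The index starts at `1`: `T_0` has a different norm and is not in the range of the finite
Hilbert transform. -/
theorem orthonormal_cos : Orthonormal ℂ fun n : ℕ => nrm • emb (tC (n + 1)) := by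
  rw [orthonormal_iff_ite]
  intro i j
  rw [inner_nrm_smul (fun x hx => extC_tC ((i : ℤ) + 1) hx) (fun x hx => extC_tC ((j : ℤ) + 1) hx)]
  have := integral_eval_T_mul_eval_T (i + 1) (j + 1)
  simp only [Nat.cast_add, Nat.cast_one] at this
  rw [this]
  by_cases h : i = j
  · rw [if_pos h, if_pos (by simp [h]), if_neg (by simp), div_mul_div_cancel₀ (by positivity)]
    norm_num
  · rw [if_neg h, if_neg (by omega)]; simp

/-- The orthonormal basis of normalized functions `√(1 - x²) U_n(x)`. -/
def sinBasis : HilbertBasis ℕ ℂ LpT :=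
  HilbertBasis.mkOfOrthogonalEqBot orthonormal_sin (by
    refine eq_bot_iff.mpr ((Submodule.orthogonal_le ?_).trans span_sin_orthogonal.le)
    rw [Submodule.span_le]
    rintro _ ⟨n, rfl⟩
    have h := Submodule.smul_mem _ nrm⁻¹ (Submodule.subset_span
      (R := ℂ) (s := Set.range fun n : ℕ => nrm • emb (rtC * uC n)) ⟨n, rfl⟩)
    rwa [inv_smul_smul₀ nrm_ne_zero] at h)

/-- The finite Hilbert transform on `L²_d(I)`, as the isometry with
`√(1 - x²) U_n(x) ↦ T_{n+1}(x)`. -/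
def hilbT : LpT →L[ℂ] LpT :=
  (orthonormal_cos.orthogonalFamily.linearIsometry.comp
    sinBasis.repr.toLinearIsometry).toContinuousLinearMap

theorem hilbT_sin (n : ℕ) : hilbT (emb (rtC * uC n)) = emb (tC (n + 1)) := by
  have h1 : sinBasis n = nrm • emb (rtC * uC n) := by
    rw [sinBasis, HilbertBasis.coe_mkOfOrthogonalEqBot]
  have h2 : hilbT (nrm • emb (rtC * uC n)) = nrm • emb (tC (n + 1)) := by
    rw [← h1]
    change orthonormal_cos.orthogonalFamily.linearIsometry (sinBasis.repr (sinBasis n)) = _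
    rw [HilbertBasis.repr_self, OrthogonalFamily.linearIsometry_apply_single]
    simp
  rw [map_smul] at h2
  exact smul_right_injective _ nrm_ne_zero h2

/-! ### Calculus of principal values -/

/-- `L` is the principal value at `x` of the integral of `g` over `(-1, 1)`. -/
def HasPV (g : ℝ → ℂ) (x : ℝ) (L : ℂ) : Prop :=
  (∀ ε > 0, IntegrableOn g (cutInterval x ε)) ∧
    Tendsto (fun ε : ℝ => ∫ s in cutInterval x ε, g s) (𝓝[>] 0) (𝓝 L)

theorem HasPV.pvExists {g : ℝ → ℂ} {x : ℝ} {L : ℂ} (h : HasPV g x L) : PVExists g x :=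
  ⟨h.1, L, h.2⟩

theorem HasPV.pv_eq {g : ℝ → ℂ} {x : ℝ} {L : ℂ} (h : HasPV g x L) : pv g x = L :=
  h.2.limUnder_eq

theorem HasPV.add {f g : ℝ → ℂ} {x : ℝ} {L M : ℂ} (hf : HasPV f x L) (hg : HasPV g x M) :
    HasPV (fun s => f s + g s) x (L + M) := by
  refine ⟨fun ε hε => (hf.1 ε hε).add (hg.1 ε hε), (hf.2.add hg.2).congr' ?_⟩
  filter_upwards [self_mem_nhdsWithin] with ε hε
  exact (integral_add (hf.1 ε hε) (hg.1 ε hε)).symm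

theorem HasPV.const_mul {f : ℝ → ℂ} {x : ℝ} {L : ℂ} (hf : HasPV f x L) (c : ℂ) :
    HasPV (fun s => c * f s) x (c * L) := by
  refine ⟨fun ε hε => (hf.1 ε hε).const_mul c, (hf.2.const_mul c).congr fun ε => ?_⟩
  exact (integral_const_mul _ _).symm

theorem HasPV.congr_ae {f g : ℝ → ℂ} {x : ℝ} {L : ℂ} (hf : HasPV f x L)
    (h : f =ᵐ[volume.restrict (Ioo (-1 : ℝ) 1)] g) : HasPV g x L := by
  have h' : ∀ ε, f =ᵐ[volume.restrict (cutInterval x ε)] g := fun ε =>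
    ae_restrict_of_ae_restrict_of_subset (cutInterval_subset x ε) h
  exact ⟨fun ε hε => (hf.1 ε hε).congr (h' ε), hf.2.congr fun ε => integral_congr_ae (h' ε)⟩

theorem HasPV.congr {f g : ℝ → ℂ} {x : ℝ} {L : ℂ} (hf : HasPV f x L)
    (h : ∀ s ∈ Ioo (-1 : ℝ) 1, s ≠ x → f s = g s) : HasPV g x L := by
  refine hf.congr_ae ?_
  filter_upwards [ae_restrict_mem measurableSet_Ioo,
    ae_restrict_of_ae (Measure.ae_ne volume x)] with s hs hsx using h s hs hsx

theorem hasPV_of_integrableOn {g : ℝ → ℂ} (hg : IntegrableOn g (Ioo (-1 : ℝ) 1)) (x : ℝ) :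
    HasPV g x (∫ s in Ioo (-1 : ℝ) 1, g s) := by
  refine ⟨fun ε _ => hg.mono_set (cutInterval_subset x ε), ?_⟩
  have h1 : ∀ ε, ∫ s in cutInterval x ε, g s
      = ∫ s in Ioo (-1 : ℝ) 1, (cutInterval x ε).indicator g s := fun ε => by
    rw [setIntegral_indicator (measurableSet_cutInterval x ε),
      inter_eq_self_of_subset_right (cutInterval_subset x ε)]
  simp only [h1]
  refine tendsto_integral_filter_of_dominated_convergence (fun s => ‖g s‖) ?_ ?_ hg.norm ?_
  · exact Eventually.of_forall fun ε => hg.1.indicator (measurableSet_cutInterval x ε)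
  · exact Eventually.of_forall fun ε => ae_of_all _ fun s => norm_indicator_le_norm_self _ _
  · filter_upwards [ae_restrict_mem measurableSet_Ioo,
      ae_restrict_of_ae (Measure.ae_ne volume x)] with s hs hsx
    refine tendsto_const_nhds.congr' ?_
    have : 0 < |s - x| := abs_pos.mpr (sub_ne_zero.mpr hsx)
    filter_upwards [nhdsWithin_le_nhds (Iio_mem_nhds this)] with ε hε
    rw [indicator_of_mem]
    exact ⟨hs, hε⟩

theorem integrableOn_cut_div {f : ℝ → ℂ} (hf : IntegrableOn f (Ioo (-1 : ℝ) 1)) (x : ℝ) {ε : ℝ}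
    (hε : 0 < ε) : IntegrableOn (fun s => f s / ((x : ℂ) - s)) (cutInterval x ε) := by
  simp only [div_eq_mul_inv]
  refine Integrable.mul_bdd (c := ε⁻¹) (hf.mono_set (cutInterval_subset x ε))
    (by fun_prop : Measurable fun s : ℝ => ((x : ℂ) - s)⁻¹).aestronglyMeasurable ?_
  filter_upwards [ae_restrict_mem (measurableSet_cutInterval x ε)] with s hs
  rw [norm_inv, ← Complex.ofReal_sub, Complex.norm_real, Real.norm_eq_abs, abs_sub_comm]
  exact inv_anti₀ hε hs.2.le

/-! ### Principal values of functions in `L²_d` -/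

/-- Both sides are bounded functionals of `h`. On `√(1 - x²) U_n` both equal `π r^{n+1} T_{n+1}(y)`,
and density does the rest. -/
theorem integral_mul_conjKer (h : LpT) {r : ℝ} (hr0 : 0 ≤ r) (hr : r < 1) {y : ℝ}
    (hy : y ∈ Icc (-1 : ℝ) 1) :
    ∫ x in Ioo (-1 : ℝ) 1, h x * (conjKer r x y : ℝ)
      = ∫ x, hilbT h x * (poisKer r x y : ℝ) ∂measureT := by
  have hy' : |y| ≤ 1 := abs_le.mpr hy
  let kC : C(Icc (-1 : ℝ) 1, ℂ) := ⟨fun x => ((rt x * conjKer r x y : ℝ) : ℂ),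
    Complex.continuous_ofReal.comp ((continuous_rt.comp continuous_subtype_val).mul
      (continuousOn_iff_continuous_domRestrict.mp (continuousOn_conjKer hr0 hr hy')))⟩
  let pC : C(Icc (-1 : ℝ) 1, ℂ) := ⟨fun x => ((poisKer r x y : ℝ) : ℂ),
    Complex.continuous_ofReal.comp
      (continuousOn_iff_continuous_domRestrict.mp (continuousOn_poisKer hr0 hr hy'))⟩
  have hk : ∀ g : LpT, intT (mulOp kC g) = ∫ x in Ioo (-1 : ℝ) 1, g x * (conjKer r x y : ℝ) := by
    intro g
    rw [intT_apply, ← integral_rt_mul]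
    refine integral_congr_ae ?_
    filter_upwards [coeFn_mulOp kC g, ae_measureT_mem] with x h1 hx
    rw [h1, extC_of_mem _ (Ioo_subset_Icc_self hx)]
    simp only [kC, ContinuousMap.coe_mk]
    push_cast
    ring
  have hp : ∀ g : LpT, intT (mulOp pC g) = ∫ x, g x * (poisKer r x y : ℝ) ∂measureT := by
    intro g
    rw [intT_apply]
    refine integral_congr_ae ?_
    filter_upwards [coeFn_mulOp pC g, ae_measureT_mem] with x h1 hx
    rw [h1, extC_of_mem _ (Ioo_subset_Icc_self hx)]
    simp only [pC, ContinuousMap.coe_mk]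
    ring
  have key : intT.comp (mulOp kC) = intT.comp ((mulOp pC).comp hilbT) := by
    refine ext_of_sin fun n => ?_
    change intT (mulOp kC _) = intT (mulOp pC (hilbT _))
    rw [hilbT_sin, hk, hp, ← integral_rt_mul]
    have e1 : ∫ x, (rt x : ℂ) * ((emb (rtC * uC n)) x * (conjKer r x y : ℝ)) ∂measureT
        = ((∫ x, (rt x * (U ℝ n).eval x) * (rt x * conjKer r x y) ∂measureT : ℝ) : ℂ) := by
      rw [← integral_complex_ofReal]
      refine integral_congr_ae ?_
      filter_upwards [coeFn_emb (rtC * uC n), ae_measureT_mem] with x h1 hx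
      rw [h1, extC_rtC_mul_uC _ (Ioo_subset_Icc_self hx)]
      push_cast
      ring
    have e2 : ∫ x, (emb (tC (n + 1))) x * ((poisKer r x y : ℝ) : ℂ) ∂measureT
        = ((∫ x, (T ℝ (n + 1)).eval x * poisKer r x y ∂measureT : ℝ) : ℂ) := by
      rw [← integral_complex_ofReal]
      refine integral_congr_ae ?_
      filter_upwards [coeFn_emb (tC (n + 1)), ae_measureT_mem] with x h1 hx
      rw [h1, extC_tC _ (Ioo_subset_Icc_self hx)]
      push_cast
      ring
    have e3 := integral_eval_T_mul_poisKer (n + 1) hr0 hr hy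
    push_cast at e3
    rw [e1, e2, e3, integral_eval_U_mul_conjKer n hr0 hr hy]
  rw [← hk, ← hp]
  exact congrArg (fun A : LpT →L[ℂ] ℂ => A h) key

/-- Truncations of `f` differ by `o(1)` from its conjugate means; these are exactly the Abel–Poisson
means of `g`, which tend to `π g(y)`. The representatives `f` and `g` are kept free, so that
continuous ones can be used at a prescribed point. -/
theorem hasPV_of_isLebesguePt {f g : ℝ → ℂ} {h : LpT} (hf : f =ᵐ[measureT] h)
    (hg : g =ᵐ[measureT] hilbT h) {y : ℝ} (hy : y ∈ Ioo (-1 : ℝ) 1) (hLf : IsLebesguePt f y)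
    (hLg : IsLebesguePt g y) :
    HasPV (fun s => f s / ((y : ℂ) - s)) y (Real.pi * g y) := by
  have hy' := Ioo_subset_Icc_self hy
  have hfi : IntegrableOn f (Ioo (-1 : ℝ) 1) :=
    ((integrable_coe h).congr hf.symm).integrableOn_of_measureT
  have hgi : Integrable g measureT := (integrable_coe _).congr hg.symm
  refine ⟨fun ε hε => integrableOn_cut_div hfi y hε, ?_⟩
  have h1 := (tendsto_cut_sub_conjKer hfi hy hLf).add
    (tendsto_integral_mul_poisKer hgi hy hLg fun r h0 h1 => integral_poisKer h0 h1 hy')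
  rw [zero_add] at h1
  refine h1.congr' ?_
  filter_upwards [self_mem_nhdsWithin,
    nhdsWithin_le_nhds (Iio_mem_nhds (by norm_num : (0:ℝ) < 1 / 2))] with ε a b
  have a' : 0 < ε := a
  have b' : ε < 1 / 2 := b
  have e1 : ∫ x in Ioo (-1 : ℝ) 1, f x * (conjKer (1 - ε) x y : ℝ)
      = ∫ x, g x * (poisKer (1 - ε) x y : ℝ) ∂measureT := by
    have e2 : ∫ x, g x * (poisKer (1 - ε) x y : ℝ) ∂measureT
        = ∫ x, hilbT h x * (poisKer (1 - ε) x y : ℝ) ∂measureT := by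
      refine integral_congr_ae ?_
      filter_upwards [hg] with x hx
      rw [hx]
    rw [e2, ← integral_mul_conjKer h (by linarith) (by linarith) hy']
    refine integral_congr_ae ?_
    rw [EventuallyEq, ae_measureT] at hf
    filter_upwards [hf] with x hx
    rw [hx]
  rw [e1]
  ring

/-- Principal values of functions in `L²_d(I)` exist almost everywhere. -/
theorem ae_hasPV_hilbT {f : ℝ → ℂ} {h : LpT} (hf : f =ᵐ[measureT] h) :
    ∀ᵐ y : ℝ ∂(volume.restrict (Ioo (-1 : ℝ) 1)),
      HasPV (fun s => f s / ((y : ℂ) - s)) y (Real.pi * hilbT h y) := by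
  have hfi : IntegrableOn f (Ioo (-1 : ℝ) 1) :=
    ((integrable_coe h).congr hf.symm).integrableOn_of_measureT
  filter_upwards [ae_restrict_mem measurableSet_Ioo, ae_isLebesguePt hfi,
    ae_isLebesguePt (integrable_coe (hilbT h)).integrableOn_of_measureT] with y hy h1 h2
  exact hasPV_of_isLebesguePt hf EventuallyEq.rfl hy h1 h2

/-- Division of the density by `1 - s²`. -/
theorem HasPV.div_one_sub_sq {f : ℝ → ℂ} (hf : IntegrableOn f (Ioo (-1 : ℝ) 1)) {t : ℝ}
    (ht : t ∈ Ioo (-1 : ℝ) 1) {L : ℂ}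
    (h : HasPV (fun s => (rt s : ℂ) ^ 2 * f s / ((t : ℂ) - s)) t L) :
    HasPV (fun s => f s / ((t : ℂ) - s)) t
      (((rt t : ℂ) ^ 2)⁻¹ * (L - (t * ∫ s in Ioo (-1 : ℝ) 1, f s)
        - ∫ s in Ioo (-1 : ℝ) 1, (s : ℂ) * f s)) := by
  have hsf : IntegrableOn (fun s : ℝ => (s : ℂ) * f s) (Ioo (-1 : ℝ) 1) := by
    refine Integrable.bdd_mul (c := 1) hf (by fun_prop) ?_
    filter_upwards [ae_restrict_mem measurableSet_Ioo] with x hx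
    rw [Complex.norm_real]
    exact (abs_lt.mpr hx).le
  -- The underlying identity is `(1 - t²) / (t - s) = (1 - s²) / (t - s) - (t + s)`.
  have h1 := (h.add (((hasPV_of_integrableOn hf t).const_mul (-t)).add
    ((hasPV_of_integrableOn hsf t).const_mul (-1)))).const_mul (((rt t : ℂ) ^ 2)⁻¹)
  have hrt : ((rt t : ℂ) ^ 2) ≠ 0 :=
    pow_ne_zero 2 (Complex.ofReal_ne_zero.mpr (rt_pos ht).ne')
  have e := h1.congr (g := fun s => f s / ((t : ℂ) - s)) fun s hs hst => by
    have h2 : (t : ℂ) - s ≠ 0 := sub_ne_zero.mpr fun h => hst (Complex.ofReal_injective h).symm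
    have h3 : (rt t : ℂ) ^ 2 = 1 - (t : ℂ) ^ 2 := by
      rw [← Complex.ofReal_pow, rt_sq (Ioo_subset_Icc_self ht)]; push_cast; ring
    have h4 : (rt s : ℂ) ^ 2 = 1 - (s : ℂ) ^ 2 := by
      rw [← Complex.ofReal_pow, rt_sq (Ioo_subset_Icc_self hs)]; push_cast; ring
    rw [inv_mul_eq_iff_eq_mul₀ hrt, h3, h4]
    field_simp
    ring
  convert! e using 1
  ring

/-! ### Chebyshev identities on `[-1, 1]` -/

theorem poly_ext_Ioo {p q : Polynomial ℝ} (h : ∀ x ∈ Ioo (-1 : ℝ) 1, p.eval x = q.eval x) :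
    p = q :=
  Polynomial.eq_of_infinite_eval_eq p q ((Ioo_infinite (by norm_num : (-1 : ℝ) < 1)).mono h)

/-- Product-to-sum for `sin((m + 1)θ) sin((k + 1)θ)`. -/
theorem two_mul_U_mul_U (m k : ℤ) : (1 - Polynomial.X ^ 2) * (2 * U ℝ m * U ℝ k)
    = T ℝ (m - k) - T ℝ (m + k + 2) := by
  refine poly_ext_Ioo fun x hx => ?_
  have hx' := Ioo_subset_Icc_self hx
  have h1 := rt_mul_eval_U m hx'
  have h2 := rt_mul_eval_U k hx'
  have h3 := rt_sq hx'
  simp only [Polynomial.eval_mul, Polynomial.eval_sub, Polynomial.eval_one, Polynomial.eval_pow,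
    Polynomial.eval_X, Polynomial.eval_ofNat]
  rw [eval_T_eq_cos _ hx', eval_T_eq_cos _ hx', ← h3]
  set a := Real.arccos x
  have e1 : ((m - k : ℤ) : ℝ) * a = (m + 1) * a - (k + 1) * a := by push_cast; ring
  have e2 : ((m + k + 2 : ℤ) : ℝ) * a = (m + 1) * a + (k + 1) * a := by push_cast; ring
  rw [e1, e2, Real.cos_sub, Real.cos_add, ← h1, ← h2]
  ring

/-- The addition theorem for the sine of `(m + 1)θ + nθ`. -/
theorem U_mul_T_add (m n : ℤ) : U ℝ m * T ℝ n + T ℝ (m + 1) * U ℝ (n - 1) = U ℝ (m + n) := by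
  refine poly_ext_Ioo fun x hx => ?_
  have hx' := Ioo_subset_Icc_self hx
  have h1 := rt_mul_eval_U m hx'
  have h2 := rt_mul_eval_U (n - 1) hx'
  have h3 := rt_mul_eval_U (m + n) hx'
  simp only [Polynomial.eval_mul, Polynomial.eval_add]
  refine mul_left_cancel₀ (rt_pos hx).ne' ?_
  rw [eval_T_eq_cos _ hx', eval_T_eq_cos _ hx', h3]
  set a := Real.arccos x
  have e1 : (((m + n : ℤ) : ℝ) + 1) * a = (m + 1) * a + n * a := by push_cast; ring
  have e2 : (((n - 1 : ℤ) : ℝ) + 1) * a = n * a := by push_cast; ring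
  rw [e2] at h2
  rw [e1, Real.sin_add, ← h1, ← h2]
  push_cast
  ring

theorem rtC_sq : rtC ^ 2 = 1 - xC ^ 2 := by
  ext x
  have := rt_sq x.2
  simp only [rtC, xC, ContinuousMap.pow_apply, ContinuousMap.sub_apply, ContinuousMap.one_apply,
    ContinuousMap.coe_mk]
  rw [← Complex.ofReal_pow, this]
  push_cast
  ring

theorem tC_zero : tC 0 = 1 := by ext x; simp [tC]

theorem tC_one : tC 1 = xC := by ext x; simp [tC, xC]

theorem uC_zero : uC 0 = 1 := by ext x; simp [uC]

theorem uC_neg_one : uC (-1) = 0 := by ext x; simp [uC]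

theorem tC_neg (n : ℤ) : tC (-n) = tC n := by simp [tC]

theorem two_tC_mul_tC (m k : ℤ) : (2 : ℂ) • (tC m * tC k) = tC (m + k) + tC (m - k) := by
  ext x
  have := congrArg (Polynomial.eval (x : ℝ)) (Polynomial.Chebyshev.T_mul_T ℝ m k)
  simp only [Polynomial.eval_mul, Polynomial.eval_add, Polynomial.eval_ofNat] at this
  simp only [tC, ContinuousMap.smul_apply, ContinuousMap.mul_apply, ContinuousMap.add_apply,
    ContinuousMap.coe_mk, smul_eq_mul]
  rw [← mul_assoc]
  exact_mod_cast this

theorem two_tC (n : ℤ) : (2 : ℂ) • tC n = uC n - uC (n - 2) := by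
  ext x
  have := congrArg (Polynomial.eval (x : ℝ)) (Polynomial.Chebyshev.two_mul_T_eq_U_sub_U ℝ (n - 2))
  rw [sub_add_cancel] at this
  simp only [Polynomial.eval_mul, Polynomial.eval_sub, Polynomial.eval_ofNat] at this
  simp only [tC, uC, ContinuousMap.smul_apply, ContinuousMap.sub_apply,
    ContinuousMap.coe_mk, smul_eq_mul]
  exact_mod_cast this

theorem two_rtC_sq_mul_uC_mul_uC (m k : ℤ) :
    (2 : ℂ) • (rtC ^ 2 * (uC m * uC k)) = tC (m - k) - tC (m + k + 2) := by
  rw [rtC_sq]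
  ext x
  have := congrArg (Polynomial.eval (x : ℝ)) (two_mul_U_mul_U m k)
  simp only [Polynomial.eval_mul, Polynomial.eval_sub, Polynomial.eval_ofNat, Polynomial.eval_one,
    Polynomial.eval_pow, Polynomial.eval_X] at this
  simp only [tC, uC, xC, ContinuousMap.smul_apply, ContinuousMap.sub_apply, ContinuousMap.mul_apply,
    ContinuousMap.one_apply, ContinuousMap.pow_apply, ContinuousMap.coe_mk, smul_eq_mul]
  rw [mul_left_comm, ← mul_assoc 2]
  exact_mod_cast this

theorem uC_mul_tC_add (m n : ℤ) : uC m * tC n + tC (m + 1) * uC (n - 1) = uC (m + n) := by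
  ext x
  have := congrArg (Polynomial.eval (x : ℝ)) (U_mul_T_add m n)
  simp only [Polynomial.eval_mul, Polynomial.eval_add] at this
  simp only [tC, uC, ContinuousMap.add_apply, ContinuousMap.mul_apply, ContinuousMap.coe_mk]
  exact_mod_cast this

/-! ### The finite Hilbert transform on `L²_m` -/

/-- Integration followed by the embedding of constants. -/
def meanT : LpT →L[ℂ] LpT := intT.smulRight oneT

theorem meanT_apply (h : LpT) : meanT h = intT h • oneT := rfl

/-- The operator `h ↦ (1 - t²) H(h / √(1 - s²))`, where `H` is the finite Hilbert transform. -/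
def hilbS : LpT →L[ℂ] LpT :=
  hilbT * mulOp rtC - (1 / (Real.pi : ℂ)) • (mulOp xC * meanT + meanT * mulOp xC)

/-- At `n = -1` the rule `U_n ↦ T_{n+1}` fails, since `U_{-1} = 0` but `T_0 = 1`. Recording the
defect lets recurrences run through this index. -/
theorem hilbT_rtC_mul_uC (n : ℤ) (hn : -1 ≤ n) : hilbT (emb (rtC * uC n)) =
    emb (tC (n + 1)) - if n = -1 then oneT else 0 := by
  rcases eq_or_lt_of_le hn with h | h
  · rw [← h, uC_neg_one, if_pos rfl]
    have h0 : emb (rtC * 0) = 0 := by rw [mul_zero, emb, map_zero]; rfl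
    have h1 : emb (tC (-1 + 1)) = oneT := by
      rw [show (-1 + 1 : ℤ) = 0 by norm_num, tC_zero, emb, map_one]; rfl
    rw [h0, h1, map_zero, sub_self]
  · lift n to ℕ using by omega
    rw [hilbT_sin, if_neg (by omega), sub_zero]

theorem emb_one : emb 1 = oneT := by rw [emb, map_one]; rfl

theorem emb_two_smul {c d : C(Icc (-1 : ℝ) 1, ℂ)} (h : (2 : ℂ) • c = d) :
    emb c = (1 / 2 : ℂ) • emb d := by
  rw [← h, emb_smul, smul_smul]; norm_num

/-- In terms of `H` this is the classical rule `T_n / √(1 - s²) ↦ -U_{n-1}`. Expanding `2 T_n = U_n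
- U_{n-2}` gives it directly for large `n`; for `n = 0, 1` the rank-one terms of `hilbS` supply the
corrections. -/
theorem hilbS_tC_nat (n : ℕ) : hilbS (emb (tC n)) = -emb (rtC ^ 2 * uC (n - 1)) := by
  have hpi : (Real.pi : ℂ) ≠ 0 := Complex.ofReal_ne_zero.mpr Real.pi_ne_zero
  have e1 : emb (rtC ^ 2 * uC (n - 1)) = (1 / 2 : ℂ) • (emb (tC (n - 1)) - emb (tC (n + 1))) := by
    have := two_rtC_sq_mul_uC_mul_uC (n - 1) 0
    rw [uC_zero, mul_one] at this
    rw [emb_two_smul this, emb_sub]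
    congr 4 <;> ring
  have e2 : emb (rtC * tC n) = (1 / 2 : ℂ) • (emb (rtC * uC n) - emb (rtC * uC (n - 2))) := by
    rw [← emb_sub, ← mul_sub, ← two_tC, mul_smul_comm, emb_smul, smul_smul]
    norm_num
  have e3 : emb (xC * tC n) = (1 / 2 : ℂ) • (emb (tC (n + 1)) + emb (tC (n - 1))) := by
    have := two_tC_mul_tC n 1
    rw [tC_one, mul_comm] at this
    rw [emb_two_smul this, emb_add]
  have e4 : hilbS (emb (tC n)) = hilbT (emb (rtC * tC n))
      - (1 / (Real.pi : ℂ)) • (intT (emb (tC n)) • emb xC + intT (emb (xC * tC n)) • oneT) := by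
    change hilbT (mulOp rtC (emb (tC n))) - (1 / (Real.pi : ℂ)) • (mulOp xC (meanT (emb (tC n)))
      + meanT (mulOp xC (emb (tC n)))) = _
    rw [mulOp_emb, mulOp_emb, meanT_apply, meanT_apply, map_smul]
    rfl
  rw [e4, e1, e2, e3, map_smul, map_sub, hilbT_rtC_mul_uC _ (by omega), map_smul, map_add,
    intT_emb_tC, intT_emb_tC, intT_emb_tC]
  rcases n with _ | _ | n
  · have e5 : emb (rtC * uC (((0 : ℕ) : ℤ) - 2)) = -emb (rtC * uC 0) := by
      rw [← emb_neg]
      congr 1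
      ext x
      simp [uC]
    rw [e5, map_neg, hilbT_rtC_mul_uC _ (by omega)]
    have e6 : tC (((0 : ℕ) : ℤ) - 1) = xC := by
      rw [show (((0 : ℕ) : ℤ) - 1) = -1 by norm_num, tC_neg, tC_one]
    rw [e6]
    simp [tC_one]
    rw [← Complex.coe_smul Real.pi, smul_smul, inv_mul_cancel₀ hpi]
    module
  · rw [hilbT_rtC_mul_uC _ (by norm_num)]
    simp [tC_zero, emb_one]
    rw [smul_smul]
    have : (Real.pi : ℂ)⁻¹ * (2⁻¹ * Real.pi) = 2⁻¹ := by field_simp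
    rw [this]
    module
  · rw [hilbT_rtC_mul_uC _ (by push_cast; omega), if_neg (by omega), if_neg (by omega),
      if_neg (by omega), if_neg (by omega), if_neg (by omega)]
    rw [show ((n + 1 + 1 : ℕ) : ℤ) - 2 + 1 = ((n + 1 + 1 : ℕ) : ℤ) - 1 by ring]
    simp
    module

theorem hilbS_tC (k : ℤ) : hilbS (emb (tC k)) = -emb (rtC ^ 2 * uC (|k| - 1)) := by
  have h := hilbS_tC_nat k.natAbs
  rw [Int.natCast_natAbs] at h
  rw [← h]
  rcases abs_choice k with h1 | h1 <;> rw [h1]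
  rw [tC_neg]

/-- Commutation of the finite Hilbert transform with multiplication by the variable. -/
theorem xC_mul_hilbS_sub : mulOp xC * hilbS - hilbS * mulOp xC
    = (1 / (Real.pi : ℂ)) • (mulOp (rtC ^ 2) * meanT) := by
  refine ext_of_cos fun n => ?_
  have hpi : (Real.pi : ℂ) ≠ 0 := Complex.ofReal_ne_zero.mpr Real.pi_ne_zero
  change mulOp xC (hilbS (emb (tC n))) - hilbS (mulOp xC (emb (tC n)))
    = (1 / (Real.pi : ℂ)) • (mulOp (rtC ^ 2) (meanT (emb (tC n))))
  have e3 : emb (xC * tC n) = (1 / 2 : ℂ) • (emb (tC (n + 1)) + emb (tC (n - 1))) := by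
    have := two_tC_mul_tC n 1
    rw [tC_one, mul_comm] at this
    rw [emb_two_smul this, emb_add]
  rw [mulOp_emb, e3, map_smul, map_add, hilbS_tC, hilbS_tC, hilbS_tC, map_neg, mulOp_emb,
    meanT_apply, map_smul, intT_emb_tC]
  rcases n with _ | n
  · simp [uC_neg_one, uC_zero]
    rw [← emb_one, mulOp_emb, mul_one, emb, map_zero]
    simp
    rw [← Complex.coe_smul Real.pi, smul_smul, inv_mul_cancel₀ hpi, mulOp_emb, ← pow_two]
    module
  · have e4 : (2 : ℂ) • (xC * uC n) = uC (n + 1) + uC (n - 1) := by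
      ext x
      have := congrArg (Polynomial.eval (x : ℝ)) (Polynomial.Chebyshev.U_add_one ℝ n)
      simp only [Polynomial.eval_mul, Polynomial.eval_sub, Polynomial.eval_ofNat,
        Polynomial.eval_X] at this
      simp only [xC, uC, ContinuousMap.smul_apply, ContinuousMap.add_apply,
        ContinuousMap.mul_apply, ContinuousMap.coe_mk, smul_eq_mul]
      rw [this]; push_cast; ring
    have e5 : emb (xC * (rtC ^ 2 * uC n)) = (1 / 2 : ℂ) •
        (emb (rtC ^ 2 * uC (n + 1)) + emb (rtC ^ 2 * uC (n - 1))) := by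
      rw [← emb_add, ← mul_add, ← e4, mul_smul_comm, emb_smul, smul_smul, mul_left_comm]
      norm_num
    rw [if_neg (by omega), abs_of_nonneg (by omega), abs_of_nonneg (by omega),
      abs_of_nonneg (by omega)]
    push_cast
    rw [show (n : ℤ) + 1 - 1 = n by ring, show (n : ℤ) + 1 + 1 - 1 = n + 1 by ring, e5]
    simp
    module

/-! ### Product identities for the finite Hilbert transform -/

/-- The product identity of Tricomi for the density `√(1 - x²) v` with finite Hilbert transform
`X`. -/
def Tricomi (v X : C(Icc (-1 : ℝ) 1, ℂ)) : Prop :=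
  hilbS * mulOp v * hilbS = -mulOp (rtC ^ 2 * v) + mulOp X * hilbS - hilbS * mulOp X

theorem Tricomi.add {v w X Y : C(Icc (-1 : ℝ) 1, ℂ)} (h : Tricomi v X) (h' : Tricomi w Y) :
    Tricomi (v + w) (X + Y) := by
  unfold Tricomi at *
  simp only [map_add, mul_add, add_mul]
  rw [h, h']
  abel

theorem Tricomi.smul {v X : C(Icc (-1 : ℝ) 1, ℂ)} (h : Tricomi v X) (a : ℂ) :
    Tricomi (a • v) (a • X) := by
  unfold Tricomi at *
  simp only [map_smul, mul_smul_comm, smul_mul_assoc]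
  rw [h]
  module

/-- Tested on `T_n`, both sides contain `-½ S T_{m+1-n}`, so that index of unknown sign drops out.
What remains is `S T_{m+1+n} = -r² U_{m+n}`, which is the addition formula `uC_mul_tC_add`. -/
theorem tricomi_uC (m : ℕ) : Tricomi (uC m) (tC (m + 1)) := by
  refine ext_of_cos fun n => ?_
  change hilbS (mulOp (uC m) (hilbS (emb (tC n)))) = -(mulOp (rtC ^ 2 * uC m) (emb (tC n)))
    + mulOp (tC (m + 1)) (hilbS (emb (tC n))) - hilbS (mulOp (tC (m + 1)) (emb (tC n)))
  have h1 := two_rtC_sq_mul_uC_mul_uC m (n - 1)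
  have h2 := two_tC_mul_tC (m + 1) n
  rw [mul_left_comm] at h1
  rw [hilbS_tC_nat, map_neg, map_neg, map_neg, mulOp_emb, mulOp_emb, mulOp_emb, mulOp_emb,
    emb_two_smul h1, emb_two_smul h2, map_smul, map_smul, emb_sub, emb_add, map_sub, map_add,
    show (m : ℤ) - (n - 1) = m + 1 - n by ring, show (m : ℤ) + (n - 1) + 2 = m + 1 + n by ring]
  have h3 : emb (rtC ^ 2 * uC m * tC n) = emb (rtC ^ 2 * uC (m + n))
      - emb (tC (m + 1) * (rtC ^ 2 * uC (n - 1))) := by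
    rw [← uC_mul_tC_add, ← emb_sub]
    congr 1; ring
  have h4 : hilbS (emb (tC (m + 1 + n))) = -emb (rtC ^ 2 * uC (m + n)) := by
    rw [hilbS_tC, abs_of_nonneg (by omega)]
    congr 4; ring
  rw [h3, h4]
  module

/-- Constants commute with the transform. This serves the initial term of the series, where `U_{-1}
= 0` is paired with `T_0 = 1`. -/
theorem tricomi_zero_one : Tricomi 0 1 := by
  unfold Tricomi
  simp

/-- Both sides are linear in `(v, X)` and continuous in operator norm. -/
theorem tricomi_of_hasSum {v X : ℕ → C(Icc (-1 : ℝ) 1, ℂ)} {V Y : C(Icc (-1 : ℝ) 1, ℂ)}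
    (h : ∀ k, Tricomi (v k) (X k)) (hv : HasSum v V) (hX : HasSum X Y) : Tricomi V Y := by
  have h1 := ((hv.mapL mulOpL).mul_left hilbS).mul_right hilbS
  have h2 := (((hv.mul_left (rtC ^ 2)).mapL mulOpL).neg.add
    ((hX.mapL mulOpL).mul_right hilbS)).sub ((hX.mapL mulOpL).mul_left hilbS)
  refine h1.unique ?_
  convert! h2 using 1
  ext1 k
  exact h k

/-- Antisymmetry of the finite Hilbert transform between `√(1 - x²) Y` and `v`. -/
def Antisymm (v Y : C(Icc (-1 : ℝ) 1, ℂ)) : Prop :=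
  intT.comp (mulOp v * hilbT) = -intT.comp (mulOp Y)

/-- The adjoint of the isometry sends `T_k` back to `√(1 - x²) U_{k-1}`, and `T_0` to zero. On the
sine system both sides are nonzero only for `k = n + 1`. -/
theorem antisymm_tC (k : ℕ) : Antisymm (tC k) (-(rtC * uC (k - 1))) := by
  refine ext_of_sin fun n => ?_
  change intT (mulOp (tC k) (hilbT _)) = -intT (mulOp (-(rtC * uC (k - 1))) _)
  rw [hilbT_sin, mulOp_emb, mulOp_emb,
    show -(rtC * uC (k - 1)) * (rtC * uC n) = -(rtC * uC (k - 1) * (rtC * uC n)) by ring,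
    emb_neg, map_neg, neg_neg]
  have h1 := two_tC_mul_tC k (n + 1)
  have h2 := two_rtC_sq_mul_uC_mul_uC (k - 1) n
  rw [show rtC * uC (k - 1) * (rtC * uC n) = rtC ^ 2 * (uC (k - 1) * uC n) by ring,
    emb_two_smul h1, emb_two_smul h2, map_smul, map_smul, emb_add, emb_sub, map_add, map_sub,
    intT_emb_tC, intT_emb_tC, intT_emb_tC, intT_emb_tC, if_neg (by omega),
    if_neg (show ¬ (k : ℤ) - 1 + n + 2 = 0 by omega), zero_add, sub_zero]
  congr 2
  simp only [eq_iff_iff]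
  omega

theorem antisymm_of_hasSum {v X : ℕ → C(Icc (-1 : ℝ) 1, ℂ)} {V Y : C(Icc (-1 : ℝ) 1, ℂ)}
    (h : ∀ k, Antisymm (v k) (X k)) (hv : HasSum v V) (hX : HasSum X Y) : Antisymm V Y := by
  have h1 := ((hv.mapL mulOpL).mul_right hilbT).mapL
    (ContinuousLinearMap.compL ℂ LpT LpT ℂ intT)
  have h2 := ((hX.mapL mulOpL).mapL (ContinuousLinearMap.compL ℂ LpT LpT ℂ intT)).neg
  refine h1.unique ?_
  convert! h2 using 1
  ext1 k
  exact h k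

theorem Antisymm.smul {v Y : C(Icc (-1 : ℝ) 1, ℂ)} (h : Antisymm v Y) (a : ℂ) :
    Antisymm (a • v) (a • Y) := by
  unfold Antisymm at *
  rw [map_smul, map_smul, smul_mul_assoc, ContinuousLinearMap.comp_smul,
    ContinuousLinearMap.comp_smul, h, smul_neg]

open Complex (I)

/-! ### Exponential multipliers -/

/-- The function `exp(ν(x + a√(1 - x²)))` on `[-1, 1]`. -/
def zexpC (ν a : ℂ) : C(Icc (-1 : ℝ) 1, ℂ) :=
  ⟨fun x => Complex.exp (ν * ((x : ℝ) + a * rt x)), by have := continuous_rt; fun_prop⟩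

/-- The function `exp(νx)` on `[-1, 1]`. -/
def expC (ν : ℂ) : C(Icc (-1 : ℝ) 1, ℂ) := ⟨fun x => Complex.exp (ν * (x : ℝ)), by fun_prop⟩

/-- The function `cosh(iμ√(1 - x²))` on `[-1, 1]`. -/
def coshC (μ : ℂ) : C(Icc (-1 : ℝ) 1, ℂ) :=
  ⟨fun x => coshR μ x, by have := continuous_rt; unfold coshR; fun_prop⟩

/-- The function `sinh(iμ√(1 - x²))` on `[-1, 1]`. -/
def sinhC (μ : ℂ) : C(Icc (-1 : ℝ) 1, ℂ) :=
  ⟨fun x => sinhR μ x, by have := continuous_rt; unfold sinhR; fun_prop⟩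

theorem hasSum_zexpC (ν a : ℂ) :
    HasSum (fun k : ℕ => (ν ^ k / (k.factorial : ℂ)) • (xC + a • rtC) ^ k) (zexpC ν a) := by
  have h := NormedSpace.exp_series_hasSum_exp' (𝕂 := ℂ) (ν • (xC + a • rtC))
  have e : NormedSpace.exp (ν • (xC + a • rtC)) = zexpC ν a := by
    ext x
    have h1 := h.map (ContinuousMap.evalCLM ℂ x) (ContinuousMap.evalCLM ℂ x).continuous
    have h2 := NormedSpace.exp_series_hasSum_exp' (𝕂 := ℂ) (ν * ((x : ℝ) + a * rt x))
    rw [← Complex.exp_eq_exp_ℂ] at h2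
    exact h1.unique h2
  rw [e] at h
  convert! h using 1
  ext1 k
  rw [smul_pow, smul_smul]
  congr 1
  ring

/-- De Moivre's formula, with `x = cos θ` and `√(1 - x²) = sin θ`. -/
theorem xC_add_I_rtC_pow (k : ℕ) :
    tC k + I • (rtC * uC (k - 1)) = (xC + I • rtC) ^ k ∧
    tC k - I • (rtC * uC (k - 1)) = (xC + (-I) • rtC) ^ k := by
  have key : ∀ x : Icc (-1 : ℝ) 1, tC k x = Complex.cos (k * Real.arccos x) ∧
      (rtC * uC (k - 1)) x = Complex.sin (k * Real.arccos x) ∧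
      xC x = Complex.cos (Real.arccos x) ∧ rtC x = Complex.sin (Real.arccos x) := by
    intro x
    refine ⟨?_, ?_, ?_, ?_⟩
    · change (((T ℝ k).eval (x : ℝ) : ℝ) : ℂ) = _
      rw [eval_T_eq_cos _ x.2]; push_cast; rfl
    · have := rt_mul_eval_U ((k : ℤ) - 1) x.2
      change ((rt x : ℝ) : ℂ) * (((U ℝ ((k : ℤ) - 1)).eval (x : ℝ) : ℝ) : ℂ) = _
      rw [← Complex.ofReal_mul, this]
      push_cast; ring_nf
    · change ((x : ℝ) : ℂ) = _
      rw [← Complex.ofReal_cos, Real.cos_arccos x.2.1 x.2.2]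
    · change ((rt x : ℝ) : ℂ) = _
      rw [← Complex.ofReal_sin, Real.sin_arccos]; rfl
  constructor
  · ext x
    obtain ⟨h1, h2, h3, h4⟩ := key x
    simp only [ContinuousMap.add_apply, ContinuousMap.smul_apply, ContinuousMap.pow_apply,
      smul_eq_mul, h1, h2, h3, h4]
    rw [mul_comm I, mul_comm I, ← Complex.exp_mul_I, ← Complex.exp_mul_I, ← Complex.exp_nat_mul]
    ring_nf
  · ext x
    obtain ⟨h1, h2, h3, h4⟩ := key x
    simp only [ContinuousMap.add_apply, ContinuousMap.sub_apply, ContinuousMap.smul_apply,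
      ContinuousMap.pow_apply, smul_eq_mul, h1, h2, h3, h4]
    have e1 := Complex.exp_mul_I (-(k * Real.arccos x))
    have e2 := Complex.exp_mul_I (-(Real.arccos x))
    rw [Complex.cos_neg, Complex.sin_neg] at e1 e2
    rw [show Complex.cos (Real.arccos x) + -I * Complex.sin (Real.arccos x)
        = Complex.cos (Real.arccos x) + -Complex.sin (Real.arccos x) * I by ring, ← e2,
      show Complex.cos (k * Real.arccos x) - I * Complex.sin (k * Real.arccos x)
        = Complex.cos (k * Real.arccos x) + -Complex.sin (k * Real.arccos x) * I by ring, ← e1,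
      ← Complex.exp_nat_mul]
    ring_nf

theorem zexpC_add (ν : ℂ) : zexpC ν I + zexpC ν (-I) = (2 : ℂ) • (expC ν * coshC ν) := by
  ext x
  simp only [zexpC, expC, coshC, coshR, ContinuousMap.add_apply, ContinuousMap.smul_apply,
    ContinuousMap.mul_apply, ContinuousMap.coe_mk, smul_eq_mul, mul_add, Complex.exp_add,
    Complex.cosh]
  rw [show ν * (I * rt x) = I * ν * rt x by ring, show ν * (-I * rt x) = -(I * ν * rt x) by ring]
  ring

theorem zexpC_sub (ν : ℂ) : zexpC ν I - zexpC ν (-I) = (2 : ℂ) • (expC ν * sinhC ν) := by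
  ext x
  simp only [zexpC, expC, sinhC, sinhR, ContinuousMap.sub_apply, ContinuousMap.smul_apply,
    ContinuousMap.mul_apply, ContinuousMap.coe_mk, smul_eq_mul, mul_add, Complex.exp_add,
    Complex.sinh]
  rw [show ν * (I * rt x) = I * ν * rt x by ring, show ν * (-I * rt x) = -(I * ν * rt x) by ring]
  ring

/-- Half the sum of the exponential series of `e^{iθ}` and `e^{-iθ}`; half the difference gives
`hasSum_rtC_mul_uC`. -/
theorem hasSum_tC (ν : ℂ) :
    HasSum (fun k : ℕ => (ν ^ k / (k.factorial : ℂ)) • tC k) (expC ν * coshC ν) := by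
  have h := ((hasSum_zexpC ν I).add (hasSum_zexpC ν (-I))).const_smul (1 / 2 : ℂ)
  rw [zexpC_add, smul_smul] at h
  norm_num at h
  convert! h using 1
  ext1 k
  rw [← (xC_add_I_rtC_pow k).1, ← (xC_add_I_rtC_pow k).2]
  module

theorem hasSum_rtC_mul_uC (ν : ℂ) :
    HasSum (fun k : ℕ => (ν ^ k / (k.factorial : ℂ)) • (rtC * uC (k - 1)))
      ((-I) • (expC ν * sinhC ν)) := by
  have h := ((hasSum_zexpC ν I).sub (hasSum_zexpC ν (-I))).const_smul (-I / 2 : ℂ)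
  rw [zexpC_sub, smul_smul, div_mul_cancel₀ _ two_ne_zero] at h
  convert! h using 1
  ext1 k
  rw [← (xC_add_I_rtC_pow k).1, ← (xC_add_I_rtC_pow k).2]
  match_scalars
  · linear_combination (ν ^ k / (k.factorial : ℂ)) * Complex.I_sq
  · ring

/-- The recursion `U_k = x U_{k-1} + T_k` gains at most `1` per step. A bound up to the endpoints is
needed because the series of `U_{k-1}` cannot be obtained there by dividing by `√(1 - x²)`. -/
theorem norm_uC_le (k : ℕ) : ‖uC (k - 1)‖ ≤ k := by
  rw [ContinuousMap.norm_le _ (by positivity)]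
  intro x
  change ‖(((U ℝ ((k : ℤ) - 1)).eval (x : ℝ) : ℝ) : ℂ)‖ ≤ k
  rw [Complex.norm_real, Real.norm_eq_abs]
  induction k with
  | zero => simp
  | succ k ih =>
    have h1 := Polynomial.Chebyshev.U_eq_X_mul_U_add_T ℝ ((k : ℤ) - 1)
    rw [sub_add_cancel] at h1
    push_cast
    rw [add_sub_cancel_right, h1, Polynomial.eval_add, Polynomial.eval_mul, Polynomial.eval_X]
    calc _ ≤ |(x : ℝ) * (U ℝ ((k : ℤ) - 1)).eval (x : ℝ)| + |(T ℝ k).eval (x : ℝ)| :=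
          abs_add_le _ _
      _ ≤ 1 * k + 1 := by
          rw [abs_mul]
          gcongr
          · exact abs_le.mpr x.2
          · exact abs_eval_T_le_one _ x.2
      _ = _ := by ring

theorem summable_uC (ν : ℂ) :
    Summable fun k : ℕ => (ν ^ k / (k.factorial : ℂ)) • uC (k - 1) := by
  refine Summable.of_norm_bounded (Real.summable_pow_div_factorial (2 * ‖ν‖)) fun k => ?_
  rw [norm_smul, norm_div, norm_pow, Complex.norm_natCast]
  have h1 : ‖uC (k - 1)‖ ≤ 2 ^ k := (norm_uC_le k).trans (by exact_mod_cast k.lt_two_pow_self.le)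
  calc _ ≤ ‖ν‖ ^ k / k.factorial * 2 ^ k := by gcongr
    _ = _ := by rw [mul_pow]; ring

/-- The series `∑ νᵏ U_{k-1} / k!`. -/
def uSeries (ν : ℂ) : C(Icc (-1 : ℝ) 1, ℂ) := ∑' k : ℕ, (ν ^ k / (k.factorial : ℂ)) • uC (k - 1)

theorem rtC_mul_uSeries (ν : ℂ) : rtC * uSeries ν = (-I) • (expC ν * sinhC ν) := by
  have h := (summable_uC ν).hasSum.mul_left rtC
  refine h.unique ?_
  convert! hasSum_rtC_mul_uC ν using 1
  ext1 k
  rw [mul_smul_comm]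

theorem tricomi_uSeries (ν : ℂ) : Tricomi (uSeries ν) (expC ν * coshC ν) := by
  refine tricomi_of_hasSum (fun k => Tricomi.smul ?_ _) (summable_uC ν).hasSum (hasSum_tC ν)
  rcases k with _ | k
  · have := tricomi_zero_one
    simpa [uC_neg_one, tC_zero] using this
  · have := tricomi_uC k
    push_cast
    rwa [add_sub_cancel_right]

/-- The pair of `v` and the finite Hilbert transform `X` of `√(1 - x²) v`, with the product
identity. -/
def IsConj (v X : C(Icc (-1 : ℝ) 1, ℂ)) : Prop := Tricomi v X ∧ hilbT (emb (rtC * v)) = emb X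

theorem IsConj.add {v w X Y : C(Icc (-1 : ℝ) 1, ℂ)} (h : IsConj v X) (h' : IsConj w Y) :
    IsConj (v + w) (X + Y) :=
  ⟨h.1.add h'.1, by rw [mul_add, emb_add, emb_add, map_add, h.2, h'.2]⟩

theorem IsConj.smul {v X : C(Icc (-1 : ℝ) 1, ℂ)} (h : IsConj v X) (a : ℂ) :
    IsConj (a • v) (a • X) :=
  ⟨h.1.smul a, by rw [mul_smul_comm, emb_smul, emb_smul, map_smul, h.2]⟩

theorem isConj_uC (m : ℕ) : IsConj (uC m) (tC (m + 1)) := ⟨tricomi_uC m, hilbT_sin m⟩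

theorem isConj_of_hasSum {v X : ℕ → C(Icc (-1 : ℝ) 1, ℂ)} {V Y : C(Icc (-1 : ℝ) 1, ℂ)}
    (h : ∀ k, IsConj (v k) (X k)) (hv : HasSum v V) (hX : HasSum X Y) : IsConj V Y := by
  refine ⟨tricomi_of_hasSum (fun k => (h k).1) hv hX, ?_⟩
  let ev : C(Icc (-1 : ℝ) 1, ℂ) →L[ℂ] LpT := mulOpL.flip oneT
  have h1 := ((hv.mul_left rtC).mapL ev).mapL hilbT
  have h2 := hX.mapL ev
  refine h1.unique ?_
  convert! h2 using 1
  ext1 k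
  exact (h k).2

/-- From `2 T_k = U_k - U_{k-2}` the transform is `(T_{k+1} - T_{k-1}) / 2 = -r² U_{k-1}` for `k ≥
2`. At `k = 0` and `k = 1` the true values are `T_1` and `T_2 / 2`, which the added terms account
for. -/
theorem isConj_tC (k : ℕ) : IsConj (tC k) (-(rtC * (rtC * uC (k - 1)))
    + (if k = 0 then xC else 0) + (if k = 1 then (1 / 2 : ℂ) • 1 else 0)) := by
  have key : ∀ n : ℤ, rtC * (rtC * uC (n - 1)) = (1 / 2 : ℂ) • (tC (n - 1) - tC (n + 1)) := by
    intro n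
    have := two_rtC_sq_mul_uC_mul_uC (n - 1) 0
    rw [uC_zero, mul_one, show n - 1 - 0 = n - 1 by ring,
      show n - 1 + 0 + 2 = n + 1 by ring] at this
    rw [← this, smul_smul, ← mul_assoc, ← pow_two]
    norm_num
  rw [key]
  rcases k with _ | _ | k
  · have h := isConj_uC 0
    convert! h using 1
    · simp [tC_zero, uC_zero]
    · have : tC (-1) = tC 1 := tC_neg 1
      simp [tC_one, this]
  · have h := (isConj_uC 1).smul (1 / 2)
    have e := two_tC 1
    rw [show (1 : ℤ) - 2 = -1 by norm_num, uC_neg_one, sub_zero] at e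
    convert! h using 1
    · simp [← e, smul_smul]
    · simp [tC_zero]
      module
  · have h := ((isConj_uC (k + 2)).smul (1 / 2)).add ((isConj_uC k).smul (-1 / 2))
    have e := two_tC (k + 2)
    convert! h using 1
    · rw [add_sub_cancel_right] at e
      push_cast
      rw [show (k : ℤ) + 1 + 1 = k + 2 by ring,
        show uC (k + 2) = (2 : ℂ) • tC (k + 2) + uC k by rw [e]; abel]
      module
    · push_cast
      rw [show (k : ℤ) + 1 + 1 - 1 = k + 1 by ring, show (k : ℤ) + 1 + 1 + 1 = k + 2 + 1 by ring]
      simp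
      module

/-- In the sum over `k`, the exceptional terms of `isConj_tC` at `k = 0, 1` leave `x` and `ν / 2`.
The former later produces the moment term. -/
theorem isConj_exp_cosh (ν : ℂ) : IsConj (expC ν * coshC ν)
    (I • (rtC * (expC ν * sinhC ν)) + xC + (ν / 2) • 1) := by
  refine isConj_of_hasSum (fun k => (isConj_tC k).smul _) (hasSum_tC ν) ?_
  have h1 := ((hasSum_rtC_mul_uC ν).mul_left rtC).neg
  have h2 := (hasSum_ite_eq 0 xC).add (hasSum_ite_eq 1 ((ν / 2) • (1 : C(Icc (-1 : ℝ) 1, ℂ))))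
  have h3 := h1.add h2
  convert! h3 using 1
  · ext1 k
    rw [mul_smul_comm]
    rcases k with _ | _ | k
    · simp
    · simp
      module
    · simp
  · rw [mul_smul_comm]
    module

theorem antisymm_exp_cosh (ν : ℂ) :
    Antisymm (expC ν * coshC ν) (I • (expC ν * sinhC ν)) := by
  refine antisymm_of_hasSum (fun k => (antisymm_tC k).smul _) (hasSum_tC ν) ?_
  convert! (hasSum_rtC_mul_uC ν).neg using 1
  · ext1 k
    rw [smul_neg]
  · module

/-- By orthogonality only the coefficient of `T_0`, respectively of `T_1`, contributes. -/
theorem intT_exp_cosh (ν : ℂ) : intT (emb (expC ν * coshC ν)) = Real.pi ∧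
    intT (emb (xC * (expC ν * coshC ν))) = Real.pi * (ν / 2) := by
  let ev : C(Icc (-1 : ℝ) 1, ℂ) →L[ℂ] ℂ := intT.comp (mulOpL.flip oneT)
  have hev : ∀ c, ev c = intT (emb c) := fun c => rfl
  constructor
  · have h1 := (hasSum_tC ν).mapL ev
    have h2 := hasSum_ite_eq (0 : ℕ) (Real.pi : ℂ)
    rw [hev] at h1
    refine h1.unique ?_
    convert! h2 using 1
    ext1 k
    rw [hev, emb_smul, map_smul, intT_emb_tC]
    rcases k with _ | k
    · simp
    · simp
      omega
  · have h1 := ((hasSum_tC ν).mul_left xC).mapL ev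
    have h2 := hasSum_ite_eq (1 : ℕ) (Real.pi * (ν / 2))
    rw [hev] at h1
    refine h1.unique ?_
    convert! h2 using 1
    ext1 k
    have e := two_tC_mul_tC k 1
    rw [tC_one, mul_comm] at e
    rw [hev, mul_smul_comm, emb_smul, map_smul, emb_two_smul e, emb_add, map_smul, map_add,
      intT_emb_tC, intT_emb_tC, if_neg (by omega), zero_add]
    rcases k with _ | _ | k
    · simp
    · simp; ring
    · rw [if_neg (by push_cast; omega), if_neg (by omega)]; simp

/-! ### The weighted transforms as operators -/

theorem expC_mul_expC_neg (μ : ℂ) : expC μ * expC (-μ) = 1 := by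
  ext x
  simp [expC, ← Complex.exp_add]

theorem coshC_neg (μ : ℂ) : coshC (-μ) = coshC μ := by
  ext x
  simp [coshC, coshR]

theorem sinhC_neg (μ : ℂ) : sinhC (-μ) = -sinhC μ := by
  ext x
  simp [sinhC, sinhR]

theorem rtC_mul_cancel {c d : C(Icc (-1 : ℝ) 1, ℂ)} (h : rtC * c = rtC * d) :
    mulOp c = mulOp d := by
  ext1 k
  refine Lp.ext ?_
  filter_upwards [coeFn_mulOp c k, coeFn_mulOp d k, ae_measureT_mem] with x h1 h2 h3
  rw [h1, h2]
  have hx := Ioo_subset_Icc_self h3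
  have h4 := congrArg (fun g : C(Icc (-1 : ℝ) 1, ℂ) => g ⟨x, hx⟩) h
  have h5 : (rt x : ℂ) ≠ 0 := Complex.ofReal_ne_zero.mpr (rt_pos h3).ne'
  rw [extC_of_mem c hx, extC_of_mem d hx, mul_left_cancel₀ h5 h4]

/-- The operator `h ↦ (1 - s²) H_μ (h / √(1 - t²))`. -/
def coshS (μ : ℂ) : LpT →L[ℂ] LpT :=
  (1 / 2 : ℂ) • (mulOp (expC μ) * hilbS * mulOp (expC (-μ))
    + mulOp (expC (-μ)) * hilbS * mulOp (expC μ))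

/-- The analogue of `coshS` with the kernel `sinh[μ(s - t)] / (s - t)`. -/
def sinhS (μ : ℂ) : LpT →L[ℂ] LpT :=
  (1 / 2 : ℂ) • (mulOp (expC μ) * hilbS * mulOp (expC (-μ))
    - mulOp (expC (-μ)) * hilbS * mulOp (expC μ))

/-- The function `sinh(iμ√(1 - x²)) / √(1 - x²)`. -/
def sincC (μ : ℂ) : C(Icc (-1 : ℝ) 1, ℂ) := I • (expC (-μ) * uSeries μ)

theorem rtC_mul_sincC (μ : ℂ) : rtC * sincC μ = sinhC μ := by
  rw [sincC, mul_smul_comm, mul_left_comm, rtC_mul_uSeries, mul_smul_comm, smul_smul, ← mul_assoc,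
    mul_comm (expC (-μ)), expC_mul_expC_neg, one_mul]
  simp

/-- Apply the product identity to `e^{νx} cosh(iνr)` for `ν = ±μ`, multiply on the right by
`e^{-νx}` and average. As `sinh(iνr)` is odd in `ν`, the terms `S r sinh(iνr)` cancel, while those
with `S` on the right combine into `sinhS`. -/
theorem hilbS_mul_coshC_mul_coshS (μ : ℂ) :
    hilbS * mulOp (coshC μ) * coshS μ = -mulOp (rtC ^ 2 * coshC μ)
      + I • (mulOp (rtC * sinhC μ) * sinhS μ)
      + (1 / (2 * Real.pi : ℂ)) •
        (mulOp (rtC ^ 2) * meanT * (mulOp (expC μ) + mulOp (expC (-μ)))) := by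
  have key : ∀ ν : ℂ, hilbS * mulOp (coshC ν) * (mulOp (expC ν) * hilbS * mulOp (expC (-ν)))
      = -mulOp (rtC ^ 2 * coshC ν)
        + I • (mulOp (rtC * sinhC ν) * (mulOp (expC ν) * hilbS * mulOp (expC (-ν))))
        - I • (hilbS * mulOp (rtC * sinhC ν))
        + (1 / (Real.pi : ℂ)) • (mulOp (rtC ^ 2) * meanT * mulOp (expC (-ν))) := by
    intro ν
    have h := congrArg (· * mulOp (expC (-ν))) (isConj_exp_cosh ν).1
    have e1 : mulOp (rtC ^ 2 * (expC ν * coshC ν)) * mulOp (expC (-ν))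
        = mulOp (rtC ^ 2 * coshC ν) := by
      rw [← map_mul, ← mul_one (rtC ^ 2 * coshC ν), ← expC_mul_expC_neg ν]
      congr 1; ring
    have e2 : mulOp (I • (rtC * (expC ν * sinhC ν)) + xC + (ν / 2) • 1)
        = I • (mulOp (rtC * sinhC ν) * mulOp (expC ν)) + mulOp xC + (ν / 2) • 1 := by
      rw [map_add, map_add, map_smul, map_smul, map_one, ← map_mul]
      congr 4; ring
    have e3 : mulOp (expC ν) * mulOp (expC (-ν)) = 1 := by
      rw [← map_mul, expC_mul_expC_neg, map_one]
    have e4 : hilbS * mulOp (expC ν * coshC ν) * hilbS * mulOp (expC (-ν))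
        = hilbS * mulOp (coshC ν) * (mulOp (expC ν) * hilbS * mulOp (expC (-ν))) := by
      rw [mul_comm (expC ν), map_mul]
      simp only [mul_assoc]
    rw [← e4]
    refine h.trans ?_
    -- The constant `ν / 2` commutes with `S`; the summand `x` does not, and its rank-one commutator
    -- is the moment term.
    rw [sub_mul, add_mul, neg_mul, e1, e2, ← smul_mul_assoc (1 / (Real.pi : ℂ)), ← xC_mul_hilbS_sub]
    simp only [add_mul, mul_add, sub_mul, smul_mul_assoc, mul_smul_comm, mul_assoc, e3, mul_one,
      one_mul]
    abel
  have h1 := key μ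
  have h2 := key (-μ)
  rw [coshC_neg, sinhC_neg, neg_neg, show rtC * -sinhC μ = -(rtC * sinhC μ) by ring, map_neg] at h2
  have h3 : (1 / (2 * Real.pi : ℂ)) = (1 / 2) * (1 / (Real.pi : ℂ)) := by
    field_simp
  rw [coshS, sinhS, mul_smul_comm, mul_add, h1, h2, h3]
  simp only [mul_add, mul_sub, mul_smul_comm, neg_mul, mul_neg]
  module

/-- The same averaging, for the pair `uSeries ν`, `e^{νx} cosh(iνr)`. The second member contains no
bare `x`, so no moment appears. -/
theorem hilbS_mul_sincC_mul_coshS (μ : ℂ) :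
    hilbS * mulOp (sincC μ) * coshS μ = -mulOp (rtC ^ 2 * sincC μ)
      + I • (mulOp (coshC μ) * sinhS μ) := by
  have key : ∀ ν a : ℂ, mulOp (sincC μ * expC ν) = mulOp (a • uSeries ν) →
      hilbS * mulOp (sincC μ) * (mulOp (expC ν) * hilbS * mulOp (expC (-ν)))
      = -mulOp (rtC ^ 2 * sincC μ)
        + a • (mulOp (coshC ν) * (mulOp (expC ν) * hilbS * mulOp (expC (-ν))))
        - a • (hilbS * mulOp (coshC ν)) := by
    intro ν a ha
    have h := congrArg (· * mulOp (expC (-ν))) ((tricomi_uSeries ν).smul a)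
    have e3 : mulOp (expC ν) * mulOp (expC (-ν)) = 1 := by
      rw [← map_mul, expC_mul_expC_neg, map_one]
    have e1 : mulOp (rtC ^ 2 * (a • uSeries ν)) * mulOp (expC (-ν))
        = mulOp (rtC ^ 2 * sincC μ) := by
      rw [map_mul, ← ha, map_mul, map_mul, mul_assoc, mul_assoc, e3, mul_one]
    have e2 : mulOp (a • (expC ν * coshC ν)) = a • (mulOp (coshC ν) * mulOp (expC ν)) := by
      rw [map_smul, mul_comm, map_mul]
    have e4 : hilbS * mulOp (a • uSeries ν) * hilbS * mulOp (expC (-ν))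
        = hilbS * mulOp (sincC μ) * (mulOp (expC ν) * hilbS * mulOp (expC (-ν))) := by
      rw [← ha, map_mul]
      simp only [mul_assoc]
    rw [← e4]
    refine h.trans ?_
    rw [sub_mul, add_mul, neg_mul, e1, e2]
    simp only [smul_mul_assoc, mul_smul_comm, mul_assoc, e3, mul_one]
  have h1 := key μ I (by
    congr 1
    rw [sincC, smul_mul_assoc, mul_right_comm, mul_comm (expC (-μ)), expC_mul_expC_neg, one_mul])
  -- For `-μ` the two multipliers are compared after multiplication by `√(1 - x²)`, which vanishes
  -- only at the endpoints.
  have h2 := key (-μ) (-I) (by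
    refine rtC_mul_cancel ?_
    rw [← mul_assoc, rtC_mul_sincC, mul_smul_comm, rtC_mul_uSeries, smul_smul, sinhC_neg]
    ext x
    simp [mul_comm])
  rw [coshC_neg, neg_neg] at h2
  rw [coshS, sinhS, mul_smul_comm, mul_add, h1, h2]
  simp only [mul_sub, mul_smul_comm]
  module

/-! ### Polynomial factors in principal values -/

theorem ofReal_rt_ne_zero {x : ℝ} (hx : x ∈ Ioo (-1 : ℝ) 1) : (rt x : ℂ) ≠ 0 :=
  Complex.ofReal_ne_zero.mpr (rt_pos hx).ne'

theorem ofReal_rt_sq {x : ℝ} (hx : x ∈ Icc (-1 : ℝ) 1) : (rt x : ℂ) ^ 2 = 1 - (x : ℂ) ^ 2 := by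
  rw [← Complex.ofReal_pow, rt_sq hx]; push_cast; ring

theorem extC_expC (ν : ℂ) {x : ℝ} (hx : x ∈ Ioo (-1 : ℝ) 1) :
    extC (expC ν) x = Complex.exp (ν * x) := extC_of_mem _ (Ioo_subset_Icc_self hx)

theorem integrableOn_ofReal_mul {f : ℝ → ℂ} (hf : IntegrableOn f (Ioo (-1 : ℝ) 1)) :
    IntegrableOn (fun s : ℝ => (s : ℂ) * f s) (Ioo (-1 : ℝ) 1) := by
  refine Integrable.bdd_mul (c := 1) hf (by fun_prop) ?_
  filter_upwards [ae_restrict_mem measurableSet_Ioo] with x hx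
  rw [Complex.norm_real]
  exact (abs_lt.mpr hx).le

/-- Multiplication of the density by a quadratic polynomial. -/
theorem HasPV.quad_mul {f : ℝ → ℂ} (hf : IntegrableOn f (Ioo (-1 : ℝ) 1)) {t : ℝ} {L : ℂ}
    (h : HasPV (fun s => f s / ((t : ℂ) - s)) t L) (α β γ : ℂ) :
    HasPV (fun s => quad α β γ s * f s / ((t : ℂ) - s)) t
      (quad α β γ t * L - (α * t + β) * (∫ s in Ioo (-1 : ℝ) 1, f s)
        - α * ∫ s in Ioo (-1 : ℝ) 1, (s : ℂ) * f s) := by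
  -- This uses `q(s) = q(t) - (t - s)(α(t + s) + β)`.
  have h1 := (h.const_mul (quad α β γ t)).add
    (((hasPV_of_integrableOn hf t).const_mul (-(α * t + β))).add
    ((hasPV_of_integrableOn (integrableOn_ofReal_mul hf) t).const_mul (-α)))
  have e := h1.congr (g := fun s => quad α β γ s * f s / ((t : ℂ) - s)) fun s hs hst => by
    have h2 : (t : ℂ) - s ≠ 0 := sub_ne_zero.mpr fun h => hst (Complex.ofReal_injective h).symm
    unfold quad
    field_simp
    ring
  convert! e using 1
  ring

/-! ### The principal value identity -/

/-- With the factor `√(1 - s²)` in place of its inverse, density and transform are continuous, so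
the principal value exists at every `t`. On dividing by `1 - s²`, the integrals `π` and `πν / 2`
exactly remove the terms `t` and `ν / 2` of the transform. -/
theorem hasPV_exp_mul_coshR_div (ν : ℂ) {t : ℝ} (ht : t ∈ Ioo (-1 : ℝ) 1) :
    IntegrableOn (fun s : ℝ => Complex.exp (ν * s) * coshR ν s / rt s) (Ioo (-1 : ℝ) 1) ∧
    ∫ s in Ioo (-1 : ℝ) 1, Complex.exp (ν * s) * coshR ν s / rt s = Real.pi ∧
    ∫ s in Ioo (-1 : ℝ) 1, (s : ℂ) * (Complex.exp (ν * s) * coshR ν s / rt s)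
      = Real.pi * (ν / 2) ∧
    HasPV (fun s : ℝ => Complex.exp (ν * s) * coshR ν s / rt s / ((t : ℂ) - s)) t
      (Real.pi * (I * Complex.exp (ν * t) * sinhR ν t / rt t)) := by
  set c := expC ν * coshC ν with hc
  set g : ℝ → ℂ := fun s : ℝ => Complex.exp (ν * s) * coshR ν s / rt s with hg
  have hcx : ∀ x ∈ Icc (-1 : ℝ) 1, extC c x = Complex.exp (ν * x) * coshR ν x := fun x hx =>
    extC_of_mem _ hx
  have hrg : (fun x => (rt x : ℂ) * g x) =ᵐ[measureT] emb c := by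
    filter_upwards [coeFn_emb c, ae_measureT_mem] with x h1 hx
    have := ofReal_rt_ne_zero hx
    rw [h1, hcx x (Ioo_subset_Icc_self hx), hg]
    field_simp
  have hint : IntegrableOn g (Ioo (-1 : ℝ) 1) :=
    integrable_rt_mul_iff.mp ((integrable_coe _).congr hrg.symm)
  have h1 : ∫ s in Ioo (-1 : ℝ) 1, g s = Real.pi := by
    rw [← integral_rt_mul, integral_congr_ae hrg, ← intT_apply, (intT_exp_cosh ν).1]
  have h2 : ∫ s in Ioo (-1 : ℝ) 1, (s : ℂ) * g s = Real.pi * (ν / 2) := by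
    rw [← integral_rt_mul, ← (intT_exp_cosh ν).2, intT_apply]
    refine integral_congr_ae ?_
    rw [← hc, ← mulOp_emb]
    filter_upwards [hrg, coeFn_mulOp xC (emb c), ae_measureT_mem] with x e1 e2 hx
    rw [e2, ← e1, extC_of_mem xC (Ioo_subset_Icc_self hx)]
    simp only [xC, ContinuousMap.coe_mk]
    ring
  refine ⟨hint, h1, h2, ?_⟩
  have h3 := hasPV_of_isLebesguePt (f := extC (rtC * c))
    (g := extC (I • (rtC * (expC ν * sinhC ν)) + xC + (ν / 2) • 1)) (h := emb (rtC * c))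
    (coeFn_emb _).symm (by rw [(isConj_exp_cosh ν).2]; exact (coeFn_emb _).symm) ht
    (isLebesguePt_of_continuousAt (continuous_extC _).continuousAt)
    (isLebesguePt_of_continuousAt (continuous_extC _).continuousAt)
  have h4 := HasPV.div_one_sub_sq hint ht (h3.congr fun s hs _ => by
    have h5 : extC (rtC * c) s = rt s * (Complex.exp (ν * s) * coshR ν s) :=
      extC_of_mem _ (Ioo_subset_Icc_self hs)
    have := ofReal_rt_ne_zero hs
    rw [h5, hg, pow_two]
    congr 1
    field_simp)
  have h6 : extC (I • (rtC * (expC ν * sinhC ν)) + xC + (ν / 2) • 1) t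
      = I * (rt t * (Complex.exp (ν * t) * sinhR ν t)) + t + ν / 2 * 1 :=
    extC_of_mem _ (Ioo_subset_Icc_self ht)
  have := ofReal_rt_ne_zero ht
  convert! h4 using 1
  rw [h6, h1, h2]
  field_simp
  ring

theorem hasPV_exp_mul_quad (ν α β γ : ℂ) {t : ℝ} (ht : t ∈ Ioo (-1 : ℝ) 1) :
    HasPV (fun s : ℝ => quad α β γ s * (Complex.exp (ν * s) * coshR ν s / rt s) / ((t : ℂ) - s)) t
      (Real.pi * (quad α β γ t * (I * Complex.exp (ν * t) * sinhR ν t / rt t)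
        - (α * t + β) - α * (ν / 2))) := by
  obtain ⟨h0, h1, h2, h3⟩ := hasPV_exp_mul_coshR_div ν ht
  convert! HasPV.quad_mul h0 h3 α β γ using 1
  rw [h1, h2]
  ring

/-- Split `cosh[μ(u - s)]` into exponentials in `s` and use that `cosh(iμr)` is even and `sinh(iμr)`
odd in `μ`. -/
theorem hasPV_cosh_mul_quad (μ α β γ : ℂ) {t : ℝ} (ht : t ∈ Ioo (-1 : ℝ) 1) (u : ℝ) :
    HasPV (fun s : ℝ => Complex.cosh (μ * (u - s)) / (t - s) * (quad α β γ s / rt s) * coshR μ s) t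
      (Real.pi * (I * Complex.sinh (μ * (t - u)) * sinhR μ t * (quad α β γ t / rt t)
          - (α * t + β) * Complex.cosh (μ * u) + α * μ / 2 * Complex.sinh (μ * u))) := by
  have hc : ∀ s, coshR (-μ) s = coshR μ s := fun s => by simp [coshR]
  have hs : ∀ s, sinhR (-μ) s = -sinhR μ s := fun s => by simp [sinhR]
  have h1 := ((hasPV_exp_mul_quad (-μ) α β γ ht).const_mul (Complex.exp (μ * u) / 2)).add
    ((hasPV_exp_mul_quad μ α β γ ht).const_mul (Complex.exp (-(μ * u)) / 2))
  convert! h1 using 1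
  · ext1 s
    rw [hc, Complex.cosh, show μ * ((u : ℂ) - s) = μ * u + -μ * s by ring,
      show -(μ * (u : ℂ) + -μ * s) = -(μ * u) + μ * s by ring, Complex.exp_add, Complex.exp_add]
    ring
  · rw [hs, Complex.sinh, Complex.sinh, Complex.cosh,
      show μ * ((t : ℂ) - u) = -(μ * u) + μ * t by ring,
      show -(-(μ * (u : ℂ)) + μ * t) = μ * u + -μ * t by ring, Complex.exp_add, Complex.exp_add]
    ring

/-! ### The transforms as principal values -/

theorem integrableOn_of_rt_mul {f : ℝ → ℂ} {h : LpT}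
    (hf : (fun x => (rt x : ℂ) * f x) =ᵐ[measureT] h) : IntegrableOn f (Ioo (-1 : ℝ) 1) :=
  integrable_rt_mul_iff.mp ((integrable_coe _).congr hf.symm)

theorem rt_mul_extC_mul {f : ℝ → ℂ} {h : LpT} (hf : (fun x => (rt x : ℂ) * f x) =ᵐ[measureT] h)
    (c : C(Icc (-1 : ℝ) 1, ℂ)) :
    (fun x => (rt x : ℂ) * (extC c x * f x)) =ᵐ[measureT] mulOp c h := by
  filter_upwards [hf, coeFn_mulOp c h] with x h1 h2
  rw [h2, ← h1]
  ring

theorem coeFn_hilbS (h : LpT) : hilbS h =ᵐ[measureT] fun x =>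
    hilbT (mulOp rtC h) x - (1 / (Real.pi : ℂ)) * (x * intT h + intT (mulOp xC h)) := by
  have e : hilbS h = hilbT (mulOp rtC h) - (1 / (Real.pi : ℂ)) • (intT h • emb xC
      + intT (mulOp xC h) • emb 1) := by
    rw [emb_one]
    change hilbT (mulOp rtC h) - (1 / (Real.pi : ℂ)) • (mulOp xC (meanT h) + meanT (mulOp xC h)) = _
    rw [meanT_apply, meanT_apply, map_smul]
    rfl
  rw [e]
  filter_upwards [Lp.coeFn_sub (hilbT (mulOp rtC h)) ((1 / (Real.pi : ℂ)) • (intT h • emb xC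
      + intT (mulOp xC h) • emb 1)), Lp.coeFn_smul (1 / (Real.pi : ℂ)) (intT h • emb xC
      + intT (mulOp xC h) • emb 1), Lp.coeFn_add (intT h • emb xC) (intT (mulOp xC h) • emb 1),
    Lp.coeFn_smul (intT h) (emb xC), Lp.coeFn_smul (intT (mulOp xC h)) (emb 1), coeFn_emb xC,
    coeFn_emb 1, ae_measureT_mem] with x h1 h2 h3 h4 h5 h6 h7 hx
  rw [h1, Pi.sub_apply, h2, Pi.smul_apply, h3, Pi.add_apply, h4, h5, Pi.smul_apply, Pi.smul_apply,
    h6, h7, extC_of_mem _ (Ioo_subset_Icc_self hx), extC_of_mem _ (Ioo_subset_Icc_self hx)]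
  simp only [xC, ContinuousMap.coe_mk, ContinuousMap.one_apply, smul_eq_mul]
  ring

/-- Although `f` need not lie in `L²_d(I)`, `(1 - s²) f = √(1 - s²) h` does. The rank-one terms of
`hilbS` are the corrections for dividing by `1 - s²`. -/
theorem ae_hasPV_hilbS {f : ℝ → ℂ} {h : LpT} (hf : (fun x => (rt x : ℂ) * f x) =ᵐ[measureT] h) :
    ∀ᵐ y : ℝ ∂(volume.restrict (Ioo (-1 : ℝ) 1)),
      HasPV (fun s => f s / ((y : ℂ) - s)) y (Real.pi * (hilbS h y / (rt y : ℂ) ^ 2)) := by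
  have hpi : (Real.pi : ℂ) ≠ 0 := Complex.ofReal_ne_zero.mpr Real.pi_ne_zero
  have hint := integrableOn_of_rt_mul hf
  have h1 : (fun x => (rt x : ℂ) ^ 2 * f x) =ᵐ[measureT] mulOp rtC h := by
    filter_upwards [hf, coeFn_mulOp rtC h, ae_measureT_mem] with x e1 e2 hx
    rw [e2, ← e1, extC_of_mem _ (Ioo_subset_Icc_self hx)]
    simp only [rtC, ContinuousMap.coe_mk]
    ring
  have e1 : ∫ s in Ioo (-1 : ℝ) 1, f s = intT h := by
    rw [← integral_rt_mul, integral_congr_ae hf, ← intT_apply]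
  have e2 : ∫ s in Ioo (-1 : ℝ) 1, (s : ℂ) * f s = intT (mulOp xC h) := by
    rw [← integral_rt_mul, intT_apply]
    refine integral_congr_ae ?_
    filter_upwards [rt_mul_extC_mul hf xC, ae_measureT_mem] with x h1 hx
    rw [← h1, extC_of_mem _ (Ioo_subset_Icc_self hx)]
    rfl
  have h2 := coeFn_hilbS h
  rw [EventuallyEq, ae_measureT] at h2
  filter_upwards [ae_hasPV_hilbT h1, h2, ae_restrict_mem measurableSet_Ioo] with y h3 h4 hy
  convert! HasPV.div_one_sub_sq hint hy h3 using 1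
  rw [h4, e1, e2]
  have := ofReal_rt_ne_zero hy
  field_simp
  ring

theorem coshIntegrand_eq (μ : ℂ) (f : ℝ → ℂ) {s t : ℝ} (ht : t ∈ Ioo (-1 : ℝ) 1) :
    coshIntegrand μ f s t = 1 / 2 * (Complex.exp (μ * s)
        * (extC (expC (-μ)) t * f t / ((s : ℂ) - t)))
      + 1 / 2 * (Complex.exp (-μ * s) * (extC (expC μ) t * f t / ((s : ℂ) - t))) := by
  rw [coshIntegrand, extC_expC _ ht, extC_expC _ ht, Complex.cosh,
    show μ * ((s : ℂ) - t) = μ * s + -μ * t by ring,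
    show -(μ * (s : ℂ) + -μ * t) = -μ * s + μ * t by ring, Complex.exp_add, Complex.exp_add]
  ring

/-- Combination of the conjugates of a bounded operator by the two exponentials. -/
theorem coeFn_exp_conj (A : LpT →L[ℂ] LpT) (μ : ℂ) (h : LpT) :
    ((1 / 2 : ℂ) • (mulOp (expC μ) * A * mulOp (expC (-μ))
      + mulOp (expC (-μ)) * A * mulOp (expC μ)) : LpT →L[ℂ] LpT) h =ᵐ[measureT] fun x =>
      1 / 2 * (Complex.exp (μ * x) * A (mulOp (expC (-μ)) h) x)
        + 1 / 2 * (Complex.exp (-μ * x) * A (mulOp (expC μ) h) x) := by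
  change ((1 / 2 : ℂ) • (mulOp (expC μ) (A (mulOp (expC (-μ)) h))
      + mulOp (expC (-μ)) (A (mulOp (expC μ) h))) : LpT) =ᵐ[measureT] _
  set a := A (mulOp (expC (-μ)) h)
  set b := A (mulOp (expC μ) h)
  filter_upwards [Lp.coeFn_smul (1 / 2 : ℂ) (mulOp (expC μ) a + mulOp (expC (-μ)) b),
    Lp.coeFn_add (mulOp (expC μ) a) (mulOp (expC (-μ)) b), coeFn_mulOp (expC μ) a,
    coeFn_mulOp (expC (-μ)) b, ae_measureT_mem] with x h1 h2 h3 h4 hx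
  rw [h1, Pi.smul_apply, h2, Pi.add_apply, h3, h4, extC_expC _ hx, extC_expC _ hx, smul_eq_mul]
  ring

theorem ae_hasPV_coshIntegrand (μ : ℂ) {f : ℝ → ℂ} {h : LpT}
    (hf : (fun x => (rt x : ℂ) * f x) =ᵐ[measureT] h) :
    ∀ᵐ s : ℝ ∂(volume.restrict (Ioo (-1 : ℝ) 1)),
      HasPV (coshIntegrand μ f s) s (Real.pi * (coshS μ h s / (rt s : ℂ) ^ 2)) := by
  have h0 := coeFn_exp_conj hilbS μ h
  rw [EventuallyEq, ae_measureT] at h0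
  filter_upwards [ae_hasPV_hilbS (rt_mul_extC_mul hf (expC (-μ))),
    ae_hasPV_hilbS (rt_mul_extC_mul hf (expC μ)), h0] with s h1 h2 h3
  have h4 := (((h1.const_mul (Complex.exp (μ * s))).const_mul (1 / 2)).add
    ((h2.const_mul (Complex.exp (-μ * s))).const_mul (1 / 2))).congr
    (g := coshIntegrand μ f s) fun t ht _ => (coshIntegrand_eq μ f ht).symm
  convert! h4 using 1
  rw [coshS, h3]
  ring

theorem coshFHT_ae (μ : ℂ) {f : ℝ → ℂ} {h : LpT}
    (hf : (fun x => (rt x : ℂ) * f x) =ᵐ[measureT] h) :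
    coshFHT μ f =ᵐ[measureT] fun s => coshS μ h s / (rt s : ℂ) ^ 2 := by
  have hpi : (Real.pi : ℂ) ≠ 0 := Complex.ofReal_ne_zero.mpr Real.pi_ne_zero
  rw [EventuallyEq, ae_measureT]
  filter_upwards [ae_hasPV_coshIntegrand μ hf] with s h1
  rw [coshFHT, h1.pv_eq]
  field_simp

/-- The condition on `w` makes `√(1 - s²) F_μ w` equal to `c · coshS h`, again in `LpT`, so `hilbS`
applies a second time. The sign comes from the kernel `1 / (s - t)`. -/
theorem ae_hasPV_invIntegrand (μ : ℂ) {f w : ℝ → ℂ} {h : LpT}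
    (hf : (fun x => (rt x : ℂ) * f x) =ᵐ[measureT] h) {c : C(Icc (-1 : ℝ) 1, ℂ)}
    (hw : ∀ x ∈ Ioo (-1 : ℝ) 1, (rt x : ℂ) * w x = (rt x : ℂ) ^ 2 * extC c x) :
    ∀ᵐ t : ℝ ∂(volume.restrict (Ioo (-1 : ℝ) 1)),
      HasPV (invIntegrand μ f w t) t
        (-(Real.pi * ((hilbS * mulOp c * coshS μ) h t / (rt t : ℂ) ^ 2))) := by
  have h1 : (fun x => (rt x : ℂ) * (coshFHT μ f x * w x)) =ᵐ[measureT] mulOp c (coshS μ h) := by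
    filter_upwards [coshFHT_ae μ hf, coeFn_mulOp c (coshS μ h), ae_measureT_mem] with x e1 e2 hx
    have := ofReal_rt_ne_zero hx
    rw [e2, e1, mul_left_comm, hw x hx]
    field_simp
  filter_upwards [ae_hasPV_hilbS h1] with t h2
  convert! (h2.const_mul (-1)).congr (g := invIntegrand μ f w t) fun s _ hst => ?_ using 1
  · rw [neg_one_mul]
    rfl
  · have h2 : (t : ℂ) - s ≠ 0 := sub_ne_zero.mpr fun h => hst (Complex.ofReal_injective h).symm
    have h3 : (s : ℂ) - t ≠ 0 := by rwa [← neg_ne_zero, neg_sub]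
    rw [invIntegrand]
    field_simp
    ring

/-! ### The moment -/

theorem integrableOn_cosh_mul (μ : ℂ) {f : ℝ → ℂ} (hf : IntegrableOn f (Ioo (-1 : ℝ) 1)) :
    IntegrableOn (fun t : ℝ => Complex.cosh (μ * t) * f t) (Ioo (-1 : ℝ) 1) := by
  obtain ⟨C, hC⟩ := isCompact_Icc.exists_bound_of_continuousOn (s := Icc (-1 : ℝ) 1)
    (f := fun t : ℝ => Complex.cosh (μ * t)) (by fun_prop)
  refine Integrable.bdd_mul (c := C) hf (by fun_prop) ?_
  filter_upwards [ae_restrict_mem measurableSet_Ioo] with x hx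
  exact hC x (Ioo_subset_Icc_self hx)

theorem moment_eq (μ : ℂ) {f : ℝ → ℂ} {h : LpT}
    (hf : (fun x => (rt x : ℂ) * f x) =ᵐ[measureT] h) :
    moment μ f = 1 / 2 * (intT (mulOp (expC μ) h) + intT (mulOp (expC (-μ)) h)) := by
  rw [moment, ← integral_rt_mul, intT_apply, intT_apply,
    ← integral_add (integrable_coe _) (integrable_coe _), ← integral_const_mul]
  refine integral_congr_ae ?_
  filter_upwards [hf, coeFn_mulOp (expC μ) h, coeFn_mulOp (expC (-μ)) h, ae_measureT_mem]
    with x h1 h2 h3 hx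
  rw [h2, h3, ← h1, extC_expC _ hx, extC_expC _ hx, Complex.cosh, neg_mul]
  ring

/-! ### The inversion formula on `L²_m` -/

theorem coeFn_hilbS_coshC (μ : ℂ) {f : ℝ → ℂ} {h : LpT}
    (hf : (fun x => (rt x : ℂ) * f x) =ᵐ[measureT] h) :
    (hilbS * mulOp (coshC μ) * coshS μ) h =ᵐ[measureT] fun x =>
      (rt x : ℂ) ^ 2 * (-(coshR μ x * h x) + 1 / (Real.pi : ℂ) * moment μ f)
        + I * (rt x * sinhR μ x * sinhS μ h x) := by
  have hpi : (Real.pi : ℂ) ≠ 0 := Complex.ofReal_ne_zero.mpr Real.pi_ne_zero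
  have e : (hilbS * mulOp (coshC μ) * coshS μ) h = -mulOp (rtC ^ 2 * coshC μ) h
      + I • mulOp (rtC * sinhC μ) (sinhS μ h)
      + (1 / (Real.pi : ℂ) * moment μ f) • emb (rtC ^ 2) := by
    rw [hilbS_mul_coshC_mul_coshS]
    change -mulOp (rtC ^ 2 * coshC μ) h + I • mulOp (rtC * sinhC μ) (sinhS μ h)
      + (1 / (2 * Real.pi : ℂ)) • (mulOp (rtC ^ 2) (meanT (mulOp (expC μ) h
        + mulOp (expC (-μ)) h))) = _
    rw [meanT_apply, map_smul, smul_smul, map_add, moment_eq μ hf]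
    congr 2
    field_simp
  rw [e]
  set a := mulOp (rtC ^ 2 * coshC μ) h with ha
  set b := mulOp (rtC * sinhC μ) (sinhS μ h) with hb
  set k := 1 / (Real.pi : ℂ) * moment μ f
  filter_upwards [Lp.coeFn_add (-a + I • b) (k • emb (rtC ^ 2)), Lp.coeFn_add (-a) (I • b),
    Lp.coeFn_neg a, Lp.coeFn_smul I b, Lp.coeFn_smul k (emb (rtC ^ 2)), coeFn_emb (rtC ^ 2),
    coeFn_mulOp (rtC ^ 2 * coshC μ) h, coeFn_mulOp (rtC * sinhC μ) (sinhS μ h), ae_measureT_mem]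
    with x h1 h2 h3 h4 h5 h6 h7 h8 hx
  have hx' := Ioo_subset_Icc_self hx
  rw [h1, Pi.add_apply, h2, Pi.add_apply, h3, Pi.neg_apply, h4, Pi.smul_apply, h5, Pi.smul_apply,
    h6, h7, h8, extC_of_mem _ hx', extC_of_mem _ hx', extC_of_mem _ hx']
  simp only [rtC, coshC, sinhC, ContinuousMap.coe_mk, ContinuousMap.mul_apply,
    ContinuousMap.pow_apply, smul_eq_mul]
  ring

theorem coeFn_hilbS_sincC (μ : ℂ) (h : LpT) :
    (hilbS * mulOp (sincC μ) * coshS μ) h =ᵐ[measureT] fun x =>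
      -(rt x * sinhR μ x * h x) + I * (coshR μ x * sinhS μ h x) := by
  have e : (hilbS * mulOp (sincC μ) * coshS μ) h = -mulOp (rtC * sinhC μ) h
      + I • mulOp (coshC μ) (sinhS μ h) := by
    rw [hilbS_mul_sincC_mul_coshS, pow_two, mul_assoc, rtC_mul_sincC]
    rfl
  rw [e]
  set a := mulOp (rtC * sinhC μ) h with ha
  set b := mulOp (coshC μ) (sinhS μ h) with hb
  filter_upwards [Lp.coeFn_add (-a) (I • b), Lp.coeFn_neg a, Lp.coeFn_smul I b,
    coeFn_mulOp (rtC * sinhC μ) h, coeFn_mulOp (coshC μ) (sinhS μ h), ae_measureT_mem]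
    with x h2 h3 h4 h7 h8 hx
  have hx' := Ioo_subset_Icc_self hx
  rw [h2, Pi.add_apply, h3, Pi.neg_apply, h4, Pi.smul_apply, h7, h8, extC_of_mem _ hx',
    extC_of_mem _ hx']
  simp only [rtC, coshC, sinhC, ContinuousMap.coe_mk, ContinuousMap.mul_apply, smul_eq_mul]

/-- The inversion formula with the weight `√(1 - s²)`, for `f ∈ L²_m(I)`. -/
theorem ae_inversion_rt (μ : ℂ) {f : ℝ → ℂ} {h : LpT}
    (hf : (fun x => (rt x : ℂ) * f x) =ᵐ[measureT] h) :
    ∀ᵐ t : ℝ ∂(volume.restrict (Ioo (-1 : ℝ) 1)), ∃ A B : ℂ,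
      HasPV (invIntegrand μ f (fun s => coshR μ s * rt s) t) t (Real.pi * A) ∧
      HasPV (invIntegrand μ f (sinhR μ) t) t (Real.pi * B) ∧
      f t = coshR μ t / rt t * (A + 1 / (Real.pi : ℂ) * moment μ f) - sinhR μ t * B := by
  have h1 := ae_hasPV_invIntegrand μ hf (w := fun s => coshR μ s * rt s) (c := coshC μ)
    fun x hx => by
      rw [extC_of_mem _ (Ioo_subset_Icc_self hx)]
      simp only [coshC, ContinuousMap.coe_mk]
      ring
  have h2 := ae_hasPV_invIntegrand μ hf (w := sinhR μ) (c := sincC μ) fun x hx => by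
      have e := congrArg (fun g => extC g x) (rtC_mul_sincC μ)
      simp only [extC_of_mem _ (Ioo_subset_Icc_self hx)] at e ⊢
      simp only [rtC, sinhC, ContinuousMap.coe_mk, ContinuousMap.mul_apply] at e
      rw [← e]
      ring
  have h3 := coeFn_hilbS_coshC μ hf
  have h4 := coeFn_hilbS_sincC μ h
  rw [EventuallyEq, ae_measureT] at h3 h4 hf
  filter_upwards [h1, h2, h3, h4, hf, ae_restrict_mem measurableSet_Ioo] with t e1 e2 e3 e4 e5 ht
  refine ⟨_, _, by rw [mul_neg]; exact e1, by rw [mul_neg]; exact e2, ?_⟩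
  have hr := ofReal_rt_ne_zero ht
  -- The contributions of `sinhS` cancel between the two inner transforms, leaving `f(t) (cosh² -
  -- sinh²)` once the moment is moved across.
  have hcs : coshR μ t ^ 2 - sinhR μ t ^ 2 = 1 := Complex.cosh_sq_sub_sinh_sq _
  rw [e3, e4, ← e5]
  field_simp
  linear_combination (-(f t) * rt t ^ 2 * Real.pi) * hcs

/-! ### The transform of functions in `L²_d` -/

/-- The commutator has the constant kernel `(x - s) / (π(x - s)) = 1 / π`. -/
theorem xC_mul_hilbT_sub : mulOp xC * hilbT - hilbT * mulOp xC
    = (1 / (Real.pi : ℂ)) • (meanT * mulOp rtC) := by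
  refine ext_of_sin fun n => ?_
  have hpi : (Real.pi : ℂ) ≠ 0 := Complex.ofReal_ne_zero.mpr Real.pi_ne_zero
  change mulOp xC (hilbT (emb (rtC * uC n))) - hilbT (mulOp xC (emb (rtC * uC n)))
    = (1 / (Real.pi : ℂ)) • (meanT (mulOp rtC (emb (rtC * uC n))))
  have e3 := two_tC_mul_tC (n + 1) 1
  rw [tC_one, mul_comm] at e3
  have e4 : (2 : ℂ) • (xC * uC n) = uC (n + 1) + uC (n - 1) := by
    ext x
    have := congrArg (Polynomial.eval (x : ℝ)) (Polynomial.Chebyshev.U_add_one ℝ n)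
    simp only [Polynomial.eval_mul, Polynomial.eval_sub, Polynomial.eval_ofNat,
      Polynomial.eval_X] at this
    simp only [xC, uC, ContinuousMap.smul_apply, ContinuousMap.add_apply,
      ContinuousMap.mul_apply, ContinuousMap.coe_mk, smul_eq_mul]
    rw [this]; push_cast; ring
  have e5 : emb (xC * (rtC * uC n)) = (1 / 2 : ℂ) •
      (emb (rtC * uC (n + 1)) + emb (rtC * uC (n - 1))) := by
    rw [← emb_add, ← mul_add, ← e4, mul_smul_comm, emb_smul, smul_smul, mul_left_comm]
    norm_num
  have e6 := two_rtC_sq_mul_uC_mul_uC n 0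
  rw [uC_zero, mul_one, pow_two, mul_assoc] at e6
  rw [hilbT_sin, mulOp_emb, mulOp_emb, mulOp_emb, emb_two_smul e3, e5, emb_two_smul e6, map_smul,
    map_add, hilbT_rtC_mul_uC _ (by omega), hilbT_rtC_mul_uC _ (by omega), meanT_apply, map_smul,
    emb_add, emb_sub, map_sub, intT_emb_tC, intT_emb_tC, if_neg (show ¬ (n : ℤ) + 1 = -1 by omega),
    if_neg (show ¬ (n : ℤ) + 0 + 2 = 0 by omega)]
  rw [show (n : ℤ) + 1 - 1 = n by ring, sub_add_cancel]
  rcases n with _ | n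
  · simp
    rw [smul_smul]
    have : (Real.pi : ℂ)⁻¹ * (2⁻¹ * Real.pi) = 2⁻¹ := by field_simp
    rw [this]
    module
  · rw [if_neg (by push_cast; omega), if_neg (by push_cast; omega)]
    simp

/-- The operator `H_μ` on `L²_d(I)`. -/
def coshT (μ : ℂ) : LpT →L[ℂ] LpT :=
  (1 / 2 : ℂ) • (mulOp (expC μ) * hilbT * mulOp (expC (-μ))
    + mulOp (expC (-μ)) * hilbT * mulOp (expC μ))

/-- For `f ∈ L²_d(I)` the transform itself lies in `LpT`, so `F_μ cosh(iμr) / √(1 - s²)` is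
integrable. This permits the passage to the weight `q / √(1 - s²)`. -/
theorem coshFHT_ae_of_ld (μ : ℂ) {f : ℝ → ℂ} {h : LpT} (hf : f =ᵐ[measureT] h) :
    coshFHT μ f =ᵐ[measureT] coshT μ h := by
  have hpi : (Real.pi : ℂ) ≠ 0 := Complex.ofReal_ne_zero.mpr Real.pi_ne_zero
  have key : ∀ c, (fun x => extC c x * f x) =ᵐ[measureT] mulOp c h := fun c => by
    filter_upwards [hf, coeFn_mulOp c h] with x h1 h2
    rw [h2, ← h1]
  have h0 := coeFn_exp_conj hilbT μ h
  rw [EventuallyEq, ae_measureT] at h0 ⊢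
  filter_upwards [ae_hasPV_hilbT (key (expC (-μ))), ae_hasPV_hilbT (key (expC μ)), h0]
    with s h1 h2 h3
  have h4 := (((h1.const_mul (Complex.exp (μ * s))).const_mul (1 / 2)).add
    ((h2.const_mul (Complex.exp (-μ * s))).const_mul (1 / 2))).congr
    (g := coshIntegrand μ f s) fun t ht _ => (coshIntegrand_eq μ f ht).symm
  rw [coshFHT, h4.pv_eq, coshT, h3]
  field_simp

/-! ### Integrals of the weighted transform and the moment -/

/-- Antisymmetry applied to `e^{-νx} h`. The result is odd in `ν`, hence disappears in the average
over `±μ` that forms `coshT`. -/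
theorem intT_coshC_hilbT (ν : ℂ) (h : LpT) :
    intT (mulOp (coshC ν) (mulOp (expC ν) (hilbT (mulOp (expC (-ν)) h))))
      = -(I * intT (mulOp (sinhC ν) h)) := by
  have h1 := congrArg (fun A : LpT →L[ℂ] ℂ => A (mulOp (expC (-ν)) h)) (antisymm_exp_cosh ν)
  have e1 : mulOp (coshC ν) * mulOp (expC ν) = mulOp (expC ν * coshC ν) := by
    rw [mul_comm (expC ν), map_mul]
  have e2 : mulOp (I • (expC ν * sinhC ν)) * mulOp (expC (-ν)) = I • mulOp (sinhC ν) := by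
    rw [← map_mul, ← map_smul]
    congr 1
    rw [smul_mul_assoc, mul_right_comm, expC_mul_expC_neg, one_mul]
  have e1' := congrArg (fun A : LpT →L[ℂ] LpT => A (hilbT (mulOp (expC (-ν)) h))) e1
  have e2' := congrArg (fun A : LpT →L[ℂ] LpT => A h) e2
  refine (congrArg intT e1').trans (h1.trans ?_)
  refine (congrArg (fun z => -intT z) e2').trans ?_
  change -intT (I • mulOp (sinhC ν) h) = _
  rw [map_smul, smul_eq_mul]

/-- Moving `x` through the transform adds a rank-one term to the previous identity. After averaging
over `±μ`, only that term survives, and it is the moment. -/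
theorem intT_xC_coshC_hilbT (ν : ℂ) (h : LpT) :
    intT (mulOp xC (mulOp (coshC ν) (mulOp (expC ν) (hilbT (mulOp (expC (-ν)) h)))))
      = -(I * intT (mulOp (sinhC ν) (mulOp xC h))) + intT (mulOp rtC (mulOp (expC (-ν)) h)) := by
  have hpi : (Real.pi : ℂ) ≠ 0 := Complex.ofReal_ne_zero.mpr Real.pi_ne_zero
  have comm : ∀ (c d : C(Icc (-1 : ℝ) 1, ℂ)) (k : LpT), mulOp c (mulOp d k) = mulOp d (mulOp c k) :=
    fun c d k => by
      change (mulOp c * mulOp d) k = (mulOp d * mulOp c) k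
      rw [← map_mul, mul_comm, map_mul]
  have h1 := congrArg (fun A : LpT →L[ℂ] LpT => A (mulOp (expC (-ν)) h)) xC_mul_hilbT_sub
  change mulOp xC (hilbT (mulOp (expC (-ν)) h)) - hilbT (mulOp xC (mulOp (expC (-ν)) h))
    = (1 / (Real.pi : ℂ)) • meanT (mulOp rtC (mulOp (expC (-ν)) h)) at h1
  rw [sub_eq_iff_eq_add, comm xC (expC (-ν)), meanT_apply] at h1
  have h2 : mulOp (coshC ν) (mulOp (expC ν) oneT) = emb (expC ν * coshC ν) := by
    change mulOp (coshC ν) (emb (expC ν)) = _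
    rw [mulOp_emb, mul_comm]
  rw [comm xC (coshC ν), comm xC (expC ν), h1, map_add, map_add, map_add, intT_coshC_hilbT,
    map_smul, map_smul, map_smul, map_smul, map_smul, map_smul, h2, (intT_exp_cosh ν).1]
  simp only [smul_eq_mul]
  field_simp
  ring

theorem intT_coshC_coshT (μ : ℂ) (h : LpT) : intT (mulOp (coshC μ) (coshT μ h)) = 0 := by
  have h1 := intT_coshC_hilbT μ h
  have h2 := intT_coshC_hilbT (-μ) h
  rw [coshC_neg, sinhC_neg, neg_neg, map_neg] at h2
  change intT (mulOp (coshC μ) ((1 / 2 : ℂ) • (mulOp (expC μ) (hilbT (mulOp (expC (-μ)) h))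
    + mulOp (expC (-μ)) (hilbT (mulOp (expC μ) h))))) = 0
  rw [map_smul, map_smul, map_add, map_add, h1, h2]
  change (1 / 2 : ℂ) • (_ + -(I * intT (-(mulOp (sinhC μ) h)))) = 0
  rw [map_neg, smul_eq_mul]
  ring

theorem intT_xC_coshC_coshT (μ : ℂ) (h : LpT) :
    intT (mulOp xC (mulOp (coshC μ) (coshT μ h)))
      = 1 / 2 * (intT (mulOp (expC μ) (mulOp rtC h)) + intT (mulOp (expC (-μ)) (mulOp rtC h))) := by
  have comm : ∀ (c d : C(Icc (-1 : ℝ) 1, ℂ)) (k : LpT), mulOp c (mulOp d k) = mulOp d (mulOp c k) :=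
    fun c d k => by
      change (mulOp c * mulOp d) k = (mulOp d * mulOp c) k
      rw [← map_mul, mul_comm, map_mul]
  have h1 := intT_xC_coshC_hilbT μ h
  have h2 := intT_xC_coshC_hilbT (-μ) h
  rw [coshC_neg, sinhC_neg, neg_neg, map_neg] at h2
  change intT (mulOp xC (mulOp (coshC μ) ((1 / 2 : ℂ) • (mulOp (expC μ)
    (hilbT (mulOp (expC (-μ)) h)) + mulOp (expC (-μ)) (hilbT (mulOp (expC μ) h)))))) = _
  rw [map_smul, map_smul, map_smul, map_add, map_add, map_add, h1, h2]
  change (1 / 2 : ℂ) • (_ + (-(I * intT (-(mulOp (sinhC μ) (mulOp xC h)))) + _)) = _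
  rw [map_neg, smul_eq_mul, comm rtC, comm rtC]
  ring

/-! ### The inversion formulas with a quadratic weight -/

theorem MemLm.exists_coe {f : ℝ → ℂ} (hf : MemLm f) :
    ∃ h : LpT, (fun x => (rt x : ℂ) * f x) =ᵐ[measureT] h :=
  ⟨(memLm_iff.mp hf).toLp _, (memLm_iff.mp hf).coeFn_toLp.symm⟩

/-- Going from `√(1 - s²)` to `q / √(1 - s²)` means dividing by `1 - s²` and multiplying by `q`.
With `∫ g = 0` and `∫ s g` the moment, the division replaces `A` by `A + moment / π`, and the
multiplication adds `α · moment / π`. -/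
theorem hasPV_invIntegrand_of_memLd (μ α β γ : ℂ) {f : ℝ → ℂ} (hf : MemLd f) {t : ℝ}
    (ht : t ∈ Ioo (-1 : ℝ) 1) {A : ℂ}
    (hA : HasPV (invIntegrand μ f (fun s => coshR μ s * rt s) t) t (Real.pi * A)) :
    HasPV (invIntegrand μ f (fun s => coshR μ s * (quad α β γ s / rt s)) t) t
      (Real.pi * (quad α β γ t * (A + 1 / (Real.pi : ℂ) * moment μ f) / (rt t : ℂ) ^ 2
        + α * (1 / (Real.pi : ℂ) * moment μ f))) := by
  have hpi : (Real.pi : ℂ) ≠ 0 := Complex.ofReal_ne_zero.mpr Real.pi_ne_zero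
  set h : LpT := (memLd_iff.mp hf).toLp f
  have hfh : f =ᵐ[measureT] h := (memLd_iff.mp hf).coeFn_toLp.symm
  have hm : moment μ f = intT (mulOp xC (mulOp (coshC μ) (coshT μ h))) := by
    rw [intT_xC_coshC_coshT]
    refine moment_eq μ ?_
    filter_upwards [hfh, coeFn_mulOp rtC h, ae_measureT_mem] with x h1 h2 hx
    rw [h1, h2, extC_of_mem _ (Ioo_subset_Icc_self hx)]
    rfl
  set g : ℝ → ℂ := fun s => coshFHT μ f s * coshR μ s / rt s with hg
  have hrg : (fun x => (rt x : ℂ) * g x) =ᵐ[measureT] mulOp (coshC μ) (coshT μ h) := by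
    filter_upwards [coshFHT_ae_of_ld μ hfh, coeFn_mulOp (coshC μ) (coshT μ h), ae_measureT_mem]
      with x h1 h2 hx
    have hr := ofReal_rt_ne_zero hx
    rw [h2, extC_of_mem _ (Ioo_subset_Icc_self hx), hg, ← h1]
    simp only [coshC, ContinuousMap.coe_mk]
    field_simp
  have hgi := integrableOn_of_rt_mul hrg
  have e1 : ∫ s in Ioo (-1 : ℝ) 1, g s = 0 := by
    rw [← integral_rt_mul, integral_congr_ae hrg, ← intT_apply, intT_coshC_coshT]
  have e2 : ∫ s in Ioo (-1 : ℝ) 1, (s : ℂ) * g s = moment μ f := by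
    rw [hm, ← integral_rt_mul, intT_apply]
    refine integral_congr_ae ?_
    filter_upwards [rt_mul_extC_mul hrg xC, ae_measureT_mem] with x h1 hx
    rw [← h1, extC_of_mem _ (Ioo_subset_Icc_self hx)]
    rfl
  have h1 := HasPV.div_one_sub_sq hgi ht ((hA.const_mul (-1)).congr fun s hs hst => by
    have h2 : (t : ℂ) - s ≠ 0 := sub_ne_zero.mpr fun h => hst (Complex.ofReal_injective h).symm
    have h3 : (s : ℂ) - t ≠ 0 := by rwa [← neg_ne_zero, neg_sub]
    have hr := ofReal_rt_ne_zero hs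
    rw [invIntegrand, hg]
    field_simp
    ring)
  have h2 := ((HasPV.quad_mul hgi h1 α β γ).const_mul (-1)).congr
    (g := invIntegrand μ f (fun s => coshR μ s * (quad α β γ s / rt s)) t) fun s hs hst => by
    have h2 : (t : ℂ) - s ≠ 0 := sub_ne_zero.mpr fun h => hst (Complex.ofReal_injective h).symm
    have h3 : (s : ℂ) - t ≠ 0 := by rwa [← neg_ne_zero, neg_sub]
    have hr := ofReal_rt_ne_zero hs
    rw [invIntegrand, hg]
    field_simp
    ring
  have hr := ofReal_rt_ne_zero ht
  convert! h2 using 1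
  rw [e1, e2]
  field_simp
  ring

/-- Vanishing at both endpoints forces `q = -α(1 - s²)`, so the weight is only rescaled. The moment
is written in so that the value has the form of the `L²_d` case; its two occurrences cancel. -/
theorem hasPV_invIntegrand_of_memLm (μ α β γ : ℂ) {f : ℝ → ℂ} (h1 : quad α β γ (-1) = 0)
    (h2 : quad α β γ 1 = 0) {t : ℝ} (ht : t ∈ Ioo (-1 : ℝ) 1) {A : ℂ}
    (hA : HasPV (invIntegrand μ f (fun s => coshR μ s * rt s) t) t (Real.pi * A)) :
    HasPV (invIntegrand μ f (fun s => coshR μ s * (quad α β γ s / rt s)) t) t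
      (Real.pi * (quad α β γ t * (A + 1 / (Real.pi : ℂ) * moment μ f) / (rt t : ℂ) ^ 2
        + α * (1 / (Real.pi : ℂ) * moment μ f))) := by
  have hq : ∀ s ∈ Ioo (-1 : ℝ) 1, quad α β γ s = -α * (rt s : ℂ) ^ 2 := by
    intro s hs
    rw [ofReal_rt_sq (Ioo_subset_Icc_self hs)]
    simp only [quad, Complex.ofReal_neg, Complex.ofReal_one] at h1 h2 ⊢
    -- The difference `q + α(1 - s²)` is affine, hence given by linear interpolation of its values
    -- at `±1`.
    linear_combination (1 / 2 - (s : ℂ) / 2) * h1 + (1 / 2 + (s : ℂ) / 2) * h2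
  have e := (hA.const_mul (-α)).congr
    (g := invIntegrand μ f (fun s => coshR μ s * (quad α β γ s / rt s)) t) fun s hs _ => by
    have hr := ofReal_rt_ne_zero hs
    rw [invIntegrand, invIntegrand, hq s hs]
    field_simp
  have hr := ofReal_rt_ne_zero ht
  convert! e using 1
  rw [hq t ht]
  field_simp
  ring

/-- The inversion formulas, multiplied by the quadratic weight. -/
theorem ae_inversion_quad (μ α β γ : ℂ) {f : ℝ → ℂ}
    (hf : MemLd f ∨ (MemLm f ∧ quad α β γ (-1) = 0 ∧ quad α β γ 1 = 0)) :
    ∀ᵐ t : ℝ ∂(volume.restrict (Ioo (-1 : ℝ) 1)),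
      PVExists (invIntegrand μ f (fun s => coshR μ s * (quad α β γ s / rt s)) t) t ∧
      PVExists (invIntegrand μ f (sinhR μ) t) t ∧
      quad α β γ t * f t = rt t * coshR μ t *
          (invTerm μ f (fun s => coshR μ s * (quad α β γ s / rt s)) t
            - α * (1 / (Real.pi : ℂ) * moment μ f))
        - quad α β γ t * (sinhR μ t * invTerm μ f (sinhR μ) t) := by
  have hpi : (Real.pi : ℂ) ≠ 0 := Complex.ofReal_ne_zero.mpr Real.pi_ne_zero
  have hm : MemLm f := hf.elim MemLd.memLm fun h => h.1
  obtain ⟨h, hh⟩ := hm.exists_coe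
  filter_upwards [ae_inversion_rt μ hh, ae_restrict_mem measurableSet_Ioo]
    with t ⟨A, B, h1, h2, h3⟩ ht
  have h4 : HasPV (invIntegrand μ f (fun s => coshR μ s * (quad α β γ s / rt s)) t) t
      (Real.pi * (quad α β γ t * (A + 1 / (Real.pi : ℂ) * moment μ f) / (rt t : ℂ) ^ 2
        + α * (1 / (Real.pi : ℂ) * moment μ f))) := by
    rcases hf with hd | ⟨-, hl, hr⟩
    · exact hasPV_invIntegrand_of_memLd μ α β γ hd ht h1
    · exact hasPV_invIntegrand_of_memLm μ α β γ hl hr ht h1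
  refine ⟨h4.pvExists, h2.pvExists, ?_⟩
  have hr := ofReal_rt_ne_zero ht
  rw [invTerm, invTerm, h4.pv_eq, h2.pv_eq, h3]
  field_simp
  ring

/-- By continuity it would vanish also at the endpoint `1`, where its value is `cosh 0 = 1`. -/
theorem not_ae_coshR_eq_zero (μ : ℂ) :
    ¬ ∀ᵐ t : ℝ ∂(volume.restrict (Ioo (-1 : ℝ) 1)), coshR μ t = 0 := by
  intro h
  have hc : Continuous (coshR μ) := by have := continuous_rt; unfold coshR; fun_prop
  have h1 : EqOn (coshR μ) (fun _ => 0) (Ioo (-1 : ℝ) 1) :=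
    Measure.eqOn_open_of_ae_eq h isOpen_Ioo hc.continuousOn continuousOn_const
  have h2 := h1.closure hc continuous_const
  rw [closure_Ioo (by norm_num)] at h2
  have h3 := h2 (right_mem_Icc.mpr (by norm_num : (-1 : ℝ) ≤ 1))
  simp [coshR, rt] at h3

end CoshFHT

end

/-! ### The main theorem -/

theorem mainTheorem5 (μ α β γ : ℂ) :
    -- the principal value identity with the weight `(αs² + βs + γ) / √(1 - s²)`
    (∀ t ∈ Ioo (-1 : ℝ) 1, ∀ u ∈ Ioo (-1 : ℝ) 1,
      CoshFHT.PVExists (fun s : ℝ => Complex.cosh (μ * (u - s)) / (t - s) *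
          (CoshFHT.quad α β γ s / CoshFHT.rt s) * CoshFHT.coshR μ s) t ∧
      1 / (Real.pi : ℂ) * CoshFHT.pv (fun s : ℝ => Complex.cosh (μ * (u - s)) / (t - s) *
          (CoshFHT.quad α β γ s / CoshFHT.rt s) * CoshFHT.coshR μ s) t =
        Complex.I * Complex.sinh (μ * (t - u)) * CoshFHT.sinhR μ t *
            (CoshFHT.quad α β γ t / CoshFHT.rt t)
          - (α * t + β) * Complex.cosh (μ * u) + α * μ / 2 * Complex.sinh (μ * u)) ∧
    -- the family of inversion formulas
    ((∀ t ∈ Ioo (-1 : ℝ) 1, CoshFHT.quad α β γ t ≠ 0) →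
      ∀ f : ℝ → ℂ,
        (CoshFHT.MemLd f ∨
          (CoshFHT.MemLm f ∧ CoshFHT.quad α β γ (-1) = 0 ∧ CoshFHT.quad α β γ 1 = 0)) →
        (∀ᵐ s : ℝ ∂(volume.restrict (Ioo (-1 : ℝ) 1)),
          CoshFHT.PVExists (CoshFHT.coshIntegrand μ f s) s) ∧
        IntegrableOn (fun t : ℝ => Complex.cosh (μ * t) * f t) (Ioo (-1 : ℝ) 1) ∧
        (∀ᵐ t : ℝ ∂(volume.restrict (Ioo (-1 : ℝ) 1)),
          CoshFHT.PVExists (CoshFHT.invIntegrand μ f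
            (fun s => CoshFHT.coshR μ s * (CoshFHT.quad α β γ s / CoshFHT.rt s)) t) t ∧
          CoshFHT.PVExists (CoshFHT.invIntegrand μ f (CoshFHT.sinhR μ) t) t ∧
          f t =
            CoshFHT.rt t / CoshFHT.quad α β γ t * CoshFHT.coshR μ t *
                CoshFHT.invTerm μ f
                  (fun s => CoshFHT.coshR μ s * (CoshFHT.quad α β γ s / CoshFHT.rt s)) t
              - α * CoshFHT.rt t / CoshFHT.quad α β γ t * CoshFHT.coshR μ t *
                (1 / (Real.pi : ℂ) * CoshFHT.moment μ f)
              - CoshFHT.sinhR μ t * CoshFHT.invTerm μ f (CoshFHT.sinhR μ) t) ∧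
        -- for `α ≠ 0` the moment term can be left out only when the moment vanishes
        (α ≠ 0 →
          ((∀ᵐ t : ℝ ∂(volume.restrict (Ioo (-1 : ℝ) 1)),
            f t =
              CoshFHT.rt t / CoshFHT.quad α β γ t * CoshFHT.coshR μ t *
                  CoshFHT.invTerm μ f
                    (fun s => CoshFHT.coshR μ s * (CoshFHT.quad α β γ s / CoshFHT.rt s)) t
                - CoshFHT.sinhR μ t * CoshFHT.invTerm μ f (CoshFHT.sinhR μ) t) ↔
            CoshFHT.moment μ f = 0))) ∧
    -- the two moment-free formulas, `σ = 1` and `σ = -1`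
    (∀ σ : ℝ, (σ = 1 ∨ σ = -1) → ∀ f : ℝ → ℂ, CoshFHT.MemLd f →
      (∀ᵐ s : ℝ ∂(volume.restrict (Ioo (-1 : ℝ) 1)),
        CoshFHT.PVExists (CoshFHT.coshIntegrand μ f s) s) ∧
      (∀ᵐ t : ℝ ∂(volume.restrict (Ioo (-1 : ℝ) 1)),
        CoshFHT.PVExists (CoshFHT.invIntegrand μ f
          (fun s => CoshFHT.coshR μ s * (CoshFHT.rt s / (1 + σ * s))) t) t ∧
        CoshFHT.PVExists (CoshFHT.invIntegrand μ f (CoshFHT.sinhR μ) t) t ∧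
        f t =
          (1 + σ * t) / CoshFHT.rt t * CoshFHT.coshR μ t *
              CoshFHT.invTerm μ f
                (fun s => CoshFHT.coshR μ s * (CoshFHT.rt s / (1 + σ * s))) t
            - CoshFHT.sinhR μ t * CoshFHT.invTerm μ f (CoshFHT.sinhR μ) t)) := by
  open CoshFHT in
  have hpi : (Real.pi : ℂ) ≠ 0 := Complex.ofReal_ne_zero.mpr Real.pi_ne_zero
  have hF : ∀ f, MemLm f → ∀ᵐ s : ℝ ∂(volume.restrict (Ioo (-1 : ℝ) 1)),
      PVExists (coshIntegrand μ f s) s := fun f hf => by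
    obtain ⟨h, hh⟩ := hf.exists_coe
    filter_upwards [ae_hasPV_coshIntegrand μ hh] with s hs using hs.pvExists
  refine ⟨fun t ht u _ => ?_, fun hq f hf => ?_, fun σ hσ f hf => ⟨hF f hf.memLm, ?_⟩⟩
  · have h := hasPV_cosh_mul_quad μ α β γ ht u
    refine ⟨h.pvExists, ?_⟩
    rw [h.pv_eq, one_div, inv_mul_cancel_left₀ hpi]
  · have hm : MemLm f := hf.elim MemLd.memLm fun h => h.1
    obtain ⟨h, hh⟩ := hm.exists_coe
    have hinv := ae_inversion_quad μ α β γ hf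
    have hform : ∀ᵐ t : ℝ ∂(volume.restrict (Ioo (-1 : ℝ) 1)), f t =
        rt t / quad α β γ t * coshR μ t *
            invTerm μ f (fun s => coshR μ s * (quad α β γ s / rt s)) t
          - α * rt t / quad α β γ t * coshR μ t * (1 / (Real.pi : ℂ) * moment μ f)
          - sinhR μ t * invTerm μ f (sinhR μ) t := by
      filter_upwards [hinv, ae_restrict_mem measurableSet_Ioo] with t h1 ht
      have h2 := hq t ht
      refine mul_left_cancel₀ h2 (h1.2.2.trans ?_)
      field_simp
    refine ⟨hF f hm, integrableOn_cosh_mul μ (integrableOn_of_rt_mul hh), ?_, fun hα => ⟨?_, ?_⟩⟩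
    · filter_upwards [hinv, hform] with t h1 h2 using ⟨h1.1, h1.2.1, h2⟩
    -- Subtracting the two formulas leaves a multiple of the moment by `cosh(iμ√(1 - t²))` with
    -- nowhere vanishing cofactor.
    · intro h1
      by_contra hne
      refine not_ae_coshR_eq_zero μ ?_
      filter_upwards [hform, h1, ae_restrict_mem measurableSet_Ioo] with t h2 h3 ht
      have hr := ofReal_rt_ne_zero ht
      have h4 := hq t ht
      have h5 : α * rt t / quad α β γ t * coshR μ t * (1 / (Real.pi : ℂ) * moment μ f) = 0 := by
        linear_combination h2 - h3
      simpa [hα, hr, h4, hpi, hne] using h5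
    · intro h1
      filter_upwards [hform] with t h2
      rw [h1, mul_zero, mul_zero, sub_zero] at h2
      exact h2
  · have hσ2 : (σ : ℂ) ^ 2 = 1 := by
      rcases hσ with rfl | rfl <;> simp
    -- From `1 - s² = (1 + σs)(1 - σs)`, the quadratic `q = 1 - σs` has `q / √(1 - s²) = √(1 - s²) /
    -- (1 + σs)`. Its leading coefficient is `0`, so the moment drops out.
    have hr2 : ∀ s ∈ Ioo (-1 : ℝ) 1,
        (rt s : ℂ) ^ 2 = (1 + σ * s) * quad 0 (-σ) 1 s := fun s hs => by
      rw [ofReal_rt_sq (Ioo_subset_Icc_self hs), quad]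
      linear_combination (s : ℂ) ^ 2 * hσ2
    have hw : ∀ t, ∀ s ∈ Ioo (-1 : ℝ) 1,
        invIntegrand μ f (fun s => coshR μ s * (quad 0 (-σ) 1 s / rt s)) t s
          = invIntegrand μ f (fun s => coshR μ s * (rt s / (1 + σ * s))) t s := by
      intro t s hs
      have h1 := hr2 s hs
      have hr := ofReal_rt_ne_zero hs
      have h2 : (1 + σ * s : ℂ) ≠ 0 := left_ne_zero_of_mul (h1 ▸ pow_ne_zero 2 hr)
      have h3 : quad 0 (-σ) 1 s / rt s = rt s / (1 + σ * s : ℂ) := by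
        rw [div_eq_div_iff hr h2, mul_comm, ← h1, pow_two]
      simp only [invIntegrand, h3]
    filter_upwards [ae_inversion_quad μ 0 (-σ) 1 (Or.inl hf), ae_restrict_mem measurableSet_Ioo]
      with t ⟨⟨h1, L, h2⟩, h3, h4⟩ ht
    have h5 := HasPV.congr (show HasPV _ t L from ⟨h1, h2⟩) fun s hs _ => hw t s hs
    have h6 : invTerm μ f (fun s => coshR μ s * (quad 0 (-σ) 1 s / rt s)) t
        = invTerm μ f (fun s => coshR μ s * (rt s / (1 + σ * s))) t := by
      rw [invTerm, invTerm, h5.pv_eq, HasPV.pv_eq (show HasPV _ t L from ⟨h1, h2⟩)]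
    refine ⟨h5.pvExists, h3, ?_⟩
    have h7 := hr2 t ht
    have hr := ofReal_rt_ne_zero ht
    have h8 : quad 0 (-σ) 1 t ≠ 0 := right_ne_zero_of_mul (h7 ▸ pow_ne_zero 2 hr)
    refine mul_left_cancel₀ h8 (h4.trans ?_)
    rw [h6, zero_mul, sub_zero, mul_sub]
    generalize invTerm μ f (fun s => coshR μ s * (rt s / (1 + σ * s))) t = X
    congr 1
    field_simp
    linear_combination (coshR μ t * X) * h7
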